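/- Write $\langle z\rangle=(1+|z|^2)^{1/2}$. For $\beta\in\mathbb R$ let $S^\beta$ (resp. $S^\beta_+$) be the set of smooth $f:\mathbb R\to\mathbb C$ (resp. $f:[0,\infty)\to\mathbb C$, with one-sided derivatives at $0$) such that for every $n\ge 0$ there is $c_n>0$ with $|f^{(n)}(x)|\le c_n\langle x\rangle^{\beta-n}$ for all $x$. Let $\mathcal A=\bigcup_{\beta<0}S^\beta$ and $\mathcal A^+=\bigcup_{\beta<0}S^\beta_+$, which are algebras under pointwise operations, and put $\|f\|_{\mathcal A^+_n}=\sum_{r=0}^n\int_0^\infty|f^{(r)}(x)|\langle x\rangle^{r-1}dx$. Let $\tau:\mathbb R^2\to\mathbb C$ be an admissible cut-off: smooth, $\tau(x,y)=1$ if $|y|\le\langle x\rangle$, $\tau(x,y)=0$ if $|y|\ge 2\langle x\rangle$, with first partial derivatives bounded by $C\langle x\rangle^{-1}$ for some constant $C$ (for example $\tau(x,y)=\chi(y/\langle x\rangle)$ with $\chi$ smooth, $\chi=1$ on $[-1,1]$, $\chi=0$ off $(-2,2)$). For $f\in\mathcal A$ and $n\ge 0$ let $$\tilde f(x,y)=\Big(\sum_{r=0}^n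 f^{(r)}(x)\frac{(iy)^r}{r!}\Big)\tau(x,y),\qquad \frac{\partial\tilde f}{\partial\bar z}=\frac12\Big(\frac{\partial\tilde f}{\partial x}+i\frac{\partial\tilde f}{\partial y}\Big).$$ Seeley data consist of real sequences $(a_k)_{k\ge0},(b_k)_{k\ge0}$ with $b_k<0$, $b_k\to-\infty$, $\sum_k|a_k||b_k|^n<\infty$ and $\sum_k a_kb_k^n=1$ for all integers $n\ge0$, and a smooth $\phi:\mathbb R\to\mathbb C$ with $\phi=1$ on $[0,1]$ and $\phi(x)=0$ for $x\ge2$ and for $x\le-1$. The Seeley extension of $f:[0,\infty)\to\mathbb C$ is $(\mathcal Ef)(x)=f(x)$ for $x\ge0$ and $(\mathcal Ef)(x)=\sum_k a_k\phi(b_kx)f(b_kx)$ for $x<0$. **Theorem.** Let $H$ be a closed, densely defined linear operator on a complex Banach space $\mathcal B$ with spectrum $\sigma(H)\subseteq[0,\infty)$, and suppose that for some $\alpha\ge0$ and $c$ $$\|(z-H)^{-1}\|\le c\,|\mathrm{Im}\,z|^{-1}\Big(\frac{\langle z\rangle}{|\mathrm{Im}\,z|}\Big)^{\alpha}\qquad(z\notin\mathbb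 R).$$ Then there is a functional calculus $\gamma_H:\mathcal A^+\to\mathcal L(\mathcal B)$, that is, a homomorphism of complex algebras with the following properties. 1. Seeley data exist. For any Seeley data, $\mathcal E$ is a linear map $\mathcal A^+\to\mathcal A$ with $(\mathcal Ef)|_{[0,\infty)}=f$, and for every $f\in\mathcal A^+$, every integer $n>\alpha$ and every admissible cut-off $\tau$ the following integral (of the almost analytic extension of $F=\mathcal Ef$) is norm convergent and $$\gamma_H(f)=-\frac1\pi\iint_{\mathbb C}\frac{\partial\tilde F}{\partial\bar z}(z-H)^{-1}\,dx\,dy .$$ 2. Admissible cut-offs exist. For every $f\in\mathcal A$, every integer $n>\alpha$ and every admissible $\tau$, the following integral is norm convergent and $$\gamma_H\big(f|_{[0,\infty)}\big)=-\frac1\pi\iint_{\mathbb C}\frac{\partial\tilde f}{\partial\bar z}(z-H)^{-1}\,dx\,dy .$$ 3. For every integer $n>\alpha$ there is a constant $c_n'$ with $\|\gamma_H(f)\|\le c_n'\|f\|_{\mathcal A^+_{n+1}}$ for all $f\in\mathcal A^+$. 4. If $f\in\mathcal A^+$ has compact support (in $[0,\infty)$) disjoint from $\sigma(H)$, then $\gamma_H(f)=0$.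 5. If $z\notin\mathbb R$ and $g_z(x)=(z-x)^{-1}$ for $x\ge0$, then $g_z\in\mathcal A^+$ and $\gamma_H(g_z)=(z-H)^{-1}$. -/

import Mathlib

open scoped ContDiff

noncomputable section

namespace HalfLineCalculus

/-- The bracket `⟨z⟩ = (1 + |z|²)^{1/2}`, for real or complex `z`. -/
def bracket {E : Type*} [Norm E] (z : E) : ℝ := Real.sqrt (1 + ‖z‖ ^ 2)

theorem one_le_bracket {E : Type*} [Norm E] (z : E) : 1 ≤ bracket z := by
  unfold bracket
  rw [Real.one_le_sqrt]
  nlinarith [sq_nonneg ‖z‖]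

theorem bracket_pos {E : Type*} [Norm E] (z : E) : 0 < bracket z :=
  lt_of_lt_of_le one_pos (one_le_bracket z)

/-! ### The algebras of slowly decreasing functions -/

/-- `f` is smooth on `s` and `|f⁽ⁿ⁾(x)| ≤ cₙ ⟨x⟩^(β - n)` on `s` for every `n`.
For `s = ℝ` this is the class `S^β`; for `s = [0, ∞)` (derivatives at `0` being one-sided) it is
the class `S^β_+`. -/
def IsSymbolOn (s : Set ℝ) (β : ℝ) (f : ℝ → ℂ) : Prop :=
  ContDiffOn ℝ ∞ f s ∧
    ∀ n : ℕ, ∃ c : ℝ, 0 < c ∧ ∀ x ∈ s, ‖iteratedDerivWithin n f s x‖ ≤ c * bracket x ^ (β - n)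

theorem IsSymbolOn.mono {s : Set ℝ} {β β' : ℝ} {f : ℝ → ℂ} (h : IsSymbolOn s β f)
    (hβ : β ≤ β') : IsSymbolOn s β' f := by
  refine ⟨h.1, fun n => ?_⟩
  obtain ⟨c, hc, hb⟩ := h.2 n
  refine ⟨c, hc, fun x hx => (hb x hx).trans ?_⟩
  have := Real.rpow_le_rpow_of_exponent_le (one_le_bracket x)
    (show β - n ≤ β' - n by linarith)
  gcongr

theorem IsSymbolOn.zero {s : Set ℝ} (β : ℝ) : IsSymbolOn s β 0 := by
  refine ⟨contDiffOn_const, fun n => ⟨1, one_pos, fun x _ => ?_⟩⟩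
  have h0 : iteratedDerivWithin n (0 : ℝ → ℂ) s x = 0 := by
    simp [iteratedDerivWithin]
  rw [h0, norm_zero]
  have := bracket_pos x
  positivity

theorem IsSymbolOn.add {s : Set ℝ} (hs : UniqueDiffOn ℝ s) {β : ℝ} {f g : ℝ → ℂ}
    (hf : IsSymbolOn s β f) (hg : IsSymbolOn s β g) : IsSymbolOn s β (f + g) := by
  refine ⟨hf.1.add hg.1, fun n => ?_⟩
  obtain ⟨c, hc, hb⟩ := hf.2 n
  obtain ⟨d, hd, hb'⟩ := hg.2 n
  refine ⟨c + d, add_pos hc hd, fun x hx => ?_⟩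
  have hn : (n : ℕ∞ω) ≤ ∞ := by exact_mod_cast le_top
  rw [iteratedDerivWithin_add hx hs ((hf.1.of_le hn) x hx) ((hg.1.of_le hn) x hx), add_mul]
  exact (norm_add_le _ _).trans (add_le_add (hb x hx) (hb' x hx))

theorem IsSymbolOn.mul {s : Set ℝ} (hs : UniqueDiffOn ℝ s) {β β' : ℝ} {f g : ℝ → ℂ}
    (hf : IsSymbolOn s β f) (hg : IsSymbolOn s β' g) : IsSymbolOn s (β + β') (f * g) := by
  refine ⟨hf.1.mul hg.1, fun n => ?_⟩
  choose c hc hb using hf.2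
  choose d hd hb' using hg.2
  refine ⟨∑ i ∈ Finset.range (n + 1), (n.choose i : ℝ) * c i * d (n - i), ?_, fun x hx => ?_⟩
  · refine Finset.sum_pos (fun i hi => ?_) ⟨0, by simp⟩
    have : 0 < n.choose i := Nat.choose_pos (Nat.lt_succ_iff.mp (Finset.mem_range.mp hi))
    have := hc i
    have := hd (n - i)
    positivity
  · have hn : (n : ℕ∞ω) ≤ ∞ := by exact_mod_cast le_top
    have key := norm_iteratedFDerivWithin_mul_le hf.1 hg.1 hs hx hn
    simp only [norm_iteratedFDerivWithin_eq_norm_iteratedDerivWithin] at key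
    refine key.trans ?_
    rw [Finset.sum_mul]
    refine Finset.sum_le_sum fun i hi => ?_
    have hi' : i ≤ n := Nat.lt_succ_iff.mp (Finset.mem_range.mp hi)
    have hpow : bracket x ^ (β - i) * bracket x ^ (β' - (n - i : ℕ)) =
        bracket x ^ (β + β' - n) := by
      rw [← Real.rpow_add (bracket_pos x)]
      congr 1
      push_cast [hi']
      ring
    have hp := bracket_pos x
    have hci := hc i
    calc (n.choose i : ℝ) * ‖iteratedDerivWithin i f s x‖ * ‖iteratedDerivWithin (n - i) g s x‖
        ≤ (n.choose i : ℝ) * (c i * bracket x ^ (β - i)) *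
            (d (n - i) * bracket x ^ (β' - (n - i : ℕ))) := by
          gcongr
          · exact hb i x hx
          · exact hb' (n - i) x hx
      _ = (n.choose i : ℝ) * c i * d (n - i) *
            (bracket x ^ (β - i) * bracket x ^ (β' - (n - i : ℕ))) := by ring
      _ = _ := by rw [hpow]

theorem IsSymbolOn.smul {s : Set ℝ} (hs : UniqueDiffOn ℝ s) {β : ℝ} {f : ℝ → ℂ} (a : ℂ)
    (hf : IsSymbolOn s β f) : IsSymbolOn s β (a • f) := by
  refine ⟨hf.1.const_smul a, fun n => ?_⟩
  obtain ⟨c, hc, hb⟩ := hf.2 n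
  refine ⟨(‖a‖ + 1) * c, by positivity, fun x hx => ?_⟩
  have hn : (n : ℕ∞ω) ≤ ∞ := by exact_mod_cast le_top
  rw [iteratedDerivWithin_const_smul hx hs a ((hf.1.of_le hn) x hx), norm_smul, mul_assoc]
  have := hb x hx
  gcongr
  linarith

/-- The algebra `𝒜 = ⋃_{β < 0} S^β` of functions on `ℝ`, with pointwise operations. -/
def lineAlgebra : NonUnitalSubalgebra ℂ (ℝ → ℂ) where
  carrier := {f | ∃ β < 0, IsSymbolOn Set.univ β f}
  zero_mem' := ⟨-1, by norm_num, IsSymbolOn.zero _⟩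
  add_mem' := by
    rintro f g ⟨β, hβ, hf⟩ ⟨β', hβ', hg⟩
    exact ⟨max β β', max_lt hβ hβ', (hf.mono (le_max_left _ _)).add uniqueDiffOn_univ
      (hg.mono (le_max_right _ _))⟩
  mul_mem' := by
    rintro f g ⟨β, hβ, hf⟩ ⟨β', hβ', hg⟩
    exact ⟨β + β', by linarith, hf.mul uniqueDiffOn_univ hg⟩
  smul_mem' := by
    rintro a f ⟨β, hβ, hf⟩
    exact ⟨β, hβ, hf.smul uniqueDiffOn_univ a⟩

/-- The algebra `𝒜⁺ = ⋃_{β < 0} S^β_+` of functions on `[0, ∞)`, with pointwise operations.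
(`Set.IciExtend` is only used to write a function on `[0, ∞)` as a function on `ℝ`; smoothness
and derivatives are taken within `[0, ∞)` and do not see the values on `(-∞, 0)`.) -/
def halfLineAlgebra : NonUnitalSubalgebra ℂ (Set.Ici (0 : ℝ) → ℂ) where
  carrier := {f | ∃ β < 0, IsSymbolOn (Set.Ici 0) β (Set.IciExtend f)}
  zero_mem' := ⟨-1, by norm_num, IsSymbolOn.zero _⟩
  add_mem' := by
    rintro f g ⟨β, hβ, hf⟩ ⟨β', hβ', hg⟩
    exact ⟨max β β', max_lt hβ hβ', (hf.mono (le_max_left _ _)).add (uniqueDiffOn_Ici 0)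
      (hg.mono (le_max_right _ _))⟩
  mul_mem' := by
    rintro f g ⟨β, hβ, hf⟩ ⟨β', hβ', hg⟩
    exact ⟨β + β', by linarith, hf.mul (uniqueDiffOn_Ici 0) hg⟩
  smul_mem' := by
    rintro a f ⟨β, hβ, hf⟩
    exact ⟨β, hβ, hf.smul (uniqueDiffOn_Ici 0) a⟩

theorem IsSymbolOn.restrict {β : ℝ} {f : ℝ → ℂ} (hf : IsSymbolOn Set.univ β f) :
    IsSymbolOn (Set.Ici 0) β (Set.IciExtend fun x : Set.Ici (0 : ℝ) => f x) := by
  have heq : Set.EqOn (Set.IciExtend fun x : Set.Ici (0 : ℝ) => f x) f (Set.Ici 0) :=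
    fun x hx => Set.IciExtend_of_mem _ hx
  have hsm : ContDiff ℝ ∞ f := contDiffOn_univ.mp hf.1
  refine ⟨hsm.contDiffOn.congr heq, fun n => ?_⟩
  obtain ⟨c, hc, hb⟩ := hf.2 n
  refine ⟨c, hc, fun x hx => ?_⟩
  have hn : (n : ℕ∞ω) ≤ ∞ := by exact_mod_cast le_top
  rw [iteratedDerivWithin_congr heq hx,
    iteratedDerivWithin_eq_iteratedDeriv (uniqueDiffOn_Ici 0) (hsm.of_le hn).contDiffAt hx,
    ← iteratedDerivWithin_univ]
  exact hb x (Set.mem_univ x)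

/-- Restriction `f ↦ f|_{[0, ∞)}` from `𝒜` to `𝒜⁺`. -/
def restrict (f : lineAlgebra) : halfLineAlgebra :=
  ⟨fun x => (f : ℝ → ℂ) x, by
    obtain ⟨β, hβ, hf⟩ := f.2
    exact ⟨β, hβ, hf.restrict⟩⟩

/-- The norm `‖f‖ₙ = ∑_{r ≤ n} ∫₀^∞ |f⁽ʳ⁾(x)| ⟨x⟩^(r - 1) dx` on `𝒜⁺`. -/
def halfLineNorm (n : ℕ) (f : halfLineAlgebra) : ℝ :=
  ∑ r ∈ Finset.range (n + 1), ∫ x in Set.Ici (0 : ℝ),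
    ‖iteratedDerivWithin r (Set.IciExtend (f : Set.Ici (0 : ℝ) → ℂ)) (Set.Ici 0) x‖ *
      bracket x ^ ((r : ℝ) - 1)

/-! ### Unbounded operators, resolvents and the resolvent hypothesis -/

section Operators

variable {B : Type*} [NormedAddCommGroup B] [NormedSpace ℂ B]

/-- `R` is a bounded two-sided inverse of `z - H : Dom H → B`. -/
def IsResolventAt (H : B →ₗ.[ℂ] B) (z : ℂ) (R : B →L[ℂ] B) : Prop :=
  (∀ v : B, ∃ h : R v ∈ H.domain, z • R v - H ⟨R v, h⟩ = v) ∧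
    ∀ u : H.domain, R (z • (u : B) - H u) = u

/-- The spectrum of `H`: the `z` at which `z - H` has no bounded inverse. -/
def opSpectrum (H : B →ₗ.[ℂ] B) : Set ℂ := {z | ¬ ∃ R : B →L[ℂ] B, IsResolventAt H z R}

open Classical in
/-- The resolvent `(z - H)⁻¹`; by convention `0` if `z` is in the spectrum. -/
def opResolvent (H : B →ₗ.[ℂ] B) (z : ℂ) : B →L[ℂ] B :=
  if h : ∃ R : B →L[ℂ] B, IsResolventAt H z R then h.choose else 0

/-- `H` is closed and densely defined, has real spectrum, and satisfies
`‖(z - H)⁻¹‖ ≤ c |Im z|⁻¹ (⟨z⟩ / |Im z|)^α` for all non-real `z`. -/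
structure ResolventHypothesis (H : B →ₗ.[ℂ] B) (α : ℝ) : Prop where
  isClosed : H.IsClosed
  dense_domain : Dense (H.domain : Set B)
  spectrum_real : opSpectrum H ⊆ {z | z.im = 0}
  bound : ∃ c : ℝ, ∀ z : ℂ, z.im ≠ 0 →
    ‖opResolvent H z‖ ≤ c * |z.im|⁻¹ * (bracket z / |z.im|) ^ α

/-! ### Almost analytic extensions and the Helffer–Sjöstrand integral -/

/-- Admissible cut-offs: `τ` is smooth on `ℝ²`, `τ = 1` where `|y| ≤ ⟨x⟩`, `τ = 0` where
`|y| ≥ 2⟨x⟩`, and the first derivatives of `τ` are `O(⟨x⟩⁻¹)`. -/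
structure IsCutoff (τ : ℝ → ℝ → ℂ) : Prop where
  smooth : ContDiff ℝ ∞ (fun p : ℝ × ℝ => τ p.1 p.2)
  eq_one : ∀ x y : ℝ, |y| ≤ bracket x → τ x y = 1
  eq_zero : ∀ x y : ℝ, 2 * bracket x ≤ |y| → τ x y = 0
  deriv_bound : ∃ C : ℝ, ∀ x y : ℝ,
    ‖deriv (fun s => τ s y) x‖ ≤ C / bracket x ∧ ‖deriv (fun t => τ x t) y‖ ≤ C / bracket x

/-- The almost analytic extension
`f̃(x, y) = (∑_{r ≤ n} f⁽ʳ⁾(x) (iy)^r / r!) τ(x, y)`. -/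
def almostAnalyticExt (n : ℕ) (τ : ℝ → ℝ → ℂ) (f : ℝ → ℂ) (x y : ℝ) : ℂ :=
  (∑ r ∈ Finset.range (n + 1),
    iteratedDeriv r f x * (Complex.I * (y : ℂ)) ^ r / (r.factorial : ℂ)) * τ x y

/-- `∂g/∂z̄ = ½ (∂g/∂x + i ∂g/∂y)` at the point `z = x + iy`. -/
def dbar (g : ℝ → ℝ → ℂ) (z : ℂ) : ℂ :=
  (1 / 2) * (deriv (fun s => g s z.im) z.re + Complex.I * deriv (fun t => g z.re t) z.im)

/-- The integrand `(∂f̃/∂z̄) (z - H)⁻¹`. -/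
def hsIntegrand (H : B →ₗ.[ℂ] B) (n : ℕ) (τ : ℝ → ℝ → ℂ) (f : ℝ → ℂ) (z : ℂ) : B →L[ℂ] B :=
  dbar (almostAnalyticExt n τ f) z • opResolvent H z

/-- The Helffer–Sjöstrand integral `-(1/π) ∬_ℂ (∂f̃/∂z̄) (z - H)⁻¹ dx dy`. -/
def hsIntegral (H : B →ₗ.[ℂ] B) (n : ℕ) (τ : ℝ → ℝ → ℂ) (f : ℝ → ℂ) : B →L[ℂ] B :=
  -((1 / Real.pi : ℝ) : ℂ) • ∫ z : ℂ, hsIntegrand H n τ f z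

end Operators

/-! ### Seeley's extension -/

/-- The data in Seeley's construction: real sequences `a`, `b` with `bₖ < 0`, `bₖ → -∞`,
`∑ |aₖ| |bₖ|ⁿ < ∞` and `∑ aₖ bₖⁿ = 1` for all `n ≥ 0`, and a smooth `φ` on `ℝ` with
`φ = 1` on `[0, 1]` and `φ(x) = 0` for `x ≥ 2` and for `x ≤ -1`. -/
structure SeeleyData where
  a : ℕ → ℝ
  b : ℕ → ℝ
  φ : ℝ → ℂ
  b_neg : ∀ k, b k < 0
  summable : ∀ n : ℕ, Summable fun k => |a k| * |b k| ^ n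
  moments : ∀ n : ℕ, HasSum (fun k => a k * b k ^ n) 1
  b_tendsto : Filter.Tendsto b Filter.atTop Filter.atBot
  φ_smooth : ContDiff ℝ ∞ φ
  φ_eq_one : ∀ x ∈ Set.Icc (0 : ℝ) 1, φ x = 1
  φ_eq_zero_right : ∀ x : ℝ, 2 ≤ x → φ x = 0
  φ_eq_zero_left : ∀ x : ℝ, x ≤ -1 → φ x = 0

/-- Seeley's extension of a function `f` on `[0, ∞)`:
`(ℰf)(x) = f(x)` for `x ≥ 0` and `(ℰf)(x) = ∑ₖ aₖ φ(bₖ x) f(bₖ x)` for `x < 0`. -/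
def seeleyExt (d : SeeleyData) (f : Set.Ici (0 : ℝ) → ℂ) (x : ℝ) : ℂ :=
  if x < 0 then ∑' k, (d.a k : ℂ) * (d.φ (d.b k * x) * Set.IciExtend f (d.b k * x))
  else Set.IciExtend f x

end HalfLineCalculus

end

/-!
The calculus is developed for a class of functions on `ℂ` that is wider than the almost analytic
extensions of the statement. `AlmostAnalytic β N F` only asks that `F` be of class `C¹`, of growth
`β`, and that `∂F/∂z̄` be smaller than its natural size `⟨z⟩^(β - 1)` by the factor
`(|Im z| / ⟨z⟩)^N`. Against the resolvent bound, `β < 0` and `N > α` make the Helffer–Sjöstrand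
integral `hsInt H F` absolutely convergent. The class is stable under sums, products,
translations and dilations, so all manipulations take place inside it, and the extensions `f̃`
(`almostAnalytic_aaExt`) are just examples.

The heart of the proof is locality, `hsInt_congr`: the integral depends only on the values of `F` on
`[0, ∞)`. If the trace of `D` on the real axis is supported in a compact set away from the
spectrum, the resolvent is shifted by `iη` in the upper and by `-iη` in the lower half-plane.
Stokes' theorem leaves `∫ D(x) (R(x + iη) - R(x - iη)) dx`, up to a constant factor; this tends to
`0` with `η` (`hsInt_eq_zero_of_compactSupport`). Dilations of one compactly supported
extension form an approximate unit (`exists_approximate_unit`), which removes the compactness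
assumption. If finally the trace vanishes on `[0, ∞)`, the trace of the translate `D(z + ε)`
lives on `(-∞, -ε]`, away from the spectrum, and `ε` can be sent to `0` by dominated
convergence. Locality shows at once that the integral does not depend on the order `n`, the cut-off,
or the extension from `[0, ∞)` to `ℝ`, and that functions with compact support off the spectrum
are sent to `0`. It also gives additivity.

Multiplicativity (`hsInt_mul`) follows from the resolvent identity
`R(z) R(w) = (R(z) - R(w)) / (w - z)` and the Cauchy–Pompeiu formula (`cauchy_pompeiu`), applied
once in each variable. The function `x ↦ 1 / (w - x)` extends to `(1 - κ(z)) / (w - z)` with a bump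
function `κ` at `w`, for which `cauchy_pompeiu` evaluates the integral as `R(w)`
(`exists_almostAnalytic_resolvent`).

The norm bound on the line (`exists_norm_hsInt_aaExt_le`) is transported to the half-line by the
boundedness of Seeley's extension (`exists_integral_normDensity_seeleyDeriv_le`). The moment
conditions `∑ aₖ bₖʳ = 1` make all derivatives of the extension continuous at `0`
(`continuousAt_seeleyDeriv_zero`). Seeley data with `bₖ = -2^k` are obtained from the Taylor
coefficients of `∏ (1 - t 2^(-j))`, which vanishes at all the points `2^m`
(`nonempty_seeleyData`).
-/

noncomputable section

namespace HalfLineCalculus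

open MeasureTheory Filter Topology Set
open Complex (I)

/-! ### The operator `∂/∂z̄` and Stokes' theorem -/

section Dbar

variable {E : Type*} [NormedAddCommGroup E] [NormedSpace ℂ E]

/-- The operator `∂/∂z̄ = ½ (∂/∂x + i ∂/∂y)` acting on vector-valued functions of a complex
variable. -/
def dbarC (G : ℂ → E) (z : ℂ) : E :=
  (1 / 2 : ℂ) • (fderiv ℝ G z 1 + I • fderiv ℝ G z I)

theorem dbarC_congr {G G' : ℂ → E} {z : ℂ} (h : G =ᶠ[𝓝 z] G') : dbarC G z = dbarC G' z := by
  simp only [dbarC, h.fderiv_eq]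

theorem dbarC_add {F G : ℂ → E} {z : ℂ} (hF : DifferentiableAt ℝ F z)
    (hG : DifferentiableAt ℝ G z) :
    dbarC (fun w => F w + G w) z = dbarC F z + dbarC G z := by
  simp only [dbarC, fderiv_fun_add hF hG, add_apply]
  module

theorem dbarC_neg (F : ℂ → E) (z : ℂ) : dbarC (fun w => -F w) z = -dbarC F z := by
  simp only [dbarC, fderiv_fun_neg, neg_apply]
  module

theorem dbarC_const_smul {F : ℂ → E} {z : ℂ} (c : ℂ) (hF : DifferentiableAt ℝ F z) :
    dbarC (fun w => c • F w) z = c • dbarC F z := by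
  simp only [dbarC, fderiv_fun_const_smul hF, smul_apply]
  module

theorem dbarC_smul {F : ℂ → ℂ} {G : ℂ → E} {z : ℂ} (hF : DifferentiableAt ℝ F z)
    (hG : DifferentiableAt ℝ G z) :
    dbarC (fun w => F w • G w) z = dbarC F z • G z + F z • dbarC G z := by
  simp only [dbarC, fderiv_fun_smul hF hG, add_apply,
    smul_apply, ContinuousLinearMap.smulRight_apply, smul_eq_mul]
  module

theorem dbarC_eq_zero {G : ℂ → E} {z : ℂ} (hG : DifferentiableAt ℂ G z) : dbarC G z = 0 := by
  have h := hG.hasFDerivAt.restrictScalars ℝ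
  have h1 : (fderiv ℂ G z) I = I • (fderiv ℂ G z) 1 := by
    rw [← map_smul]; simp
  simp only [dbarC, h.fderiv, ContinuousLinearMap.coe_restrictScalars', h1, smul_smul]
  simp

theorem dbarC_comp_affine {G : ℂ → E} (a : ℝ) (b : ℂ) {z : ℂ}
    (hG : DifferentiableAt ℝ G ((a : ℂ) * z + b)) :
    dbarC (fun w => G ((a : ℂ) * w + b)) z = (a : ℂ) • dbarC G ((a : ℂ) * z + b) := by
  have h1 : HasFDerivAt (fun w : ℂ => (a : ℂ) * w + b) (a • ContinuousLinearMap.id ℝ ℂ) z := by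
    have := ((hasFDerivAt_id (𝕜 := ℝ) z).const_smul a).add_const b
    exact this.congr_of_eventuallyEq (Eventually.of_forall fun w => by simp)
  have h2 := hG.hasFDerivAt.comp z h1
  have h3 : fderiv ℝ (fun w => G ((a : ℂ) * w + b)) z =
      (fderiv ℝ G ((a : ℂ) * z + b)).comp (a • ContinuousLinearMap.id ℝ ℂ) := h2.fderiv
  have h4 : ∀ v : ℂ, fderiv ℝ G ((a : ℂ) * z + b) (a • v) =
      (a : ℂ) • fderiv ℝ G ((a : ℂ) * z + b) v := fun v => by
    rw [map_smul, Complex.coe_smul]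
  simp only [dbarC, h3, ContinuousLinearMap.comp_apply, smul_apply,
    ContinuousLinearMap.id_apply, h4]
  module

theorem continuous_dbarC {G : ℂ → E} (hG : ContDiff ℝ 1 G) : Continuous (dbarC G) := by
  have h := hG.continuous_fderiv one_ne_zero
  unfold dbarC
  fun_prop

theorem hasCompactSupport_dbarC {G : ℂ → E} (hG : HasCompactSupport G) :
    HasCompactSupport (dbarC G) := by
  refine (hG.fderiv (𝕜 := ℝ)).mono' (Function.support_subset_iff'.2 fun z hz => ?_)
  have : fderiv ℝ G z = 0 := image_eq_zero_of_notMem_tsupport hz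
  simp [dbarC, this]

theorem integrable_fderiv_apply {G : ℂ → E} (hG : ContDiff ℝ 1 G) (hc : HasCompactSupport G)
    (v : ℂ) : Integrable (fun z => fderiv ℝ G z v) := by
  have h := hG.continuous_fderiv one_ne_zero
  refine Continuous.integrable_of_hasCompactSupport (by fun_prop) ?_
  refine (hc.fderiv (𝕜 := ℝ)).mono' (Function.support_subset_iff'.2 fun z hz => ?_)
  have : fderiv ℝ G z = 0 := image_eq_zero_of_notMem_tsupport hz
  simp [this]

theorem integrable_dbarC {G : ℂ → E} (hG : ContDiff ℝ 1 G) (hc : HasCompactSupport G) :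
    Integrable (dbarC G) :=
  (continuous_dbarC hG).integrable_of_hasCompactSupport (hasCompactSupport_dbarC hc)

theorem integral_fderiv_apply_eq_zero {G : ℂ → E} (hG : ContDiff ℝ 1 G)
    (hc : HasCompactSupport G) (v : ℂ) : ∫ z, fderiv ℝ G z v = 0 := by
  have h := integral_bilinear_hasFDerivAt_right_eq_neg_left_of_integrable
    (μ := volume) (f := fun _ : ℂ => (1 : ℝ)) (f' := fun _ => 0) (g := G) (g' := fderiv ℝ G)
    (v := v) (B := ContinuousLinearMap.lsmul ℝ ℝ) (by simp)
    (by simpa using integrable_fderiv_apply hG hc v)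
    (by simpa using hG.continuous.integrable_of_hasCompactSupport hc)
    (fun x _ => hasFDerivAt_const _ _)
    (fun x _ => (hG.differentiable one_ne_zero x).hasFDerivAt)
  simpa using h

theorem integral_dbarC_eq_zero {G : ℂ → E} (hG : ContDiff ℝ 1 G) (hc : HasCompactSupport G) :
    ∫ z, dbarC G z = 0 := by
  unfold dbarC
  rw [integral_smul, integral_add (integrable_fderiv_apply hG hc 1)
    ((integrable_fderiv_apply hG hc I).fun_smul I), integral_smul,
    integral_fderiv_apply_eq_zero hG hc, integral_fderiv_apply_eq_zero hG hc]
  simp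

/-- Fubini's theorem on `ℂ`, in the coordinates `z = x + iy`. -/
theorem integral_complex_eq {f : ℂ → E} (hf : Integrable f) :
    ∫ z, f z = ∫ x : ℝ, ∫ y : ℝ, f (x + y * I) := by
  have e := Complex.volume_preserving_equiv_real_prod.symm
  rw [← e.integral_comp Complex.measurableEquivRealProd.symm.measurableEmbedding,
    Measure.volume_eq_prod, integral_prod]
  · simp [Complex.mk_eq_add_mul_I]
  · exact (e.integrable_comp_emb Complex.measurableEquivRealProd.symm.measurableEmbedding).2 hf

theorem integrable_complex_iff {F : Type*} [NormedAddCommGroup F] {f : ℂ → F} :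
    Integrable f ↔ Integrable (fun p : ℝ × ℝ => f (p.1 + p.2 * I)) := by
  have e := Complex.volume_preserving_equiv_real_prod.symm
  rw [← e.integrable_comp_emb Complex.measurableEquivRealProd.symm.measurableEmbedding]
  simp [Function.comp_def, Complex.mk_eq_add_mul_I]

theorem measurableSet_upper : MeasurableSet {z : ℂ | 0 < z.im} :=
  measurableSet_lt measurable_const Complex.measurable_im

theorem hasCompactSupport_slice_re {F : Type*} [NormedAddCommGroup F] {G : ℂ → F}
    (hc : HasCompactSupport G) (y : ℝ) :
    HasCompactSupport (fun x : ℝ => G (x + y * I)) := by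
  refine hc.comp_isClosedEmbedding (g := fun x : ℝ => (x : ℂ) + y * I) ?_
  refine (Isometry.of_dist_eq fun a b => ?_).isClosedEmbedding
  simp [dist_eq_norm, ← Complex.ofReal_sub]

theorem hasCompactSupport_slice_im {F : Type*} [NormedAddCommGroup F] {G : ℂ → F}
    (hc : HasCompactSupport G) (x : ℝ) :
    HasCompactSupport (fun y : ℝ => G (x + y * I)) := by
  refine hc.comp_isClosedEmbedding (g := fun y : ℝ => (x : ℂ) + y * I) ?_
  refine (Isometry.of_dist_eq fun a b => ?_).isClosedEmbedding
  simp [dist_eq_norm, ← sub_mul, ← Complex.ofReal_sub]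

theorem deriv_slice_re {G : ℂ → E} {x y : ℝ} (hG : DifferentiableAt ℝ G (x + y * I)) :
    HasDerivAt (fun s : ℝ => G (s + y * I)) (fderiv ℝ G (x + y * I) 1) x := by
  have h1 : HasDerivAt (fun s : ℝ => (s : ℂ) + y * I) 1 x := by
    simpa using (Complex.ofRealCLM.hasDerivAt (x := x)).add_const ((y : ℂ) * I)
  exact hG.hasFDerivAt.comp_hasDerivAt x h1

theorem deriv_slice_im {G : ℂ → E} {x y : ℝ} (hG : DifferentiableAt ℝ G (x + y * I)) :
    HasDerivAt (fun t : ℝ => G (x + t * I)) (fderiv ℝ G (x + y * I) I) y := by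
  have h1 : HasDerivAt (fun t : ℝ => (x : ℂ) + t * I) I y := by
    simpa using ((Complex.ofRealCLM.hasDerivAt (x := y)).mul_const I).const_add (x : ℂ)
  exact hG.hasFDerivAt.comp_hasDerivAt y h1

/-- Stokes' theorem on the upper half-plane. -/
theorem setIntegral_upper_dbarC [CompleteSpace E] {G : ℂ → E} (hG : ContDiff ℝ 1 G)
    (hc : HasCompactSupport G) :
    ∫ z in {z : ℂ | 0 < z.im}, dbarC G z = -(I / 2) • ∫ x : ℝ, G x := by
  have hd := hG.differentiable one_ne_zero
  have i1 := integrable_fderiv_apply hG hc 1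
  have i2 := integrable_fderiv_apply hG hc I
  have key1 : ∀ f : ℂ → E, Integrable f →
      ∫ z in {z : ℂ | 0 < z.im}, f z = ∫ x : ℝ, ∫ y in Ioi (0 : ℝ), f (x + y * I) := by
    intro f hf
    rw [← integral_indicator measurableSet_upper,
      integral_complex_eq (hf.indicator measurableSet_upper)]
    congr 1; ext x
    rw [← integral_indicator measurableSet_Ioi]
    congr 1; ext y
    simp [indicator]
  have key2 : ∀ f : ℂ → E, Integrable f →
      ∫ z in {z : ℂ | 0 < z.im}, f z = ∫ y in Ioi (0 : ℝ), ∫ x : ℝ, f (x + y * I) := by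
    intro f hf
    rw [key1 f hf]
    refine integral_integral_swap (f := fun x y : ℝ => f (x + y * I)) ?_
    have h := (integrable_complex_iff.1 hf)
    rw [Measure.volume_eq_prod] at h
    exact h.mono_measure (Measure.prod_mono le_rfl Measure.restrict_le_self)
  -- `∂/∂x` integrates to zero on every horizontal line, `∂/∂y` to `-G(x)` on every vertical one
  have hx : ∫ z in {z : ℂ | 0 < z.im}, fderiv ℝ G z 1 = 0 := by
    rw [key2 _ i1]
    refine integral_eq_zero_of_ae (Eventually.of_forall fun y => ?_)
    refine integral_eq_zero_of_hasDerivAt_of_integrable (f := fun x : ℝ => G (x + y * I))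
      (fun x => deriv_slice_re (hd _)) ?_ ?_
    · refine Continuous.integrable_of_hasCompactSupport ?_
        (hasCompactSupport_slice_re (G := fun z => fderiv ℝ G z 1) ?_ y)
      · have h := hG.continuous_fderiv one_ne_zero
        fun_prop
      · exact (hc.fderiv_apply (𝕜 := ℝ) 1)
    · have h := hG.continuous
      exact Continuous.integrable_of_hasCompactSupport (by fun_prop)
        (hasCompactSupport_slice_re hc y)
  have hy : ∫ z in {z : ℂ | 0 < z.im}, fderiv ℝ G z I = -∫ x : ℝ, G x := by
    rw [key1 _ i2, ← integral_neg]
    congr 1; ext x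
    have h1 : ContDiff ℝ 1 (fun y : ℝ => G (x + y * I)) := by
      refine hG.comp ?_
      exact contDiff_const.add (Complex.ofRealCLM.contDiff.mul contDiff_const)
    have := HasCompactSupport.integral_Ioi_deriv_eq h1 (hasCompactSupport_slice_im hc x) 0
    simp only [Complex.ofReal_zero, zero_mul, add_zero] at this
    rw [← this]
    congr 1; ext y
    exact (deriv_slice_im (hd _)).deriv.symm
  unfold dbarC
  rw [integral_smul, integral_add i1.integrableOn (i2.fun_smul I).integrableOn, integral_smul,
    hx, hy]
  module

theorem setIntegral_lower_dbarC [CompleteSpace E] {G : ℂ → E} (hG : ContDiff ℝ 1 G)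
    (hc : HasCompactSupport G) :
    ∫ z in {z : ℂ | 0 < z.im}ᶜ, dbarC G z = (I / 2) • ∫ x : ℝ, G x := by
  have h := integral_add_compl measurableSet_upper (integrable_dbarC hG hc)
  rw [integral_dbarC_eq_zero hG hc, setIntegral_upper_dbarC hG hc] at h
  rw [← sub_eq_zero, ← h]
  module

end Dbar

/-! ### The Cauchy–Pompeiu formula -/

section CauchyPompeiu

variable {E : Type*} [NormedAddCommGroup E] [NormedSpace ℂ E]

/-- A smooth step function, equal to `0` on `(-∞, 1]` and to `1` on `[2, ∞)`. -/
def step (t : ℝ) : ℝ := Real.smoothTransition (t - 1)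

theorem step_contDiff {n : ℕ∞} : ContDiff ℝ n step :=
  Real.smoothTransition.contDiff.comp (contDiff_id.sub contDiff_const)

theorem step_of_le {t : ℝ} (h : t ≤ 1) : step t = 0 :=
  Real.smoothTransition.zero_of_nonpos (by linarith)

theorem step_of_ge {t : ℝ} (h : 2 ≤ t) : step t = 1 :=
  Real.smoothTransition.one_of_one_le (by linarith)

theorem step_nonneg (t : ℝ) : 0 ≤ step t := Real.smoothTransition.nonneg _

theorem step_le_one (t : ℝ) : step t ≤ 1 := Real.smoothTransition.le_one _

theorem continuous_deriv_step : Continuous (deriv step) :=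
  (step_contDiff (n := 1)).continuous_deriv le_rfl

theorem hasDerivAt_step (t : ℝ) : HasDerivAt step (deriv step t) t :=
  ((step_contDiff (n := 1)).differentiable one_ne_zero t).hasDerivAt

theorem deriv_step_of_lt {t : ℝ} (h : t < 1) : deriv step t = 0 := by
  have : step =ᶠ[𝓝 t] fun _ => 0 := by
    filter_upwards [Iio_mem_nhds h] with s hs using step_of_le (le_of_lt hs)
  rw [this.deriv_eq, deriv_const]

theorem deriv_step_of_gt {t : ℝ} (h : 2 < t) : deriv step t = 0 := by
  have : step =ᶠ[𝓝 t] fun _ => 1 := by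
    filter_upwards [Ioi_mem_nhds h] with s hs using step_of_ge (le_of_lt hs)
  rw [this.deriv_eq, deriv_const]

theorem hasCompactSupport_deriv_step_norm_sq :
    HasCompactSupport (fun u : ℂ => deriv step (‖u‖ ^ 2)) := by
  refine HasCompactSupport.intro (isCompact_closedBall (0 : ℂ) 2) fun u hu => ?_
  refine deriv_step_of_gt ?_
  rw [mem_closedBall_zero_iff, not_le] at hu
  nlinarith

/-- In polar coordinates this is `2π ∫₀^∞ r step'(r²) dr`. It is the constant of the
Cauchy–Pompeiu formula. -/
theorem integral_deriv_step_norm_sq : ∫ u : ℂ, deriv step (‖u‖ ^ 2) = Real.pi := by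
  rw [integral_fun_norm_addHaar volume (fun t : ℝ => deriv step (t ^ 2))]
  have h1 : ∫ y in Ioi (0 : ℝ), y ^ (Module.finrank ℝ ℂ - 1) • deriv step (y ^ 2) = 1 / 2 := by
    have hd : ∀ y : ℝ, HasDerivAt (fun y => (1 / 2) * step (y ^ 2))
        (y ^ (Module.finrank ℝ ℂ - 1) • deriv step (y ^ 2)) y := by
      intro y
      have := ((hasDerivAt_step (y ^ 2)).comp y (hasDerivAt_pow 2 y)).const_mul (1 / 2)
      refine this.congr_deriv ?_
      simp [Complex.finrank_real_complex]
      ring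
    have hint : Integrable (fun y : ℝ => y ^ (Module.finrank ℝ ℂ - 1) • deriv step (y ^ 2)) := by
      refine Continuous.integrable_of_hasCompactSupport ?_ ?_
      · have := continuous_deriv_step
        fun_prop
      · refine HasCompactSupport.intro (isCompact_closedBall (0 : ℝ) 2) fun y hy => ?_
        rw [mem_closedBall_zero_iff, not_le, Real.norm_eq_abs] at hy
        rw [deriv_step_of_gt, smul_zero]
        rw [← sq_abs]; nlinarith
    have := integral_Ioi_of_hasDerivAt_of_tendsto' (a := 0) (m := 1 / 2) (fun y _ => hd y)
      hint.integrableOn (tendsto_const_nhds.congr' ?_)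
    · rw [this]; simp [step_of_le]
    · filter_upwards [eventually_ge_atTop 2] with y hy
      rw [step_of_ge (by nlinarith)]; norm_num
  rw [h1]
  simp [Measure.real, Complex.volume_ball, Complex.finrank_real_complex]
  ring

theorem integrableOn_norm_inv_ball (r : ℝ) :
    IntegrableOn (fun u : ℂ => ‖u‖⁻¹) (Metric.ball 0 r) := by
  rw [integrableOn_fun_norm_addHaar volume (f := fun t : ℝ => t⁻¹)]
  have : IntegrableOn (fun _ : ℝ => (1 : ℝ)) (Ioo 0 r) := by simp
  refine this.congr_fun (fun y hy => ?_) measurableSet_Ioo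
  simp [Complex.finrank_real_complex, hy.1.ne']

/-- The Cauchy kernel is integrable against bounded integrable functions, uniformly in the pole:
near the pole the function is bounded by `M`, away from it the kernel is bounded by `1`. -/
theorem integrable_kernel {g : ℂ → E} (hg : Integrable g) {M : ℝ}
    (hM : ∀ w, ‖g w‖ ≤ M) (z : ℂ) :
    Integrable (fun w => (w - z)⁻¹ • g w) ∧
      ∫ w, ‖(w - z)⁻¹ • g w‖ ≤
        M * (∫ u in Metric.ball (0 : ℂ) 1, ‖u‖⁻¹) + ∫ w, ‖g w‖ := by
  have hM0 : 0 ≤ M := (norm_nonneg _).trans (hM 0)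
  set k : ℂ → ℝ := (Metric.ball (0 : ℂ) 1).indicator (fun u => ‖u‖⁻¹) with hk
  have hki : Integrable k :=
    (integrable_indicator_iff measurableSet_ball).2 (integrableOn_norm_inv_ball 1)
  have hk' : Integrable (fun w => M * k (w - z) + ‖g w‖) :=
    ((hki.comp_sub_right z).const_mul M).add hg.norm
  have hbound : ∀ w, ‖(w - z)⁻¹ • g w‖ ≤ M * k (w - z) + ‖g w‖ := by
    intro w
    rw [norm_smul, norm_inv]
    by_cases h : w - z ∈ Metric.ball (0 : ℂ) 1
    · rw [hk, indicator_of_mem h, mul_comm]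
      have := mul_le_mul_of_nonneg_right (hM w) (inv_nonneg.2 (norm_nonneg (w - z)))
      linarith [norm_nonneg (g w)]
    · rw [hk, indicator_of_notMem h, mul_zero, zero_add]
      rw [mem_ball_zero_iff, not_lt] at h
      exact mul_le_of_le_one_left (norm_nonneg _) (inv_le_one_of_one_le₀ h)
  have hmeas : AEStronglyMeasurable (fun w => (w - z)⁻¹ • g w) volume := by
    refine AEStronglyMeasurable.smul ?_ hg.1
    exact (measurable_id.sub_const z).inv.aestronglyMeasurable
  have hint : Integrable (fun w => (w - z)⁻¹ • g w) :=
    hk'.mono' hmeas (Eventually.of_forall hbound)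
  refine ⟨hint, ?_⟩
  calc ∫ w, ‖(w - z)⁻¹ • g w‖ ≤ ∫ w, (M * k (w - z) + ‖g w‖) :=
        integral_mono hint.norm hk' hbound
    _ = _ := by
        rw [integral_add ((hki.comp_sub_right z).const_mul M) hg.norm, integral_const_mul,
          integral_sub_right_eq_self k z, hk, integral_indicator measurableSet_ball]

theorem dbarC_ofReal {h : ℂ → ℝ} {h' : ℂ →L[ℝ] ℝ} {z : ℂ} (hh : HasFDerivAt h h' z) :
    dbarC (fun w => (h w : ℂ)) z = (1 / 2 : ℂ) * (h' 1 + I * h' I) := by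
  have : HasFDerivAt (fun w => (h w : ℂ)) (Complex.ofRealCLM.comp h') z :=
    Complex.ofRealCLM.hasFDerivAt.comp z hh
  simp [dbarC, this.fderiv]

/-- The Cauchy kernel `1 / w`, cut off smoothly near the origin at scale `ε`. -/
def truncKernel (ε : ℝ) (w : ℂ) : ℂ := (step (‖w‖ ^ 2 / ε ^ 2) : ℂ) * w⁻¹

theorem truncKernel_eventuallyEq {ε : ℝ} (hε : 0 < ε) : truncKernel ε =ᶠ[𝓝 0] fun _ => 0 := by
  filter_upwards [Metric.ball_mem_nhds (0 : ℂ) hε] with w hw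
  rw [mem_ball_zero_iff] at hw
  have : step (‖w‖ ^ 2 / ε ^ 2) = 0 := by
    refine step_of_le ?_
    rw [div_le_one (by positivity)]
    gcongr
  simp [truncKernel, this]

theorem contDiff_truncKernel {ε : ℝ} (hε : 0 < ε) : ContDiff ℝ 1 (truncKernel ε) := by
  rw [contDiff_iff_contDiffAt]
  intro w
  by_cases hw : w = 0
  · subst hw
    exact contDiffAt_const.congr_of_eventuallyEq (truncKernel_eventuallyEq hε)
  · have h1 : ContDiff ℝ 1 (fun w : ℂ => step (‖w‖ ^ 2 / ε ^ 2)) :=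
      (step_contDiff (n := 1)).comp ((contDiff_norm_sq ℝ).div_const _)
    exact (Complex.ofRealCLM.contDiff.comp h1).contDiffAt.mul (contDiffAt_inv ℝ hw)

theorem dbarC_truncKernel {ε : ℝ} (hε : 0 < ε) (w : ℂ) :
    dbarC (truncKernel ε) w = (deriv step (‖w‖ ^ 2 / ε ^ 2) / ε ^ 2 : ℝ) := by
  by_cases hw : w = 0
  · subst hw
    rw [dbarC_congr (truncKernel_eventuallyEq hε), deriv_step_of_lt (by simp)]
    simp [dbarC]
  · have h0 := ((hasStrictFDerivAt_norm_sq w).hasFDerivAt.mul_const ((ε ^ 2)⁻¹))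
    have h1 := (hasDerivAt_step (‖w‖ ^ 2 * (ε ^ 2)⁻¹)).comp_hasFDerivAt w h0
    have h2 := dbarC_ofReal h1
    have hd : DifferentiableAt ℝ (fun w : ℂ => ((step (‖w‖ ^ 2 * (ε ^ 2)⁻¹) : ℝ) : ℂ)) w :=
      (Complex.ofRealCLM.hasFDerivAt.comp w h1).differentiableAt
    have hinv : DifferentiableAt ℂ (fun w : ℂ => w⁻¹) w := differentiableAt_inv hw
    have h3 := dbarC_smul hd (hinv.restrictScalars ℝ)
    have h4 : truncKernel ε = fun w : ℂ => ((step (‖w‖ ^ 2 * (ε ^ 2)⁻¹) : ℝ) : ℂ) • w⁻¹ := by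
      ext w; simp [truncKernel, div_eq_mul_inv]
    rw [h4, h3, dbarC_eq_zero hinv]
    simp only [Function.comp_def] at h2
    rw [h2]
    simp only [smul_apply, smul_eq_mul, mul_zero, add_zero, innerSL_apply_apply]
    have e1 : inner ℝ w 1 = w.re := by simp [Complex.inner]
    have e2 : inner ℝ w I = w.im := by simp [Complex.inner]
    simp only [e1, e2, nsmul_eq_mul]
    have e4 : w = w.re + w.im * I := (Complex.re_add_im w).symm
    have e5 : (ε : ℂ) ≠ 0 := by exact_mod_cast hε.ne'
    push_cast
    field_simp
    linear_combination (-1 * ((deriv step (‖w‖ ^ 2 / ε ^ 2) : ℝ) : ℂ)) * e4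

/-- The Cauchy–Pompeiu formula at the origin. For the kernel truncated at scale `ε`, the integral
is `-π` times an average of `G` over a ring of size `ε`, with the weight `step'(|u|²)`. -/
theorem cauchy_pompeiu_zero [CompleteSpace E] {G : ℂ → E} (hG : ContDiff ℝ 1 G)
    (hc : HasCompactSupport G) :
    ∫ w, w⁻¹ • dbarC G w = -(Real.pi : ℂ) • G 0 := by
  obtain ⟨M, hM⟩ := hG.continuous.bounded_above_of_compact_support hc
  obtain ⟨M', hM'⟩ := (continuous_dbarC hG).bounded_above_of_compact_support
    (hasCompactSupport_dbarC hc)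
  have hker := (integrable_kernel (integrable_dbarC hG hc) hM' 0).1
  simp only [sub_zero] at hker
  -- integrate by parts against the truncated kernel
  have hparts : ∀ ε : ℝ, 0 < ε → ∫ w, truncKernel ε w • dbarC G w =
      -∫ u : ℂ, ((deriv step (‖u‖ ^ 2) : ℝ) : ℂ) • G ((ε : ℂ) * u) := by
    intro ε hε
    have hP := contDiff_truncKernel hε
    have hPG : ContDiff ℝ 1 (fun w => truncKernel ε w • G w) := hP.smul hG
    have h0 := integral_dbarC_eq_zero hPG hc.smul_left
    have h1 : ∀ w, dbarC (fun w => truncKernel ε w • G w) w =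
        dbarC (truncKernel ε) w • G w + truncKernel ε w • dbarC G w := fun w =>
      dbarC_smul (hP.differentiable one_ne_zero w) (hG.differentiable one_ne_zero w)
    simp only [h1] at h0
    rw [integral_add] at h0
    · rw [eq_neg_of_add_eq_zero_right h0]
      congr 1
      have h2 := Measure.integral_comp_smul (volume : Measure ℂ)
        (fun w => dbarC (truncKernel ε) w • G w) ε
      rw [Complex.finrank_real_complex] at h2
      have h3 : ∫ w, dbarC (truncKernel ε) w • G w =
          (ε ^ 2) • ∫ x : ℂ, dbarC (truncKernel ε) (ε • x) • G (ε • x) := by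
        rw [h2, smul_smul, abs_of_pos (by positivity), mul_inv_cancel₀ (by positivity), one_smul]
      rw [h3, ← integral_smul]
      congr 1; ext u
      rw [dbarC_truncKernel hε, norm_smul, Real.norm_of_nonneg hε.le, mul_pow,
        mul_div_cancel_left₀ _ (by positivity), ← Complex.coe_smul, smul_smul, Complex.real_smul]
      congr 1
      push_cast
      have : (ε : ℂ) ≠ 0 := by exact_mod_cast hε.ne'
      field_simp
    · refine Continuous.integrable_of_hasCompactSupport ?_ hc.smul_left
      exact (continuous_dbarC hP).smul hG.continuous
    · refine Continuous.integrable_of_hasCompactSupport ?_ (hasCompactSupport_dbarC hc).smul_left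
      exact hP.continuous.smul (continuous_dbarC hG)
  -- the truncated integrals converge to the singular one
  have hlim1 : Tendsto (fun ε : ℝ => ∫ w, truncKernel ε w • dbarC G w) (𝓝[>] 0)
      (𝓝 (∫ w, w⁻¹ • dbarC G w)) := by
    refine tendsto_integral_filter_of_dominated_convergence (fun w => ‖w⁻¹ • dbarC G w‖)
      ?_ ?_ hker.norm ?_
    · filter_upwards [self_mem_nhdsWithin] with ε hε
      exact ((contDiff_truncKernel hε).continuous.smul
        (continuous_dbarC hG)).aestronglyMeasurable
    · refine Eventually.of_forall fun ε => Eventually.of_forall fun w => ?_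
      rw [truncKernel, mul_smul, norm_smul]
      refine mul_le_of_le_one_left (norm_nonneg _) ?_
      rw [Complex.norm_real, Real.norm_of_nonneg (step_nonneg _)]
      exact step_le_one _
    · have : ∀ᵐ w : ℂ, w ≠ 0 := by simp [ae_iff, measure_singleton]
      filter_upwards [this] with w hw
      refine tendsto_const_nhds.congr' ?_
      have hw' : 0 < ‖w‖ / 2 := by positivity
      filter_upwards [Ioo_mem_nhdsGT hw'] with ε hε
      have : step (‖w‖ ^ 2 / ε ^ 2) = 1 := by
        refine step_of_ge ?_
        have := hε.1
        rw [le_div_iff₀ (by positivity)]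
        nlinarith [hε.2, hε.1]
      simp [truncKernel, this]
  -- the boundary terms converge to the value at the pole
  have hlim2 : Tendsto (fun ε : ℝ => -∫ u : ℂ, ((deriv step (‖u‖ ^ 2) : ℝ) : ℂ) • G ((ε : ℂ) * u))
      (𝓝[>] 0) (𝓝 (-∫ u : ℂ, ((deriv step (‖u‖ ^ 2) : ℝ) : ℂ) • G 0)) := by
    refine Tendsto.neg ?_
    have hs : Continuous (fun u : ℂ => deriv step (‖u‖ ^ 2)) :=
      continuous_deriv_step.comp (by fun_prop)
    refine tendsto_integral_filter_of_dominated_convergence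
      (fun u => ‖deriv step (‖u‖ ^ 2)‖ * M) ?_ ?_ ?_ ?_
    · refine Eventually.of_forall fun ε => Continuous.aestronglyMeasurable ?_
      have := hG.continuous
      fun_prop
    · refine Eventually.of_forall fun ε => Eventually.of_forall fun w => ?_
      rw [norm_smul, Complex.norm_real]
      gcongr
      exact hM _
    · exact ((hs.integrable_of_hasCompactSupport
        hasCompactSupport_deriv_step_norm_sq).norm).mul_const M
    · refine Eventually.of_forall fun u => Tendsto.const_smul ?_ _
      have h : Continuous fun ε : ℝ => G ((ε : ℂ) * u) := by
        have := hG.continuous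
        fun_prop
      have := (h.tendsto 0).mono_left (nhdsWithin_le_nhds (s := Ioi 0))
      simpa using this
  have heq : ∫ w, w⁻¹ • dbarC G w = -∫ u : ℂ, ((deriv step (‖u‖ ^ 2) : ℝ) : ℂ) • G 0 := by
    refine tendsto_nhds_unique hlim1 (hlim2.congr' ?_)
    filter_upwards [self_mem_nhdsWithin] with ε hε using (hparts ε hε).symm
  rw [heq, integral_smul_const, integral_complex_ofReal, integral_deriv_step_norm_sq, neg_smul]

/-- The Cauchy–Pompeiu formula for compactly supported functions. -/
theorem cauchy_pompeiu [CompleteSpace E] {G : ℂ → E} (hG : ContDiff ℝ 1 G)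
    (hc : HasCompactSupport G) (z : ℂ) :
    ∫ w, (w - z)⁻¹ • dbarC G w = -(Real.pi : ℂ) • G z := by
  have h := cauchy_pompeiu_zero (G := fun w => G (w + z)) (hG.comp (contDiff_id.add contDiff_const))
    (hc.comp_homeomorph (Homeomorph.addRight z))
  rw [zero_add] at h
  rw [← h, ← integral_add_right_eq_self _ z]
  congr 1; ext w
  have := dbarC_comp_affine (G := G) 1 z (z := w)
    (hG.differentiable one_ne_zero _)
  simp only [Complex.ofReal_one, one_mul, one_smul] at this
  rw [this, add_sub_cancel_right]

end CauchyPompeiu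

/-! ### The resolvent -/

section Resolvent

variable {B : Type*} [NormedAddCommGroup B] [NormedSpace ℂ B] {H : B →ₗ.[ℂ] B}

theorem IsResolventAt.unique {z : ℂ} {R R' : B →L[ℂ] B} (h : IsResolventAt H z R)
    (h' : IsResolventAt H z R') : R = R' := by
  ext v
  obtain ⟨hd, e⟩ := h'.1 v
  have := h.2 ⟨R' v, hd⟩
  rwa [e] at this

theorem isResolventAt_opResolvent {z : ℂ} (hz : z ∉ opSpectrum H) :
    IsResolventAt H z (opResolvent H z) := by
  have h : ∃ R : B →L[ℂ] B, IsResolventAt H z R := not_not.1 hz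
  rw [opResolvent, dif_pos h]
  exact h.choose_spec

theorem IsResolventAt.opResolvent_eq {z : ℂ} {R : B →L[ℂ] B} (h : IsResolventAt H z R) :
    opResolvent H z = R :=
  (isResolventAt_opResolvent (H := H) (not_not.2 ⟨R, h⟩)).unique h

/-- The first resolvent identity. -/
theorem opResolvent_sub {z w : ℂ} (hz : z ∉ opSpectrum H) (hw : w ∉ opSpectrum H) :
    opResolvent H z - opResolvent H w = (w - z) • (opResolvent H z * opResolvent H w) := by
  ext v
  obtain ⟨hd, e⟩ := (isResolventAt_opResolvent hw).1 v
  have h2 := (isResolventAt_opResolvent hz).2 ⟨_, hd⟩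
  have h3 : z • opResolvent H w v - H ⟨opResolvent H w v, hd⟩ =
      v - (w - z) • opResolvent H w v := by
    nth_rewrite 3 [← e]; module
  simp only [h3, map_sub, map_smul] at h2
  simp only [sub_apply, smul_apply]
  rw [← h2]
  simp

/-- Formally `(z - H)⁻¹ = R (1 + (z - z₀) R)⁻¹` for `R = (z₀ - H)⁻¹`; the Neumann series shows that
the second factor exists for `z` near `z₀`. -/
theorem IsResolventAt.perturb {z z₀ : ℂ} {R : B →L[ℂ] B} (h : IsResolventAt H z₀ R)
    (hu : IsUnit (1 + (z - z₀) • R)) :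
    IsResolventAt H z (R * Ring.inverse (1 + (z - z₀) • R)) := by
  set A : B →L[ℂ] B := 1 + (z - z₀) • R with hA
  have hAv : ∀ v, A v = v + (z - z₀) • R v := fun v => by simp [hA]
  constructor
  · intro v
    set u := Ring.inverse A v with hu'
    have hAu : A u = v := by
      have := congrArg (fun T : B →L[ℂ] B => T v) (Ring.mul_inverse_cancel A hu)
      simpa using this
    obtain ⟨hd, e⟩ := h.1 u
    refine ⟨hd, ?_⟩
    change z • R u - H ⟨R u, hd⟩ = v
    have h3 : z • R u - H ⟨R u, hd⟩ = (z₀ • R u - H ⟨R u, hd⟩) + (z - z₀) • R u := by module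
    rw [← hAu, hAv, h3, e]
  · intro u
    have e := h.2 u
    have h1 : z • (u : B) - H u = A (z₀ • (u : B) - H u) := by
      rw [hAv, e]; module
    have h2 : Ring.inverse A (A (z₀ • (u : B) - H u)) = z₀ • (u : B) - H u := by
      have := congrArg (fun T : B →L[ℂ] B => T (z₀ • (u : B) - H u))
        (Ring.inverse_mul_cancel A hu)
      simpa using this
    change R (Ring.inverse A (z • (u : B) - H u)) = u
    rw [h1, h2, e]

theorem ResolventHypothesis.notMem_opSpectrum {α : ℝ} (hH : ResolventHypothesis H α) {z : ℂ}
    (hz : z.im ≠ 0) : z ∉ opSpectrum H := fun h => hz (hH.spectrum_real h)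

variable [CompleteSpace B]

theorem opResolvent_eventually {z₀ : ℂ} (hz : z₀ ∉ opSpectrum H) :
    ∀ᶠ z in 𝓝 z₀, z ∉ opSpectrum H ∧ opResolvent H z =
      opResolvent H z₀ * Ring.inverse (1 + (z - z₀) • opResolvent H z₀) := by
  have hc : ContinuousAt (fun z : ℂ => 1 + (z - z₀) • opResolvent H z₀) z₀ := by fun_prop
  have h1 : {x : B →L[ℂ] B | IsUnit x} ∈ 𝓝 (1 + (z₀ - z₀) • opResolvent H z₀) :=
    Units.isOpen.mem_nhds (by simp)
  filter_upwards [hc h1] with z hz'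
  have := (isResolventAt_opResolvent hz).perturb hz'
  exact ⟨not_not.2 ⟨_, this⟩, this.opResolvent_eq⟩

theorem isClosed_opSpectrum : IsClosed (opSpectrum H) := by
  rw [← isOpen_compl_iff, isOpen_iff_mem_nhds]
  intro z hz
  filter_upwards [opResolvent_eventually hz] with w hw using hw.1

theorem differentiableAt_opResolvent {z : ℂ} (hz : z ∉ opSpectrum H) :
    DifferentiableAt ℂ (opResolvent H) z := by
  have h : DifferentiableAt ℂ (fun w : ℂ =>
      opResolvent H z * Ring.inverse (1 + (w - z) • opResolvent H z)) z := by
    refine DifferentiableAt.const_mul ?_ _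
    have h1 : DifferentiableAt ℂ (fun w : ℂ => 1 + (w - z) • opResolvent H z) z := by fun_prop
    have h2 : DifferentiableAt ℂ (Ring.inverse : (B →L[ℂ] B) → (B →L[ℂ] B))
        (1 + (z - z) • opResolvent H z) := differentiableAt_inverse (by simp)
    exact DifferentiableAt.comp z (f := fun w : ℂ => 1 + (w - z) • opResolvent H z) h2 h1
  exact h.congr_of_eventuallyEq ((opResolvent_eventually hz).mono fun _ h => h.2)

theorem contDiffAt_opResolvent {z : ℂ} (hz : z ∉ opSpectrum H) :
    ContDiffAt ℝ 1 (opResolvent H) z := by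
  have h : DifferentiableOn ℂ (opResolvent H) (opSpectrum H)ᶜ := fun w hw =>
    (differentiableAt_opResolvent hw).differentiableWithinAt
  have h2 : ContDiffOn ℂ 1 (opResolvent H) (opSpectrum H)ᶜ :=
    h.contDiffOn isClosed_opSpectrum.isOpen_compl
  exact (h2.contDiffAt (isClosed_opSpectrum.isOpen_compl.mem_nhds hz)).restrict_scalars ℝ

end Resolvent

/-! ### Weights on the plane -/

section Weights

theorem bracket_sq {E : Type*} [NormedAddCommGroup E] (z : E) : bracket z ^ 2 = 1 + ‖z‖ ^ 2 :=
  Real.sq_sqrt (by positivity)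

theorem bracket_mono {E F : Type*} [NormedAddCommGroup E] [NormedAddCommGroup F] {z : E} {w : F}
    (h : ‖z‖ ≤ ‖w‖) : bracket z ≤ bracket w := by
  unfold bracket; gcongr

theorem bracket_le_mul {E F : Type*} [NormedAddCommGroup E] [NormedAddCommGroup F] {z : E} {w : F}
    {K : ℝ} (hK : 0 ≤ K) (h : 1 + ‖z‖ ^ 2 ≤ K ^ 2 * (1 + ‖w‖ ^ 2)) :
    bracket z ≤ K * bracket w := by
  refine Real.sqrt_le_iff.2 ⟨mul_nonneg hK (bracket_pos w).le, ?_⟩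
  rwa [mul_pow, bracket_sq]

theorem continuous_bracket {E : Type*} [NormedAddCommGroup E] :
    Continuous (bracket : E → ℝ) := by
  unfold bracket; fun_prop

theorem norm_le_bracket {E : Type*} [NormedAddCommGroup E] (z : E) : ‖z‖ ≤ bracket z :=
  Real.le_sqrt_of_sq_le (by linarith)

theorem bracket_le_one_add {E : Type*} [SeminormedAddGroup E] (z : E) : bracket z ≤ 1 + ‖z‖ := by
  refine Real.sqrt_le_iff.2 ⟨by positivity, ?_⟩
  nlinarith [norm_nonneg z]

theorem abs_im_le_bracket (z : ℂ) : |z.im| ≤ bracket z :=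
  (Complex.abs_im_le_norm z).trans (norm_le_bracket z)

theorem abs_im_div_bracket_nonneg (z : ℂ) : 0 ≤ |z.im| / bracket z :=
  div_nonneg (abs_nonneg _) (bracket_pos z).le

theorem abs_im_div_bracket_le_one (z : ℂ) : |z.im| / bracket z ≤ 1 :=
  div_le_one_of_le₀ (abs_im_le_bracket z) (bracket_pos z).le

theorem abs_im_div_bracket_pos {z : ℂ} (hz : z.im ≠ 0) : 0 < |z.im| / bracket z :=
  div_pos (abs_pos.2 hz) (bracket_pos z)

theorem bracket_add_le {z w : ℂ} (hw : ‖w‖ ≤ 1) : bracket (z + w) ≤ 2 * bracket z := by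
  refine bracket_le_mul two_pos.le ?_
  have h1 : ‖z + w‖ ≤ ‖z‖ + 1 := (norm_add_le _ _).trans (by linarith)
  have h2 := pow_le_pow_left₀ (norm_nonneg _) h1 2
  nlinarith [sq_nonneg (‖z‖ - 1)]

theorem bracket_le_add {z w : ℂ} (hw : ‖w‖ ≤ 1) : bracket z ≤ 2 * bracket (z + w) := by
  have := bracket_add_le (z := z + w) (w := -w) (by rwa [norm_neg])
  simpa using this

theorem rpow_le_of_comparable {K a b : ℝ} (hK : 0 < K) (ha : 0 < a) (hb : 0 < b)
    (hab : a ≤ K * b) (hba : b ≤ K * a) (p : ℝ) : a ^ p ≤ K ^ |p| * b ^ p := by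
  rcases le_total 0 p with hp | hp
  · rw [abs_of_nonneg hp, ← Real.mul_rpow hK.le hb.le]
    exact Real.rpow_le_rpow ha.le hab hp
  · rw [abs_of_nonpos hp, Real.rpow_neg hK.le, ← Real.inv_rpow hK.le,
      ← Real.mul_rpow (inv_nonneg.2 hK.le) hb.le]
    refine Real.rpow_le_rpow_of_nonpos (by positivity) ?_ hp
    rw [inv_mul_le_iff₀ hK]; exact hba

/-- The weight `⟨z⟩^(β - 2) (|Im z| / ⟨z⟩)^s`, which dominates the integrands of the calculus. -/
def hsWeight (β s : ℝ) (z : ℂ) : ℝ := bracket z ^ (β - 2) * (|z.im| / bracket z) ^ s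

theorem integrable_abs_rpow_mul_bracket {s t : ℝ} (hs : -1 < s) (ht : t ≤ 0) (hst : s + t < -1) :
    Integrable (fun y : ℝ => |y| ^ s * bracket y ^ t) := by
  have key : IntegrableOn (fun y : ℝ => y ^ s * bracket y ^ t) (Ioi 0) := by
    rw [← Ioc_union_Ioi_eq_Ioi zero_le_one]
    refine IntegrableOn.union ?_ ?_
    · have h1 : IntegrableOn (fun y : ℝ => y ^ s) (Ioc 0 1) :=
        (intervalIntegrable_iff_integrableOn_Ioc_of_le zero_le_one).1
          (intervalIntegral.intervalIntegrable_rpow' hs)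
      refine Integrable.mono' h1 (by unfold bracket; fun_prop) ?_
      filter_upwards [ae_restrict_mem measurableSet_Ioc] with y hy
      have h2 := hy.1
      have := bracket_pos y
      rw [Real.norm_of_nonneg (by positivity)]
      exact mul_le_of_le_one_right (by positivity)
        (Real.rpow_le_one_of_one_le_of_nonpos (one_le_bracket y) ht)
    · have h1 := integrableOn_Ioi_rpow_of_lt hst one_pos
      refine Integrable.mono' h1 (by unfold bracket; fun_prop) ?_
      filter_upwards [ae_restrict_mem measurableSet_Ioi] with y hy
      have h2 : (0 : ℝ) < y := one_pos.trans hy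
      have := bracket_pos y
      rw [Real.norm_of_nonneg (by positivity), Real.rpow_add h2]
      gcongr ?_ * ?_
      refine Real.rpow_le_rpow_of_nonpos h2 ?_ ht
      exact (le_abs_self y).trans (norm_le_bracket y)
  have := (integrable_fun_norm_addHaar (volume : Measure ℝ)
    (f := fun r : ℝ => r ^ s * Real.sqrt (1 + r ^ 2) ^ t)).2 ?_
  · simpa [bracket] using this
  · simpa [bracket] using key

theorem integrable_bracket_rpow {t : ℝ} (ht : t < -1) :
    Integrable (fun y : ℝ => bracket y ^ t) := by
  have := integrable_abs_rpow_mul_bracket (s := 0) (t := t) (by norm_num) (by linarith)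
    (by linarith)
  simpa using this

/-- Since `⟨z⟩` dominates both `⟨x⟩` and `⟨y⟩`, the weight is bounded by a product of integrable
functions of `x` and of `y`; half of the decay `β < 0` is spent on each factor. -/
theorem integrable_hsWeight {β s : ℝ} (hβ : β < 0) (hs : -1 < s) :
    Integrable (hsWeight β s) := by
  rw [integrable_complex_iff]
  have h1 := (integrable_bracket_rpow (t := -1 + β / 2) (by linarith)).mul_prod
    (integrable_abs_rpow_mul_bracket (s := s) (t := -1 - s + β / 2) hs (by linarith) (by linarith))
  refine Integrable.mono' h1 ?_ ?_
  · refine Measurable.aestronglyMeasurable ?_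
    have : Measurable (bracket : ℂ → ℝ) := continuous_bracket.measurable
    unfold hsWeight
    fun_prop
  · refine Eventually.of_forall fun p => ?_
    set z : ℂ := p.1 + p.2 * I with hz
    have him : z.im = p.2 := by simp [hz]
    have hre : z.re = p.1 := by simp [hz]
    have hb := bracket_pos z
    have h2 : bracket p.1 ≤ bracket z := bracket_mono (hre ▸ Complex.abs_re_le_norm z)
    have h3 : bracket p.2 ≤ bracket z := bracket_mono (him ▸ Complex.abs_im_le_norm z)
    have h4 := bracket_pos p.1
    have h5 := bracket_pos p.2
    rw [hsWeight, Real.norm_of_nonneg (by positivity), him, Real.div_rpow (abs_nonneg _) hb.le]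
    calc bracket z ^ (β - 2) * (|p.2| ^ s / bracket z ^ s)
        = bracket z ^ (-1 + β / 2) * (|p.2| ^ s * bracket z ^ (-1 - s + β / 2)) := by
          rw [div_eq_mul_inv, ← Real.rpow_neg hb.le, mul_left_comm, ← Real.rpow_add hb,
            mul_left_comm, ← Real.rpow_add hb]
          ring_nf
      _ ≤ _ := by
          gcongr ?_ * (_ * ?_)
          · exact Real.rpow_le_rpow_of_nonpos h4 h2 (by linarith)
          · exact Real.rpow_le_rpow_of_nonpos h5 h3 (by linarith)

theorem ae_im_ne_zero : ∀ᵐ z : ℂ, z.im ≠ 0 := by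
  have h : (volume : Measure ℂ) (LinearMap.ker Complex.imLm : Submodule ℝ ℂ) = 0 := by
    refine Measure.addHaar_submodule _ _ fun h => ?_
    have : I ∈ LinearMap.ker Complex.imLm := h ▸ Submodule.mem_top
    simp at this
  rw [ae_iff]
  convert h using 2
  ext z; simp

end Weights

/-! ### Generalised almost analytic extensions -/

section AlmostAnalytic

/-- Generalised almost analytic extensions of order `N`: functions on `ℂ` of growth `β`, whose
`∂/∂z̄`-derivative is smaller than the natural size `⟨z⟩^(β - 1)` by the factor
`(|Im z| / ⟨z⟩)^N`. -/
structure AlmostAnalytic (β : ℝ) (N : ℕ) (F : ℂ → ℂ) : Prop where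
  contDiff : ContDiff ℝ 1 F
  bound : ∃ C, 0 ≤ C ∧ ∀ z, ‖F z‖ ≤ C * bracket z ^ β
  dbar_bound : ∃ C, 0 ≤ C ∧
    ∀ z, ‖dbarC F z‖ ≤ C * (bracket z ^ (β - 1) * (|z.im| / bracket z) ^ N)

namespace AlmostAnalytic

variable {β β' : ℝ} {N N' : ℕ} {F G : ℂ → ℂ}

theorem differentiable (hF : AlmostAnalytic β N F) : Differentiable ℝ F :=
  hF.contDiff.differentiable one_ne_zero

theorem mono (hF : AlmostAnalytic β N F) (hβ : β ≤ β') (hN : N' ≤ N) :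
    AlmostAnalytic β' N' F := by
  obtain ⟨C, hC, h⟩ := hF.bound
  obtain ⟨D, hD, h'⟩ := hF.dbar_bound
  refine ⟨hF.contDiff, ⟨C, hC, fun z => (h z).trans ?_⟩, ⟨D, hD, fun z => (h' z).trans ?_⟩⟩
  · gcongr
    exact one_le_bracket z
  · have := abs_im_div_bracket_nonneg z
    have := bracket_pos z
    gcongr ?_ * (?_ * ?_)
    · exact Real.rpow_le_rpow_of_exponent_le (one_le_bracket z) (by linarith)
    · exact pow_le_pow_of_le_one (abs_im_div_bracket_nonneg z) (abs_im_div_bracket_le_one z) hN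

theorem add (hF : AlmostAnalytic β N F) (hG : AlmostAnalytic β N G) :
    AlmostAnalytic β N (fun z => F z + G z) := by
  obtain ⟨C, hC, h⟩ := hF.bound
  obtain ⟨D, hD, h'⟩ := hF.dbar_bound
  obtain ⟨C₁, hC₁, h₁⟩ := hG.bound
  obtain ⟨D₁, hD₁, h₁'⟩ := hG.dbar_bound
  refine ⟨hF.contDiff.add hG.contDiff, ⟨C + C₁, by positivity, fun z => ?_⟩,
    ⟨D + D₁, by positivity, fun z => ?_⟩⟩
  · rw [add_mul]
    exact (norm_add_le _ _).trans (add_le_add (h z) (h₁ z))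
  · rw [add_mul, dbarC_add (hF.differentiable z) (hG.differentiable z)]
    exact (norm_add_le _ _).trans (add_le_add (h' z) (h₁' z))

theorem const_smul (c : ℂ) (hF : AlmostAnalytic β N F) :
    AlmostAnalytic β N (fun z => c • F z) := by
  obtain ⟨C, hC, h⟩ := hF.bound
  obtain ⟨D, hD, h'⟩ := hF.dbar_bound
  refine ⟨hF.contDiff.const_smul c, ⟨‖c‖ * C, by positivity, fun z => ?_⟩,
    ⟨‖c‖ * D, by positivity, fun z => ?_⟩⟩
  · rw [norm_smul, mul_assoc]
    exact mul_le_mul_of_nonneg_left (h z) (norm_nonneg c)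
  · rw [dbarC_const_smul c (hF.differentiable z), norm_smul, mul_assoc]
    exact mul_le_mul_of_nonneg_left (h' z) (norm_nonneg c)

theorem sub (hF : AlmostAnalytic β N F) (hG : AlmostAnalytic β N G) :
    AlmostAnalytic β N (fun z => F z - G z) := by
  simpa [sub_eq_add_neg] using hF.add (hG.const_smul (-1))

theorem mul (hF : AlmostAnalytic β N F) (hG : AlmostAnalytic β' N G) :
    AlmostAnalytic (β + β') N (fun z => F z * G z) := by
  obtain ⟨C, hC, h⟩ := hF.bound
  obtain ⟨D, hD, h'⟩ := hF.dbar_bound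
  obtain ⟨C₁, hC₁, h₁⟩ := hG.bound
  obtain ⟨D₁, hD₁, h₁'⟩ := hG.dbar_bound
  refine ⟨hF.contDiff.mul hG.contDiff, ⟨C * C₁, by positivity, fun z => ?_⟩,
    ⟨D * C₁ + C * D₁, by positivity, fun z => ?_⟩⟩
  · have := bracket_pos z
    rw [norm_mul, Real.rpow_add this]
    calc ‖F z‖ * ‖G z‖ ≤ (C * bracket z ^ β) * (C₁ * bracket z ^ β') := by
          gcongr
          · exact h z
          · exact h₁ z
      _ = _ := by ring
  · have hb := bracket_pos z
    have h2 := dbarC_smul (hF.differentiable z) (hG.differentiable z)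
    simp only [smul_eq_mul] at h2
    have e1 : bracket z ^ (β + β' - 1) = bracket z ^ (β - 1) * bracket z ^ β' := by
      rw [← Real.rpow_add hb]; ring_nf
    have e2 : bracket z ^ (β + β' - 1) = bracket z ^ β * bracket z ^ (β' - 1) := by
      rw [← Real.rpow_add hb]; ring_nf
    have := abs_im_div_bracket_nonneg z
    rw [h2]
    calc ‖dbarC F z * G z + F z * dbarC G z‖ ≤ ‖dbarC F z‖ * ‖G z‖ + ‖F z‖ * ‖dbarC G z‖ := by
          refine (norm_add_le _ _).trans ?_
          rw [norm_mul, norm_mul]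
      _ ≤ (D * (bracket z ^ (β - 1) * (|z.im| / bracket z) ^ N)) * (C₁ * bracket z ^ β') +
          (C * bracket z ^ β) * (D₁ * (bracket z ^ (β' - 1) * (|z.im| / bracket z) ^ N)) := by
          gcongr
          · exact h' z
          · exact h₁ z
          · exact h z
          · exact h₁' z
      _ = D * C₁ * (bracket z ^ (β - 1) * bracket z ^ β') * (|z.im| / bracket z) ^ N +
          C * D₁ * (bracket z ^ β * bracket z ^ (β' - 1)) * (|z.im| / bracket z) ^ N := by ring
      _ = _ := by rw [← e1, ← e2]; ring

end AlmostAnalytic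

end AlmostAnalytic

/-! ### The Helffer–Sjöstrand integral -/

section Integrability

variable {B : Type*} [NormedAddCommGroup B] [NormedSpace ℂ B] {H : B →ₗ.[ℂ] B} {α : ℝ}

/-- The resolvent bound in the form in which it is used: `R(w)` is controlled by the weight at any
`z` that is no further from the real axis than `w` and of comparable size. -/
theorem ResolventHypothesis.exists_norm_le (hH : ResolventHypothesis H α) (hα : 0 ≤ α) :
    ∃ c, 0 ≤ c ∧ ∀ z w : ℂ, z.im ≠ 0 → |z.im| ≤ |w.im| → bracket w ≤ 2 * bracket z →
      ‖opResolvent H w‖ ≤ c * ((bracket z)⁻¹ * (|z.im| / bracket z) ^ (-1 - α)) := by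
  obtain ⟨c, hc⟩ := hH.bound
  refine ⟨|c| * 2 ^ α, by positivity, fun z w hz hzw hb => ?_⟩
  have hz' : 0 < |z.im| := abs_pos.2 hz
  have hw' : 0 < |w.im| := hz'.trans_le hzw
  have hbz := bracket_pos z
  have hbw := bracket_pos w
  calc ‖opResolvent H w‖ ≤ c * |w.im|⁻¹ * (bracket w / |w.im|) ^ α := hc w (abs_pos.1 hw')
    _ ≤ |c| * |w.im|⁻¹ * (bracket w / |w.im|) ^ α := by gcongr; exact le_abs_self c
    _ ≤ |c| * |z.im|⁻¹ * (2 * bracket z / |z.im|) ^ α := by gcongr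
    _ = _ := by
      have e : 2 * bracket z / |z.im| = 2 * (|z.im| / bracket z)⁻¹ := by
        rw [inv_div]; ring
      have ht := div_pos hz' hbz
      rw [e, Real.mul_rpow two_pos.le (by positivity), Real.inv_rpow ht.le, ← Real.rpow_neg ht.le,
        sub_eq_add_neg, Real.rpow_add ht, Real.rpow_neg_one]
      field_simp

/-- The size of `∂F/∂z̄` times the size of the resolvent. The exponent `N - 1 - α` exceeds `-1`
exactly if `N > α`. -/
theorem weight_mul {β : ℝ} {N : ℕ} {z : ℂ} (hz : z.im ≠ 0) :
    bracket z ^ (β - 1) * (|z.im| / bracket z) ^ N *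
      ((bracket z)⁻¹ * (|z.im| / bracket z) ^ (-1 - α)) = hsWeight β (N - 1 - α) z := by
  have hb := bracket_pos z
  have ht := abs_im_div_bracket_pos hz
  rw [hsWeight, ← Real.rpow_natCast, mul_mul_mul_comm, ← Real.rpow_add ht, ← Real.rpow_neg_one,
    ← Real.rpow_add hb]
  ring_nf

variable (H) in
/-- The Helffer–Sjöstrand integral `-(1/π) ∬ (∂F/∂z̄) (z - H)⁻¹ dx dy` of a function on `ℂ`. -/
def hsInt (F : ℂ → ℂ) : B →L[ℂ] B :=
  -((1 / Real.pi : ℝ) : ℂ) • ∫ z : ℂ, dbarC F z • opResolvent H z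

theorem hsInt_const_smul (c : ℂ) {F : ℂ → ℂ} (hF : Differentiable ℝ F) :
    hsInt H (fun z => c • F z) = c • hsInt H F := by
  simp only [hsInt, dbarC_const_smul c (hF _), smul_assoc]
  rw [integral_smul, smul_comm]

variable [CompleteSpace B]

theorem ResolventHypothesis.continuousAt (hH : ResolventHypothesis H α) {z : ℂ}
    (hz : z.im ≠ 0) : ContinuousAt (opResolvent H) z :=
  (contDiffAt_opResolvent (hH.notMem_opSpectrum hz)).continuousAt

theorem ResolventHypothesis.aestronglyMeasurable (hH : ResolventHypothesis H α) :
    AEStronglyMeasurable (opResolvent H) (volume : Measure ℂ) := by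
  have ho : IsOpen {z : ℂ | z.im ≠ 0} :=
    isOpen_ne_fun Complex.continuous_im continuous_const
  have h : ContinuousOn (opResolvent H) {z : ℂ | z.im ≠ 0} := fun z hz =>
    (hH.continuousAt hz).continuousWithinAt
  have h2 := h.aestronglyMeasurable (μ := volume) ho.measurableSet
  rwa [Measure.restrict_eq_self_of_ae_mem (s := {z : ℂ | z.im ≠ 0}) ae_im_ne_zero] at h2

theorem ResolventHypothesis.integrable_smul (hH : ResolventHypothesis H α) (hα : 0 ≤ α)
    {β : ℝ} {N : ℕ} (hβ : β < 0) (hN : α < N) {u : ℂ → ℂ} (hu : Continuous u) {C : ℝ}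
    (hb : ∀ z, ‖u z‖ ≤ C * (bracket z ^ (β - 1) * (|z.im| / bracket z) ^ N)) :
    Integrable (fun z => u z • opResolvent H z) := by
  obtain ⟨c, hc, hR⟩ := hH.exists_norm_le hα
  refine Integrable.mono' ((integrable_hsWeight (s := N - 1 - α) hβ (by linarith)).const_mul
    (C * c)) (hu.aestronglyMeasurable.smul hH.aestronglyMeasurable) ?_
  filter_upwards [ae_im_ne_zero] with z hz
  rw [norm_smul, ← weight_mul hz]
  calc ‖u z‖ * ‖opResolvent H z‖ ≤ (C * (bracket z ^ (β - 1) * (|z.im| / bracket z) ^ N)) *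
        (c * ((bracket z)⁻¹ * (|z.im| / bracket z) ^ (-1 - α))) := by
        gcongr
        · exact (norm_nonneg _).trans (hb z)
        · exact hb z
        · exact hR z z hz le_rfl (by linarith [bracket_pos z])
    _ = _ := by ring

theorem AlmostAnalytic.integrable (hH : ResolventHypothesis H α) (hα : 0 ≤ α)
    {β : ℝ} {N : ℕ} (hβ : β < 0) (hN : α < N) {F : ℂ → ℂ} (hF : AlmostAnalytic β N F) :
    Integrable (fun z => dbarC F z • opResolvent H z) := by
  obtain ⟨C, -, h⟩ := hF.dbar_bound
  exact hH.integrable_smul hα hβ hN (continuous_dbarC hF.contDiff) h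

theorem hsInt_add (hH : ResolventHypothesis H α) (hα : 0 ≤ α)
    {β : ℝ} {N : ℕ} (hβ : β < 0) (hN : α < N) {F G : ℂ → ℂ} (hF : AlmostAnalytic β N F)
    (hG : AlmostAnalytic β N G) :
    hsInt H (fun z => F z + G z) = hsInt H F + hsInt H G := by
  simp only [hsInt, dbarC_add (hF.differentiable _) (hG.differentiable _), add_smul]
  rw [integral_add (hF.integrable hH hα hβ hN) (hG.integrable hH hα hβ hN), smul_add]

end Integrability

/-! ### Cut-offs -/

section Cutoff

theorem exists_deriv_step_bound : ∃ D, 0 ≤ D ∧ ∀ t, ‖deriv step t‖ ≤ D := by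
  have hc : HasCompactSupport (deriv step) := by
    refine HasCompactSupport.intro (isCompact_Icc (a := (1 : ℝ)) (b := 2)) fun t ht => ?_
    rw [mem_Icc, not_and_or, not_le, not_le] at ht
    exact ht.elim deriv_step_of_lt deriv_step_of_gt
  obtain ⟨D, hD⟩ := continuous_deriv_step.bounded_above_of_compact_support hc
  exact ⟨D, (norm_nonneg _).trans (hD 0), hD⟩

theorem bracket_real_sq (x : ℝ) : bracket x ^ 2 = 1 + x ^ 2 := by
  rw [bracket_sq, Real.norm_eq_abs, sq_abs]

/-- The cut-off `χ(y / ⟨x⟩)`, with `χ(s)` a smooth function of `s²`. -/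
theorem exists_isCutoff : ∃ τ, IsCutoff τ := by
  -- `(7 - s²) / 3` is at least `2` for `|s| ≤ 1` and at most `1` for `|s| ≥ 2`
  set u : ℝ → ℝ → ℝ := fun x y => (7 - y ^ 2 / (1 + x ^ 2)) / 3 with hu
  have h0 : ∀ x : ℝ, 1 + x ^ 2 ≠ 0 := fun x => by positivity
  obtain ⟨D, hD0, hD⟩ := exists_deriv_step_bound
  refine ⟨fun x y => ((step (u x y) : ℝ) : ℂ), ?_, ?_, ?_, ?_⟩
  · refine Complex.ofRealCLM.contDiff.comp ((step_contDiff (n := ⊤)).comp ?_)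
    refine ContDiff.div_const (contDiff_const.sub (ContDiff.div (by fun_prop) (by fun_prop) ?_)) _
    exact fun p => h0 p.1
  · intro x y h
    rw [step_of_ge, Complex.ofReal_one]
    have : y ^ 2 ≤ 1 + x ^ 2 := by
      rw [← bracket_real_sq, ← sq_abs]; gcongr
    have := (div_le_one (by positivity : 0 < 1 + x ^ 2)).2 this
    simp only [hu]; linarith
  · intro x y h
    rw [step_of_le, Complex.ofReal_zero]
    have : 4 * (1 + x ^ 2) ≤ y ^ 2 := by
      rw [← bracket_real_sq, ← sq_abs y]
      have := bracket_pos x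
      nlinarith
    have := (le_div_iff₀ (by positivity : 0 < 1 + x ^ 2)).2 this
    simp only [hu]; linarith
  · refine ⟨D * (8 / 3), fun x y => ?_⟩
    have hb := bracket_pos x
    have hb2 := bracket_real_sq x
    have hdx : HasDerivAt (fun s => u s y) (2 * x * y ^ 2 / (3 * (bracket x ^ 2) ^ 2)) x := by
      have h1 : HasDerivAt (fun s : ℝ => 1 + s ^ 2) (2 * x) x := by
        simpa using (hasDerivAt_pow 2 x).const_add 1
      have h2 := (((h1.inv (h0 x)).const_mul (y ^ 2)).const_sub 7).div_const 3
      simp only [hu, div_eq_mul_inv]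
      simp only [Pi.inv_apply, div_eq_mul_inv] at h2
      refine h2.congr_deriv ?_
      rw [hb2]
      have := h0 x
      field_simp
    have hdy : HasDerivAt (fun t => u x t) (-(2 * y) / (3 * bracket x ^ 2)) y := by
      have h2 := (((hasDerivAt_pow 2 y).div_const (1 + x ^ 2)).const_sub 7).div_const 3
      refine h2.congr_deriv ?_
      rw [hb2]
      have := h0 x
      field_simp
      ring
    have hdx' : deriv (fun s => ((step (u s y) : ℝ) : ℂ)) x = _ :=
      ((hasDerivAt_step _).comp x hdx).ofReal_comp.deriv
    have hdy' : deriv (fun t => ((step (u x t) : ℝ) : ℂ)) y = _ :=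
      ((hasDerivAt_step _).comp y hdy).ofReal_comp.deriv
    rw [hdx', hdy', Complex.norm_real, Complex.norm_real, norm_mul, norm_mul]
    by_cases hs : deriv step (u x y) = 0
    · rw [hs]; simp only [norm_zero, zero_mul]
      exact ⟨by positivity, by positivity⟩
    · have h1 : 1 ≤ u x y := not_lt.1 fun h => hs (deriv_step_of_lt h)
      have h2 : y ^ 2 ≤ 4 * bracket x ^ 2 := by
        rw [hb2]
        have : y ^ 2 / (1 + x ^ 2) ≤ 4 := by simp only [hu] at h1; linarith
        rwa [div_le_iff₀ (by positivity)] at this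
      have h3 : |y| ≤ 2 * bracket x := abs_le_of_sq_le_sq (by nlinarith) (by positivity)
      have h4 : |x| ≤ bracket x := norm_le_bracket x
      have e1 : ‖2 * x * y ^ 2 / (3 * (bracket x ^ 2) ^ 2)‖ ≤ (8 / 3) / bracket x := by
        rw [norm_div, norm_mul, norm_mul, Real.norm_eq_abs x,
          Real.norm_of_nonneg (by positivity : (0 : ℝ) ≤ 3 * (bracket x ^ 2) ^ 2),
          Real.norm_of_nonneg (sq_nonneg y), Real.norm_of_nonneg two_pos.le]
        calc 2 * |x| * y ^ 2 / (3 * (bracket x ^ 2) ^ 2)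
            ≤ 2 * bracket x * (4 * bracket x ^ 2) / (3 * (bracket x ^ 2) ^ 2) := by gcongr
          _ = _ := by field_simp; norm_num
      have e2 : ‖-(2 * y) / (3 * bracket x ^ 2)‖ ≤ (8 / 3) / bracket x := by
        rw [norm_div, norm_neg, norm_mul, Real.norm_eq_abs y,
          Real.norm_of_nonneg (by positivity : (0 : ℝ) ≤ 3 * bracket x ^ 2),
          Real.norm_of_nonneg two_pos.le]
        calc 2 * |y| / (3 * bracket x ^ 2) ≤ 2 * (2 * bracket x) / (3 * bracket x ^ 2) := by
              gcongr
          _ = (4 / 3) / bracket x := by field_simp; norm_num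
          _ ≤ _ := by gcongr; norm_num
      rw [mul_div_assoc D]
      exact ⟨mul_le_mul (hD _) e1 (norm_nonneg _) hD0, mul_le_mul (hD _) e2 (norm_nonneg _) hD0⟩

variable {τ : ℝ → ℝ → ℂ}

theorem deriv_bound_nonneg {C : ℝ} (hC : ∀ x y : ℝ,
    ‖deriv (fun s => τ s y) x‖ ≤ C / bracket x ∧ ‖deriv (fun t => τ x t) y‖ ≤ C / bracket x) :
    0 ≤ C := by
  have h := (norm_nonneg _).trans (hC 0 0).1
  by_contra h'
  exact absurd (div_neg_of_neg_of_pos (not_le.1 h') (bracket_pos (0 : ℝ))) (not_lt.2 h)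

/-- A cut-off is bounded: along vertical lines it has derivative `O(⟨x⟩⁻¹)` and is supported in an
interval of length `O(⟨x⟩)`. -/
theorem IsCutoff.exists_norm_le (hτ : IsCutoff τ) : ∃ M, 0 ≤ M ∧ ∀ x y, ‖τ x y‖ ≤ M := by
  obtain ⟨C, hC⟩ := hτ.deriv_bound
  have hC0 : 0 ≤ C := deriv_bound_nonneg hC
  refine ⟨1 + 2 * C, by positivity, fun x y => ?_⟩
  have hb := bracket_pos x
  rcases le_or_gt (2 * bracket x) |y| with h | h
  · rw [hτ.eq_zero x y h, norm_zero]; positivity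
  · have hd : Differentiable ℝ (fun t => τ x t) := by
      have : ContDiff ℝ ∞ (fun t : ℝ => τ x t) :=
        hτ.smooth.comp (contDiff_const.prodMk contDiff_id)
      exact this.differentiable (by simp)
    have h1 := convex_univ.norm_image_sub_le_of_norm_deriv_le (𝕜 := ℝ) (f := fun t => τ x t)
      (C := C / bracket x) (fun t _ => hd t) (fun t _ => (hC x t).2) (mem_univ 0) (mem_univ y)
    rw [sub_zero, Real.norm_eq_abs, hτ.eq_one x 0 (by simpa using hb.le)] at h1
    have h2 : C / bracket x * |y| ≤ 2 * C := by
      rw [div_mul_eq_mul_div, div_le_iff₀ hb]; nlinarith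
    calc ‖τ x y‖ = ‖(τ x y - 1) + 1‖ := by rw [sub_add_cancel]
      _ ≤ ‖τ x y - 1‖ + 1 := (norm_add_le _ _).trans (by simp)
      _ ≤ _ := by linarith

theorem IsCutoff.deriv_eq_zero_of_lt (hτ : IsCutoff τ) {x y : ℝ} (h : |y| < bracket x) :
    deriv (fun s => τ s y) x = 0 ∧ deriv (fun t => τ x t) y = 0 := by
  constructor
  · have : (fun s => τ s y) =ᶠ[𝓝 x] fun _ => 1 := by
      filter_upwards [continuous_bracket.continuousAt.eventually_const_lt h] with s hs
      exact hτ.eq_one s y hs.le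
    rw [this.deriv_eq, deriv_const]
  · have : (fun t => τ x t) =ᶠ[𝓝 y] fun _ => 1 := by
      filter_upwards [continuous_abs.continuousAt.eventually_lt_const h] with s hs
      exact hτ.eq_one x s hs.le
    rw [this.deriv_eq, deriv_const]

theorem IsCutoff.deriv_eq_zero_of_gt (hτ : IsCutoff τ) {x y : ℝ} (h : 2 * bracket x < |y|) :
    deriv (fun s => τ s y) x = 0 ∧ deriv (fun t => τ x t) y = 0 := by
  constructor
  · have : (fun s => τ s y) =ᶠ[𝓝 x] fun _ => 0 := by
      filter_upwards [(continuous_const.mul continuous_bracket).continuousAt.eventually_lt_const h]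
        with s hs
      exact hτ.eq_zero s y hs.le
    rw [this.deriv_eq, deriv_const]
  · have : (fun t => τ x t) =ᶠ[𝓝 y] fun _ => 0 := by
      filter_upwards [continuous_abs.continuousAt.eventually_const_lt h] with s hs
      exact hτ.eq_zero x s hs.le
    rw [this.deriv_eq, deriv_const]

end Cutoff

/-! ### Almost analytic extensions of symbols -/

section Extension

variable {τ : ℝ → ℝ → ℂ} {f : ℝ → ℂ} {n : ℕ}

/-- The almost analytic extension as a function of a complex variable. -/
def aaExt (n : ℕ) (τ : ℝ → ℝ → ℂ) (f : ℝ → ℂ) (z : ℂ) : ℂ := almostAnalyticExt n τ f z.re z.im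

theorem contDiff_iteratedDeriv (hf : ContDiff ℝ ∞ f) (r : ℕ) :
    ContDiff ℝ ∞ (iteratedDeriv r f) := by
  rw [iteratedDeriv_eq_iterate]
  exact hf.iterate_deriv r

theorem hasDerivAt_iteratedDeriv (hf : ContDiff ℝ ∞ f) (r : ℕ) (x : ℝ) :
    HasDerivAt (iteratedDeriv r f) (iteratedDeriv (r + 1) f x) x := by
  rw [iteratedDeriv_succ]
  exact ((contDiff_iteratedDeriv hf r).differentiable (by simp) x).hasDerivAt

theorem contDiff_aaExt (hτ : IsCutoff τ) (hf : ContDiff ℝ ∞ f) :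
    ContDiff ℝ ∞ (aaExt n τ f) := by
  unfold aaExt almostAnalyticExt
  refine ContDiff.mul (ContDiff.sum fun r _ => ?_) ?_
  · refine ContDiff.div_const (ContDiff.mul ?_ (ContDiff.pow (contDiff_const.mul ?_) r)) _
    · exact (contDiff_iteratedDeriv hf r).comp Complex.reCLM.contDiff
    · exact Complex.ofRealCLM.contDiff.comp Complex.imCLM.contDiff
  · exact hτ.smooth.comp (Complex.reCLM.contDiff.prodMk Complex.imCLM.contDiff)

theorem dbar_eq_dbarC {g : ℝ → ℝ → ℂ} {z : ℂ}
    (h : DifferentiableAt ℝ (fun w : ℂ => g w.re w.im) z) :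
    dbar g z = dbarC (fun w : ℂ => g w.re w.im) z := by
  have h' : DifferentiableAt ℝ (fun w : ℂ => g w.re w.im) (z.re + z.im * I) := by
    rwa [Complex.re_add_im]
  have h1 := deriv_slice_re h'
  have h2 := deriv_slice_im h'
  simp only [Complex.add_re, Complex.ofReal_re, Complex.mul_re, Complex.I_re, mul_zero,
    Complex.ofReal_im, Complex.I_im, mul_one, sub_self, add_zero, Complex.add_im, Complex.mul_im,
    zero_add, Complex.re_add_im] at h1 h2
  simp [dbar, dbarC, h1.deriv, h2.deriv]

theorem dbar_almostAnalyticExt (hτ : IsCutoff τ) (hf : ContDiff ℝ ∞ f) (z : ℂ) :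
    dbar (almostAnalyticExt n τ f) z = dbarC (aaExt n τ f) z :=
  dbar_eq_dbarC ((contDiff_aaExt hτ hf).differentiable (by simp) z)

theorem hsIntegral_eq_hsInt {B : Type*} [NormedAddCommGroup B] [NormedSpace ℂ B]
    (H : B →ₗ.[ℂ] B) (hτ : IsCutoff τ) (hf : ContDiff ℝ ∞ f) :
    hsIntegral H n τ f = hsInt H (aaExt n τ f) := by
  simp only [hsIntegral, hsInt, hsIntegrand, dbar_almostAnalyticExt hτ hf]

/-- In `∂f̃/∂z̄` the derivatives of the Taylor polynomial telescope: only the term with `f⁽ⁿ⁺¹⁾`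
and the terms with derivatives of the cut-off survive. -/
theorem dbarC_aaExt (hτ : IsCutoff τ) (hf : ContDiff ℝ ∞ f) (x y : ℝ) :
    dbarC (aaExt n τ f) (x + y * I) = (1 / 2) *
      (iteratedDeriv (n + 1) f x * (I * y) ^ n / n.factorial * τ x y +
        (∑ r ∈ Finset.range (n + 1), iteratedDeriv r f x * (I * y) ^ r / r.factorial) *
          (deriv (fun s => τ s y) x + I * deriv (fun t => τ x t) y)) := by
  rw [← dbar_almostAnalyticExt hτ hf, dbar]
  simp only [Complex.add_re, Complex.ofReal_re, Complex.mul_re, Complex.I_re, mul_zero,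
    Complex.ofReal_im, Complex.I_im, mul_one, sub_self, add_zero, Complex.add_im, Complex.mul_im,
    zero_add]
  have hτx : HasDerivAt (fun s => τ s y) (deriv (fun s => τ s y) x) x := by
    have : ContDiff ℝ ∞ (fun s : ℝ => τ s y) := hτ.smooth.comp (contDiff_id.prodMk contDiff_const)
    exact (this.differentiable (by simp) x).hasDerivAt
  have hτy : HasDerivAt (fun t => τ x t) (deriv (fun t => τ x t) y) y := by
    have : ContDiff ℝ ∞ (fun t : ℝ => τ x t) := hτ.smooth.comp (contDiff_const.prodMk contDiff_id)
    exact (this.differentiable (by simp) y).hasDerivAt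
  have hx : HasDerivAt (fun s => almostAnalyticExt n τ f s y)
      ((∑ r ∈ Finset.range (n + 1), iteratedDeriv (r + 1) f x * (I * y) ^ r / r.factorial) *
        τ x y + (∑ r ∈ Finset.range (n + 1), iteratedDeriv r f x * (I * y) ^ r / r.factorial) *
        deriv (fun s => τ s y) x) x := by
    refine HasDerivAt.mul (HasDerivAt.fun_sum fun r _ => ?_) hτx
    exact ((hasDerivAt_iteratedDeriv hf r x).mul_const _).div_const _
  have hy : HasDerivAt (fun t => almostAnalyticExt n τ f x t)
      ((∑ r ∈ Finset.range (n + 1),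
        iteratedDeriv r f x * (r * (I * y) ^ (r - 1) * I) / r.factorial) *
        τ x y + (∑ r ∈ Finset.range (n + 1), iteratedDeriv r f x * (I * y) ^ r / r.factorial) *
        deriv (fun t => τ x t) y) y := by
    refine HasDerivAt.mul (HasDerivAt.fun_sum fun r _ => ?_) hτy
    have h1 : HasDerivAt (fun t : ℝ => I * (t : ℂ)) I y := by
      simpa using (Complex.ofRealCLM.hasDerivAt (x := y)).const_mul I
    exact ((h1.pow r).const_mul _).div_const _
  -- the telescoping sum
  have tel : ∀ m : ℕ,
      (∑ r ∈ Finset.range (m + 1), iteratedDeriv (r + 1) f x * (I * y) ^ r / r.factorial) +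
        I * (∑ r ∈ Finset.range (m + 1),
          iteratedDeriv r f x * (r * (I * y) ^ (r - 1) * I) / r.factorial) =
      iteratedDeriv (m + 1) f x * (I * y) ^ m / m.factorial := by
    intro m
    induction m with
    | zero => simp
    | succ m ih =>
      rw [Finset.sum_range_succ, Finset.sum_range_succ _ (m + 1), mul_add, add_add_add_comm, ih]
      have h1 : ((m + 1 : ℕ) : ℂ) ≠ 0 := by exact_mod_cast m.succ_ne_zero
      have h2 : (m.factorial : ℂ) ≠ 0 := by exact_mod_cast m.factorial_ne_zero
      rw [Nat.factorial_succ]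
      push_cast at h1 ⊢
      field_simp
      linear_combination (iteratedDeriv (m + 1) f x * I ^ m * y ^ m * (m + 1)) * Complex.I_sq
  rw [hx.deriv, hy.deriv, ← tel n]
  ring

/-- The line version of the density of the norms `‖f‖ₙ`: `∑_{r ≤ n} |f⁽ʳ⁾(x)| ⟨x⟩^(r - 1)`. -/
def normDensity (n : ℕ) (f : ℝ → ℂ) (x : ℝ) : ℝ :=
  ∑ r ∈ Finset.range (n + 1), ‖iteratedDeriv r f x‖ * bracket x ^ ((r : ℝ) - 1)

theorem normDensity_nonneg (n : ℕ) (f : ℝ → ℂ) (x : ℝ) : 0 ≤ normDensity n f x :=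
  Finset.sum_nonneg fun _ _ => mul_nonneg (norm_nonneg _) (Real.rpow_nonneg (bracket_pos x).le _)

theorem dbarC_aaExt_eq_zero (hτ : IsCutoff τ) (hf : ContDiff ℝ ∞ f) {x y : ℝ}
    (h : 2 * bracket x < |y|) : dbarC (aaExt n τ f) (x + y * I) = 0 := by
  obtain ⟨h1, h2⟩ := hτ.deriv_eq_zero_of_gt h
  rw [dbarC_aaExt hτ hf, h1, h2, hτ.eq_zero x y h.le]
  simp

theorem norm_taylor_le {x y : ℝ} (h : |y| ≤ 2 * bracket x) :
    ‖∑ r ∈ Finset.range (n + 1), iteratedDeriv r f x * (I * y) ^ r / r.factorial‖ ≤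
      2 ^ n * ∑ r ∈ Finset.range (n + 1), ‖iteratedDeriv r f x‖ * bracket x ^ r := by
  rw [Finset.mul_sum]
  refine (norm_sum_le _ _).trans (Finset.sum_le_sum fun r hr => ?_)
  have hr' : r ≤ n := Nat.lt_succ_iff.1 (Finset.mem_range.1 hr)
  have hb := bracket_pos x
  rw [norm_div, norm_mul, norm_pow, norm_mul, Complex.norm_I, one_mul, Complex.norm_real,
    Real.norm_eq_abs, Complex.norm_natCast]
  have hf1 : (1 : ℝ) ≤ r.factorial := by exact_mod_cast Nat.one_le_iff_ne_zero.2 r.factorial_ne_zero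
  calc ‖iteratedDeriv r f x‖ * |y| ^ r / r.factorial ≤ ‖iteratedDeriv r f x‖ * |y| ^ r :=
        div_le_self (by positivity) hf1
    _ ≤ ‖iteratedDeriv r f x‖ * (2 * bracket x) ^ r := by gcongr
    _ = 2 ^ r * (‖iteratedDeriv r f x‖ * bracket x ^ r) := by rw [mul_pow]; ring
    _ ≤ _ := by gcongr; norm_num

/-- The basic estimate for `∂f̃/∂z̄`, with a constant that does not depend on `f`. -/
theorem exists_dbarC_aaExt_le (hτ : IsCutoff τ) (n : ℕ) : ∃ K, 0 ≤ K ∧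
    ∀ f : ℝ → ℂ, ContDiff ℝ ∞ f → ∀ x y : ℝ, |y| ≤ 2 * bracket x →
      ‖dbarC (aaExt n τ f) (x + y * I)‖ ≤
        K * (normDensity (n + 1) f x * (|y| / bracket x) ^ n) := by
  obtain ⟨C, hC⟩ := hτ.deriv_bound
  obtain ⟨M, hM0, hM⟩ := hτ.exists_norm_le
  have hC0 : 0 ≤ C := deriv_bound_nonneg hC
  refine ⟨M + 2 ^ n * C, by positivity, fun f hf x y hy => ?_⟩
  have hb := bracket_pos x
  have hdens : normDensity (n + 1) f x =
      (∑ r ∈ Finset.range (n + 1), ‖iteratedDeriv r f x‖ * bracket x ^ ((r : ℝ) - 1)) +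
        ‖iteratedDeriv (n + 1) f x‖ * bracket x ^ n := by
    rw [normDensity, Finset.sum_range_succ]
    congr 2
    push_cast
    rw [add_sub_cancel_right, Real.rpow_natCast]
  have hs0 : 0 ≤ ∑ r ∈ Finset.range (n + 1),
      ‖iteratedDeriv r f x‖ * bracket x ^ ((r : ℝ) - 1) :=
    Finset.sum_nonneg fun r _ => mul_nonneg (norm_nonneg _) (Real.rpow_nonneg hb.le _)
  have ht0 : 0 ≤ |y| / bracket x := by positivity
  have hfac : (1 : ℝ) ≤ n.factorial := by
    exact_mod_cast Nat.one_le_iff_ne_zero.2 n.factorial_ne_zero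
  -- the remainder of the Taylor polynomial
  have e1 : ‖iteratedDeriv (n + 1) f x * (I * y) ^ n / n.factorial * τ x y‖ ≤
      M * (normDensity (n + 1) f x * (|y| / bracket x) ^ n) := by
    rw [norm_mul, norm_div, norm_mul, norm_pow, norm_mul, Complex.norm_I, one_mul,
      Complex.norm_real, Real.norm_eq_abs, Complex.norm_natCast, mul_comm]
    gcongr ?_ * ?_
    · exact hM x y
    · calc ‖iteratedDeriv (n + 1) f x‖ * |y| ^ n / n.factorial
          ≤ ‖iteratedDeriv (n + 1) f x‖ * |y| ^ n := div_le_self (by positivity) hfac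
        _ = (‖iteratedDeriv (n + 1) f x‖ * bracket x ^ n) * (|y| / bracket x) ^ n := by
          rw [div_pow]; field_simp
        _ ≤ _ := by
          gcongr
          rw [hdens]; linarith
  -- the derivatives of `τ` vanish for `|y| < ⟨x⟩`, so that `(|y| / ⟨x⟩)^n ≥ 1` where they do not
  have e2 : ‖(∑ r ∈ Finset.range (n + 1), iteratedDeriv r f x * (I * y) ^ r / r.factorial) *
          (deriv (fun s => τ s y) x + I * deriv (fun t => τ x t) y)‖ ≤
      (2 ^ n * (2 * C)) * (normDensity (n + 1) f x * (|y| / bracket x) ^ n) := by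
    rcases lt_or_ge |y| (bracket x) with h | h
    · obtain ⟨h1, h2⟩ := hτ.deriv_eq_zero_of_lt h
      rw [h1, h2]
      simp only [mul_zero, add_zero, norm_zero]
      have := normDensity_nonneg (n + 1) f x
      positivity
    · have h1 : ‖deriv (fun s => τ s y) x + I * deriv (fun t => τ x t) y‖ ≤ 2 * C / bracket x := by
        refine (norm_add_le _ _).trans ?_
        rw [norm_mul, Complex.norm_I, one_mul]
        have := hC x y
        calc _ ≤ C / bracket x + C / bracket x := add_le_add this.1 this.2
          _ = _ := by ring
      have h2 : 1 ≤ (|y| / bracket x) ^ n := one_le_pow₀ ((one_le_div hb).2 h)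
      rw [norm_mul]
      calc _ ≤ (2 ^ n * ∑ r ∈ Finset.range (n + 1), ‖iteratedDeriv r f x‖ * bracket x ^ r) *
            (2 * C / bracket x) := by
            gcongr
            exact norm_taylor_le hy
        _ = 2 ^ n * (2 * C) * ((∑ r ∈ Finset.range (n + 1),
              ‖iteratedDeriv r f x‖ * bracket x ^ ((r : ℝ) - 1)) * 1) := by
            have : ∀ r : ℕ, bracket x ^ ((r : ℝ) - 1) = bracket x ^ r / bracket x := fun r => by
              rw [Real.rpow_sub_one hb.ne', Real.rpow_natCast]
            simp only [this, mul_div_assoc', ← Finset.sum_div]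
            ring
        _ ≤ _ := by
            gcongr
            · exact normDensity_nonneg _ _ _
            · rw [hdens]
              have : 0 ≤ ‖iteratedDeriv (n + 1) f x‖ * bracket x ^ n := by positivity
              linarith
  rw [dbarC_aaExt hτ hf, norm_mul]
  calc _ ≤ ‖(1 / 2 : ℂ)‖ * (M * (normDensity (n + 1) f x * (|y| / bracket x) ^ n) +
        (2 ^ n * (2 * C)) * (normDensity (n + 1) f x * (|y| / bracket x) ^ n)) := by
        gcongr
        exact (norm_add_le _ _).trans (add_le_add e1 e2)
    _ = (M / 2 + 2 ^ n * C) * (normDensity (n + 1) f x * (|y| / bracket x) ^ n) := by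
        norm_num; ring
    _ ≤ _ := by
        have := normDensity_nonneg (n + 1) f x
        gcongr
        linarith

theorem bracket_re_le (x y : ℝ) : bracket x ≤ bracket ((x : ℂ) + y * I) :=
  bracket_mono (by
    have := Complex.abs_re_le_norm ((x : ℂ) + y * I)
    simpa using this)

theorem bracket_le_three_mul {x y : ℝ} (h : |y| ≤ 2 * bracket x) :
    bracket ((x : ℂ) + y * I) ≤ 3 * bracket x := by
  refine bracket_le_mul (by norm_num) ?_
  have h1 : ‖(x : ℂ) + y * I‖ ^ 2 = x ^ 2 + y ^ 2 := by
    rw [Complex.sq_norm, Complex.normSq_add_mul_I]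
  have h2 : y ^ 2 ≤ 4 * (1 + x ^ 2) := by
    rw [← bracket_real_sq, ← sq_abs y]
    have := abs_nonneg y
    nlinarith
  rw [h1, Real.norm_eq_abs, sq_abs]
  nlinarith

theorem IsSymbolOn.contDiff {β : ℝ} (hf : IsSymbolOn univ β f) : ContDiff ℝ ∞ f :=
  contDiffOn_univ.1 hf.1

theorem IsSymbolOn.exists_norm_iteratedDeriv_le {β : ℝ} (hf : IsSymbolOn univ β f) (n : ℕ) :
    ∃ c, 0 < c ∧ ∀ x, ‖iteratedDeriv n f x‖ ≤ c * bracket x ^ (β - n) := by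
  obtain ⟨c, hc, h⟩ := hf.2 n
  refine ⟨c, hc, fun x => ?_⟩
  rw [← iteratedDerivWithin_univ]
  exact h x (mem_univ x)

theorem IsSymbolOn.exists_normDensity_le {β : ℝ} (hf : IsSymbolOn univ β f) (n : ℕ) :
    ∃ c, 0 ≤ c ∧ ∀ x, normDensity n f x ≤ c * bracket x ^ (β - 1) := by
  choose c hc h using hf.exists_norm_iteratedDeriv_le
  refine ⟨∑ r ∈ Finset.range (n + 1), c r, Finset.sum_nonneg fun r _ => (hc r).le, fun x => ?_⟩
  rw [normDensity, Finset.sum_mul]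
  refine Finset.sum_le_sum fun r _ => ?_
  have hb := bracket_pos x
  calc _ ≤ c r * bracket x ^ (β - r) * bracket x ^ ((r : ℝ) - 1) := by
        gcongr
        exact h r x
    _ = _ := by
        rw [mul_assoc, ← Real.rpow_add hb]; ring_nf

theorem isSymbolOn_of_hasCompactSupport (hf : ContDiff ℝ ∞ f)
    (hc : HasCompactSupport f) (β : ℝ) : IsSymbolOn univ β f := by
  refine ⟨hf.contDiffOn, fun n => ?_⟩
  have h1 : Continuous (fun x => ((bracket x ^ (n - β) : ℝ) : ℂ) * iteratedDeriv n f x) := by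
    refine Continuous.mul (Complex.continuous_ofReal.comp ?_)
      (contDiff_iteratedDeriv hf n).continuous
    exact continuous_bracket.rpow_const fun x => Or.inl (bracket_pos x).ne'
  have h2 : HasCompactSupport (iteratedDeriv n f) := by
    refine hc.mono' (Function.support_subset_iff'.2 fun x hx => ?_)
    have h3 : f =ᶠ[𝓝 x] fun _ => 0 := notMem_tsupport_iff_eventuallyEq.1 hx
    rw [h3.iteratedDeriv_eq n]
    simp
  obtain ⟨C, hC⟩ := h1.bounded_above_of_compact_support h2.mul_left
  refine ⟨max C 1, by positivity, fun x _ => ?_⟩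
  have hb := bracket_pos x
  have h3 := hC x
  rw [norm_mul, Complex.norm_real, Real.norm_of_nonneg (by positivity)] at h3
  rw [iteratedDerivWithin_univ]
  have e : bracket x ^ (β - n) = (bracket x ^ (n - β))⁻¹ := by
    rw [← Real.rpow_neg hb.le]; ring_nf
  rw [e, ← div_eq_mul_inv, le_div_iff₀ (by positivity), mul_comm]
  exact h3.trans (le_max_left _ _)

/-- Almost analytic extensions of functions in `S^β` have growth `β`: on the support of `f̃` the
weights `⟨x⟩` and `⟨z⟩` are comparable. -/
theorem almostAnalytic_aaExt (hτ : IsCutoff τ) {β : ℝ} (hf : IsSymbolOn univ β f) (n : ℕ) :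
    AlmostAnalytic β n (aaExt n τ f) := by
  refine ⟨(contDiff_aaExt hτ hf.contDiff).of_le (by simp), ?_, ?_⟩
  · obtain ⟨M, hM0, hM⟩ := hτ.exists_norm_le
    choose c hc h using hf.exists_norm_iteratedDeriv_le
    have hs : 0 ≤ ∑ r ∈ Finset.range (n + 1), c r := Finset.sum_nonneg fun r _ => (hc r).le
    refine ⟨2 ^ n * (∑ r ∈ Finset.range (n + 1), c r) * M * 3 ^ |β|, by positivity, fun z => ?_⟩
    obtain ⟨x, y, rfl⟩ : ∃ x y : ℝ, z = x + y * I := ⟨z.re, z.im, (Complex.re_add_im z).symm⟩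
    have hb := bracket_pos x
    have hbz := bracket_pos ((x : ℂ) + y * I)
    have e : aaExt n τ f (x + y * I) = (∑ r ∈ Finset.range (n + 1),
        iteratedDeriv r f x * (I * (y : ℂ)) ^ r / (r.factorial : ℂ)) * τ x y := by
      simp [aaExt, almostAnalyticExt]
    rcases le_or_gt |y| (2 * bracket x) with hy | hy
    · rw [e, norm_mul]
      calc _ ≤ (2 ^ n * ∑ r ∈ Finset.range (n + 1), ‖iteratedDeriv r f x‖ * bracket x ^ r) * M := by
            gcongr
            · exact norm_taylor_le hy
            · exact hM x y
        _ ≤ (2 ^ n * ∑ r ∈ Finset.range (n + 1), c r * bracket x ^ β) * M := by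
            gcongr ?_ * ?_ * _
            refine Finset.sum_le_sum fun r _ => ?_
            calc _ ≤ c r * bracket x ^ (β - r) * bracket x ^ r := by
                  gcongr
                  exact h r x
              _ = _ := by
                  rw [mul_assoc, ← Real.rpow_natCast, ← Real.rpow_add hb]; ring_nf
        _ = 2 ^ n * (∑ r ∈ Finset.range (n + 1), c r) * M * bracket x ^ β := by
            rw [← Finset.sum_mul]; ring
        _ ≤ 2 ^ n * (∑ r ∈ Finset.range (n + 1), c r) * M *
              (3 ^ |β| * bracket ((x : ℂ) + y * I) ^ β) := by
            gcongr
            exact rpow_le_of_comparable three_pos hb hbz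
              ((bracket_re_le x y).trans (by linarith)) (bracket_le_three_mul hy) β
        _ = _ := by ring
    · rw [e, hτ.eq_zero x y hy.le, mul_zero, norm_zero]
      positivity
  · obtain ⟨K, hK0, hK⟩ := exists_dbarC_aaExt_le hτ n
    obtain ⟨c, hc0, hc⟩ := hf.exists_normDensity_le (n + 1)
    refine ⟨K * c * 3 ^ |β - 1| * 3 ^ n, by positivity, fun z => ?_⟩
    obtain ⟨x, y, rfl⟩ : ∃ x y : ℝ, z = x + y * I := ⟨z.re, z.im, (Complex.re_add_im z).symm⟩
    have hb := bracket_pos x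
    have hbz := bracket_pos ((x : ℂ) + y * I)
    have him : ((x : ℂ) + y * I).im = y := by simp
    rw [him]
    rcases le_or_gt |y| (2 * bracket x) with hy | hy
    · have h3 := bracket_le_three_mul hy
      calc _ ≤ K * (normDensity (n + 1) f x * (|y| / bracket x) ^ n) := hK f hf.contDiff x y hy
        _ ≤ K * ((c * (3 ^ |β - 1| * bracket ((x : ℂ) + y * I) ^ (β - 1))) *
              (3 * (|y| / bracket ((x : ℂ) + y * I))) ^ n) := by
            gcongr ?_ * (?_ * ?_ ^ n)
            · refine (hc x).trans ?_
              gcongr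
              exact rpow_le_of_comparable three_pos hb hbz
                ((bracket_re_le x y).trans (by linarith)) h3 (β - 1)
            · rw [mul_div_assoc', div_le_div_iff₀ hb hbz]
              nlinarith [abs_nonneg y]
        _ = _ := by rw [mul_pow]; ring
    · rw [dbarC_aaExt_eq_zero hτ hf.contDiff hy, norm_zero]
      positivity

theorem aaExt_ofReal (hτ : IsCutoff τ) (n : ℕ) (f : ℝ → ℂ) (x : ℝ) : aaExt n τ f x = f x := by
  have h : τ x 0 = 1 := hτ.eq_one x 0 (by simpa using (bracket_pos x).le)
  simp [aaExt, almostAnalyticExt, h, Finset.sum_range_succ']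

theorem hasCompactSupport_aaExt (hτ : IsCutoff τ) (n : ℕ) (hf : HasCompactSupport f) :
    HasCompactSupport (aaExt n τ f) := by
  obtain ⟨r, hr⟩ := hf.isBounded.subset_closedBall 0
  refine HasCompactSupport.intro (isCompact_closedBall (0 : ℂ) (|r| + 2 * bracket r))
    fun z hz => ?_
  rw [mem_closedBall_zero_iff, not_le] at hz
  by_contra hne
  have hne' : almostAnalyticExt n τ f z.re z.im ≠ 0 := hne
  have h1 : |z.im| < 2 * bracket z.re := by
    by_contra h
    refine hne' ?_
    rw [almostAnalyticExt, hτ.eq_zero _ _ (not_lt.1 h), mul_zero]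
  have h2 : z.re ∈ tsupport f := by
    by_contra h
    refine hne' ?_
    rw [almostAnalyticExt, Finset.sum_eq_zero, zero_mul]
    intro k _
    have : iteratedDeriv k f z.re = 0 := by
      have h3 : f =ᶠ[𝓝 z.re] fun _ => 0 := notMem_tsupport_iff_eventuallyEq.1 h
      rw [h3.iteratedDeriv_eq k]
      simp
    simp [this]
  have h3 : |z.re| ≤ |r| := by
    have := hr h2
    rw [mem_closedBall_zero_iff, Real.norm_eq_abs] at this
    exact this.trans (le_abs_self r)
  have h4 : bracket z.re ≤ bracket r := bracket_mono (by simpa using h3)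
  linarith [Complex.norm_le_abs_re_add_abs_im z]

end Extension

/-! ### The norm bound -/

section NormBound

variable {B : Type*} [NormedAddCommGroup B] [NormedSpace ℂ B] [CompleteSpace B]
  {H : B →ₗ.[ℂ] B} {α : ℝ} {τ : ℝ → ℝ → ℂ}

theorem continuous_normDensity {f : ℝ → ℂ} (hf : ContDiff ℝ ∞ f) (n : ℕ) :
    Continuous (normDensity n f) := by
  unfold normDensity
  refine continuous_finsetSum _ fun r _ => ((contDiff_iteratedDeriv hf r).continuous.norm).mul ?_
  exact continuous_bracket.rpow_const fun x => Or.inl (bracket_pos x).ne'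

theorem integrable_normDensity {f : ℝ → ℂ} {β : ℝ} (hβ : β < 0) (hf : IsSymbolOn univ β f)
    (n : ℕ) : Integrable (normDensity n f) := by
  obtain ⟨c, -, hc⟩ := hf.exists_normDensity_le n
  refine ((integrable_bracket_rpow (t := β - 1) (by linarith)).const_mul c).mono'
    (continuous_normDensity hf.contDiff n).aestronglyMeasurable (Eventually.of_forall fun x => ?_)
  rw [Real.norm_of_nonneg (normDensity_nonneg _ _ _)]
  exact hc x

/-- The integral is bounded by `∑_{r ≤ n + 1} ∫ |f⁽ʳ⁾(x)| ⟨x⟩^(r - 1) dx`. After the substitution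
`y = s ⟨x⟩`, the integral in `y` of the bound for the integrand no longer depends on `x`. -/
theorem exists_norm_hsInt_aaExt_le (hH : ResolventHypothesis H α) (hα : 0 ≤ α)
    (hτ : IsCutoff τ) {n : ℕ} (hn : α < n) : ∃ K, 0 ≤ K ∧ ∀ (β : ℝ) (f : ℝ → ℂ), β < 0 →
      IsSymbolOn univ β f →
      ‖hsInt H (aaExt n τ f)‖ ≤ K * ∫ x, normDensity (n + 1) f x := by
  obtain ⟨K, hK0, hK⟩ := exists_dbarC_aaExt_le hτ n
  obtain ⟨c, hc0, hc⟩ := hH.exists_norm_le hα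
  set σ : ℝ := n - 1 - α with hσ
  -- only `|s| ≤ 2` matters; there the second factor is bounded below, and it makes `k` integrable
  set k : ℝ → ℝ := fun s => |s| ^ σ * bracket s ^ (-σ - 2) with hk
  have hki : Integrable k :=
    integrable_abs_rpow_mul_bracket (by linarith) (by linarith) (by linarith)
  have hk0 : ∀ s, 0 ≤ k s := fun s => by
    have := bracket_pos s
    positivity
  have hkint : 0 ≤ ∫ s, k s := integral_nonneg hk0
  set L : ℝ := K * c * 3 ^ α * 3 ^ (σ + 2) with hL
  have hL0 : 0 ≤ L := by positivity
  refine ⟨‖(-((1 / Real.pi : ℝ) : ℂ))‖ * (L * ∫ s, k s), by positivity, fun β f hβ hf => ?_⟩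
  have hpt : ∀ x y : ℝ, y ≠ 0 →
      ‖dbarC (aaExt n τ f) (x + y * I) • opResolvent H (x + y * I)‖ ≤
        L * normDensity (n + 1) f x * ((bracket x)⁻¹ * k (y / bracket x)) := by
    intro x y hy0
    have hb := bracket_pos x
    have hA := normDensity_nonneg (n + 1) f x
    rcases le_or_gt |y| (2 * bracket x) with hy | hy
    · have him : ((x : ℂ) + y * I).im = y := by simp
      set z : ℂ := (x : ℂ) + y * I with hz
      have hbz := bracket_pos z
      have h3 : bracket z ≤ 3 * bracket x := bracket_le_three_mul hy
      have hy' : 0 < |y| := abs_pos.2 hy0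
      have hR := hc z z (by rwa [him]) le_rfl (by linarith)
      rw [him] at hR
      have e1 : (bracket z)⁻¹ * (|y| / bracket z) ^ (-1 - α) ≤
          3 ^ α * ((bracket x)⁻¹ * (|y| / bracket x) ^ (-1 - α)) := by
        have e : ∀ b : ℝ, 0 < b → b⁻¹ * (|y| / b) ^ (-1 - α) = |y| ^ (-1 - α) * b ^ α := by
          intro b hb
          rw [Real.div_rpow hy'.le hb.le, div_eq_mul_inv, ← Real.rpow_neg hb.le,
            ← Real.rpow_neg_one, mul_left_comm, ← Real.rpow_add hb]
          ring_nf
        rw [e _ hbz, e _ hb, mul_left_comm, ← Real.mul_rpow three_pos.le hb.le]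
        gcongr
      have e2 : (|y| / bracket x) ^ n * (|y| / bracket x) ^ (-1 - α) ≤
          3 ^ (σ + 2) * k (y / bracket x) := by
        have ht : 0 < |y| / bracket x := by positivity
        have hs := bracket_pos (y / bracket x)
        rw [← Real.rpow_natCast, ← Real.rpow_add ht]
        have e3 : (n : ℝ) + (-1 - α) = σ := by rw [hσ]; ring
        have e4 : |y / bracket x| = |y| / bracket x := by rw [abs_div, abs_of_pos hb]
        have e5 : bracket (y / bracket x) ≤ 3 := by
          refine Real.sqrt_le_iff.2 ⟨by norm_num, ?_⟩
          have : |y| / bracket x ≤ 2 := (div_le_iff₀ hb).2 hy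
          rw [Real.norm_eq_abs, e4]
          nlinarith
        simp only [e3, hk, e4]
        have e6 : 1 ≤ 3 ^ (σ + 2) * bracket (y / bracket x) ^ (-σ - 2) := by
          have : -σ - 2 = -(σ + 2) := by ring
          rw [this, Real.rpow_neg hs.le, ← div_eq_mul_inv, one_le_div (by positivity)]
          exact Real.rpow_le_rpow hs.le e5 (by linarith)
        calc (|y| / bracket x) ^ σ = (|y| / bracket x) ^ σ * 1 := (mul_one _).symm
          _ ≤ (|y| / bracket x) ^ σ * (3 ^ (σ + 2) * bracket (y / bracket x) ^ (-σ - 2)) := by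
              gcongr
          _ = _ := by ring
      rw [norm_smul]
      calc _ ≤ K * (normDensity (n + 1) f x * (|y| / bracket x) ^ n) *
            (c * (3 ^ α * ((bracket x)⁻¹ * (|y| / bracket x) ^ (-1 - α)))) := by
            gcongr
            · exact hK f hf.contDiff x y hy
            · refine hR.trans ?_
              gcongr
        _ = K * c * 3 ^ α * normDensity (n + 1) f x * ((bracket x)⁻¹ *
            ((|y| / bracket x) ^ n * (|y| / bracket x) ^ (-1 - α))) := by ring
        _ ≤ K * c * 3 ^ α * normDensity (n + 1) f x * ((bracket x)⁻¹ *
            (3 ^ (σ + 2) * k (y / bracket x))) := by gcongr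
        _ = _ := by rw [hL]; ring
    · rw [dbarC_aaExt_eq_zero hτ hf.contDiff hy, zero_smul, norm_zero]
      have := hk0 (y / bracket x)
      positivity
  have hint := (almostAnalytic_aaExt hτ hf n).integrable hH hα hβ hn
  have hinner : ∀ x : ℝ, ‖∫ y : ℝ, dbarC (aaExt n τ f) (x + y * I) •
      opResolvent H (x + y * I)‖ ≤ (L * ∫ s, k s) * normDensity (n + 1) f x := by
    intro x
    have hb := bracket_pos x
    have hi : Integrable (fun y => L * normDensity (n + 1) f x *
        ((bracket x)⁻¹ * k (y / bracket x))) :=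
      ((hki.comp_div hb.ne').const_mul _).const_mul _
    refine (norm_integral_le_of_norm_le hi ?_).trans_eq ?_
    · have : ∀ᵐ y : ℝ, y ≠ 0 := by simp [ae_iff, measure_singleton]
      filter_upwards [this] with y hy using hpt x y hy
    · rw [integral_const_mul, integral_const_mul, Measure.integral_comp_div, abs_of_pos hb,
        smul_eq_mul, inv_mul_cancel_left₀ hb.ne']
      ring
  rw [hsInt, norm_smul, integral_complex_eq hint, mul_assoc]
  gcongr
  refine (norm_integral_le_of_norm_le ((integrable_normDensity hβ hf (n + 1)).const_mul
    (L * ∫ s, k s)) (Eventually.of_forall hinner)).trans_eq ?_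
  rw [integral_const_mul]

end NormBound

/-! ### Approximate units -/

section ApproximateUnit

/-- Compactly supported cut-off functions on `ℂ`, almost analytic uniformly in `k`, that converge
to `1`: dilations of the almost analytic extension of a bump function. -/
theorem exists_approximate_unit (N : ℕ) : ∃ Θ : ℕ → ℂ → ℂ, ∃ C, 0 ≤ C ∧
    (∀ k, AlmostAnalytic 0 N (Θ k)) ∧ (∀ k, HasCompactSupport (Θ k)) ∧
    (∀ k z, ‖Θ k z‖ ≤ C) ∧
    (∀ k z, ‖dbarC (Θ k) z‖ ≤ C * ((bracket z)⁻¹ * (|z.im| / bracket z) ^ N)) ∧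
    (∀ z, Tendsto (fun k => Θ k z) atTop (𝓝 1)) ∧
    (∀ z, Tendsto (fun k => dbarC (Θ k) z) atTop (𝓝 0)) := by
  obtain ⟨τ, hτ⟩ := exists_isCutoff
  let b : ContDiffBump (0 : ℝ) := ⟨1, 2, one_pos, one_lt_two⟩
  set h : ℝ → ℂ := fun x => ((b x : ℝ) : ℂ) with hh
  have hsm : ContDiff ℝ ∞ h := Complex.ofRealCLM.contDiff.comp b.contDiff
  have hcs : HasCompactSupport h := b.hasCompactSupport.comp_left Complex.ofReal_zero
  have hAA := almostAnalytic_aaExt hτ (isSymbolOn_of_hasCompactSupport hsm hcs 0) N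
  have hcomp := hasCompactSupport_aaExt hτ N hcs
  set Θ := aaExt N τ h with hΘ
  have hΘ0 : Θ 0 = 1 := by
    have := aaExt_ofReal hτ N h 0
    rw [Complex.ofReal_zero] at this
    rw [hΘ, this, hh]
    have : b 0 = 1 := b.one_of_mem_closedBall (by simp [b])
    simp [this]
  obtain ⟨C, hC0, hC⟩ := hAA.bound
  obtain ⟨D, hD0, hD⟩ := hAA.dbar_bound
  set δ : ℕ → ℝ := fun k => 1 / ((k : ℝ) + 1) with hδ
  have hδ0 : ∀ k, 0 < δ k := fun k => by positivity
  have hδ1 : ∀ k, δ k ≤ 1 := fun k => by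
    rw [hδ, div_le_one (by positivity)]
    simp
  have hδlim : Tendsto δ atTop (𝓝 0) := tendsto_one_div_add_atTop_nhds_zero_nat
  have hdb : ∀ k z, dbarC (fun w => Θ (δ k * w)) z = (δ k : ℂ) * dbarC Θ (δ k * z) := by
    intro k z
    have := dbarC_comp_affine (G := Θ) (δ k) 0 (z := z) (hAA.differentiable _)
    simpa using this
  have hbound : ∀ k z, ‖Θ (δ k * z)‖ ≤ C + D := fun k z => by
    have := hC (δ k * z)
    rw [Real.rpow_zero] at this
    linarith
  have hdbound : ∀ k z, ‖dbarC (fun w => Θ (δ k * w)) z‖ ≤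
      (C + D) * ((bracket z)⁻¹ * (|z.im| / bracket z) ^ N) := by
    intro k z
    have hk := hδ0 k
    have hbz := bracket_pos z
    have hbk := bracket_pos ((δ k : ℂ) * z)
    have hcomp : δ k / bracket ((δ k : ℂ) * z) ≤ (bracket z)⁻¹ := by
      rw [div_le_iff₀ hbk, ← div_eq_inv_mul, le_div_iff₀ hbz, mul_comm, ← le_div_iff₀ hk,
        div_eq_inv_mul]
      refine bracket_le_mul (by positivity) ?_
      rw [norm_mul, Complex.norm_real, Real.norm_of_nonneg hk.le, inv_pow, inv_mul_eq_div,
        le_div_iff₀ (by positivity)]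
      nlinarith [hδ1 k]
    have him : |((δ k : ℂ) * z).im| / bracket ((δ k : ℂ) * z) ≤ |z.im| / bracket z := by
      rw [Complex.im_ofReal_mul, abs_mul, abs_of_pos hk, mul_comm, mul_div_assoc,
        div_eq_mul_inv |z.im|]
      gcongr
    have h0 := abs_im_div_bracket_nonneg z
    have h0' := abs_im_div_bracket_nonneg ((δ k : ℂ) * z)
    rw [hdb, norm_mul, Complex.norm_real, Real.norm_of_nonneg hk.le]
    calc _ ≤ δ k * (D * (bracket ((δ k : ℂ) * z) ^ ((0 : ℝ) - 1) *
            (|((δ k : ℂ) * z).im| / bracket ((δ k : ℂ) * z)) ^ N)) := by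
          gcongr
          exact hD _
      _ = D * (δ k / bracket ((δ k : ℂ) * z) *
            (|((δ k : ℂ) * z).im| / bracket ((δ k : ℂ) * z)) ^ N) := by
          rw [zero_sub, Real.rpow_neg_one]; ring
      _ ≤ _ := by
          gcongr
          linarith
  refine ⟨fun k z => Θ (δ k * z), C + D, by positivity, fun k => ?_, fun k => ?_, hbound, hdbound,
    fun z => ?_, fun z => ?_⟩
  · refine ⟨hAA.contDiff.comp (contDiff_const.mul contDiff_id), ⟨C + D, by positivity, fun z => ?_⟩,
      ⟨C + D, by positivity, fun z => ?_⟩⟩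
    · rw [Real.rpow_zero, mul_one]; exact hbound k z
    · rw [zero_sub, Real.rpow_neg_one]; exact hdbound k z
  · have hk : (δ k : ℂ) ≠ 0 := by exact_mod_cast (hδ0 k).ne'
    exact hcomp.comp_homeomorph (Homeomorph.mulLeft₀ _ hk)
  · have h1 : Tendsto (fun k => Θ (δ k * z)) atTop (𝓝 (Θ ((0 : ℝ) * z))) :=
      (hAA.contDiff.continuous.tendsto _).comp
        (((Complex.continuous_ofReal.tendsto 0).comp hδlim).mul_const z)
    simpa [hΘ0] using h1
  · have h1 : Tendsto (fun k => (δ k : ℂ) * dbarC Θ (δ k * z)) atTop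
        (𝓝 (((0 : ℝ) : ℂ) * dbarC Θ ((0 : ℝ) * z))) := by
      have h2 := (Complex.continuous_ofReal.tendsto 0).comp hδlim
      exact h2.mul (((continuous_dbarC hAA.contDiff).tendsto _).comp (h2.mul_const z))
    simp only [hdb]
    simpa using h1

variable {B : Type*} [NormedAddCommGroup B] [NormedSpace ℂ B] [CompleteSpace B]
  {H : B →ₗ.[ℂ] B} {α : ℝ}

/-- The weights of the calculus are integrable against the resolvent. -/
theorem ResolventHypothesis.integrable_weight (hH : ResolventHypothesis H α) (hα : 0 ≤ α)
    {β : ℝ} {N : ℕ} (hβ : β < 0) (hN : α < N) :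
    Integrable (fun z : ℂ => bracket z ^ (β - 1) * (|z.im| / bracket z) ^ N *
      ‖opResolvent H z‖) := by
  have hcont : Continuous (fun z : ℂ => bracket z ^ (β - 1) * (|z.im| / bracket z) ^ N) := by
    have h1 : Continuous (fun z : ℂ => bracket z ^ (β - 1)) :=
      continuous_bracket.rpow_const fun x => Or.inl (bracket_pos x).ne'
    have h2 : Continuous (fun z : ℂ => |z.im| / bracket z) :=
      (Complex.continuous_im.abs).div continuous_bracket fun z => (bracket_pos z).ne'
    exact h1.mul (h2.pow N)
  have h0 : ∀ z : ℂ, 0 ≤ bracket z ^ (β - 1) * (|z.im| / bracket z) ^ N := fun z => by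
    have := bracket_pos z
    positivity
  have := (hH.integrable_smul hα hβ hN (Complex.continuous_ofReal.comp hcont) (C := 1)
    (fun z => by
      rw [Function.comp_apply, Complex.norm_real, Real.norm_of_nonneg (h0 z), one_mul])).norm
  refine this.congr (Eventually.of_forall fun z => ?_)
  simp only [Function.comp_apply]
  rw [norm_smul, Complex.norm_real, Real.norm_of_nonneg (h0 z)]

/-- Multiplication by an approximate unit does not change the integral in the limit. -/
theorem tendsto_hsInt_mul (hH : ResolventHypothesis H α) (hα : 0 ≤ α) {β : ℝ} {N : ℕ}
    (hβ : β < 0) (hN : α < N) {F : ℂ → ℂ} (hF : AlmostAnalytic β N F) {Θ : ℕ → ℂ → ℂ} {C : ℝ}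
    (hC : 0 ≤ C) (hΘ : ∀ k, AlmostAnalytic 0 N (Θ k)) (hb : ∀ k z, ‖Θ k z‖ ≤ C)
    (hdb : ∀ k z, ‖dbarC (Θ k) z‖ ≤ C * ((bracket z)⁻¹ * (|z.im| / bracket z) ^ N))
    (hlim : ∀ z, Tendsto (fun k => Θ k z) atTop (𝓝 1))
    (hdlim : ∀ z, Tendsto (fun k => dbarC (Θ k) z) atTop (𝓝 0)) :
    Tendsto (fun k => hsInt H (fun z => Θ k z * F z)) atTop (𝓝 (hsInt H F)) := by
  obtain ⟨A, hA0, hA⟩ := hF.bound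
  obtain ⟨D, hD0, hD⟩ := hF.dbar_bound
  have hprod : ∀ k z, dbarC (fun w => Θ k w * F w) z = dbarC (Θ k) z * F z + Θ k z * dbarC F z :=
    fun k z => by
      have := dbarC_smul ((hΘ k).differentiable z) (hF.differentiable z)
      simpa only [smul_eq_mul] using this
  refine Tendsto.const_smul ?_ _
  refine tendsto_integral_of_dominated_convergence (fun z => (C * A + C * D) *
    (bracket z ^ (β - 1) * (|z.im| / bracket z) ^ N * ‖opResolvent H z‖)) (fun k => ?_)
    ((hH.integrable_weight hα hβ hN).const_mul _) (fun k => Eventually.of_forall fun z => ?_)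
    (Eventually.of_forall fun z => ?_)
  · exact (continuous_dbarC ((hΘ k).contDiff.mul hF.contDiff)).aestronglyMeasurable.smul
      hH.aestronglyMeasurable
  · have hbz := bracket_pos z
    rw [norm_smul, ← mul_assoc, hprod]
    gcongr
    calc _ ≤ ‖dbarC (Θ k) z‖ * ‖F z‖ + ‖Θ k z‖ * ‖dbarC F z‖ := by
          refine (norm_add_le _ _).trans ?_
          rw [norm_mul, norm_mul]
      _ ≤ C * ((bracket z)⁻¹ * (|z.im| / bracket z) ^ N) * (A * bracket z ^ β) +
          C * (D * (bracket z ^ (β - 1) * (|z.im| / bracket z) ^ N)) := by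
          gcongr
          · exact hdb k z
          · exact hA z
          · exact hb k z
          · exact hD z
      _ = _ := by
          have : bracket z ^ (β - 1) = bracket z ^ β * (bracket z)⁻¹ := by
            rw [Real.rpow_sub_one hbz.ne', div_eq_mul_inv]
          rw [this]; ring
  · refine Tendsto.smul_const ?_ _
    simp only [hprod]
    simpa using ((hdlim z).mul_const (F z)).add ((hlim z).mul_const (dbarC F z))

end ApproximateUnit

/-! ### Locality -/

section Locality

variable {B : Type*} [NormedAddCommGroup B] [NormedSpace ℂ B] [CompleteSpace B]
  {H : B →ₗ.[ℂ] B} {α : ℝ}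

/-- For `s = ±1`, the function `D(z) R(z + isη)` is smooth on the closed half-plane `s Im z ≥ 0`
and extends from there to a smooth compactly supported function on `ℂ`. -/
theorem exists_shifted_product (hH : ResolventHypothesis H α) {D : ℂ → ℂ}
    (hD : ContDiff ℝ 1 D) (hc : HasCompactSupport D) {s η : ℝ} (hs : s ^ 2 = 1) (hη : 0 < η) :
    ∃ G : ℂ → (B →L[ℂ] B), ContDiff ℝ 1 G ∧ HasCompactSupport G ∧
      (∀ z : ℂ, 0 < s * z.im → dbarC G z = dbarC D z • opResolvent H (z + (s * η : ℝ) * I)) ∧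
      ∀ x : ℝ, G x = D x • opResolvent H (x + (s * η : ℝ) * I) := by
  -- `ψ = 1` where `s Im z ≥ 0`, and `ψ = 0` where `s Im z ≤ -η/2`, before the line
  -- `s Im z = -η` is reached, on which the shifted resolvent may be singular
  set ψ : ℂ → ℝ := fun z => step (2 * (s * z.im) / η + 2) with hψ
  have hψ1 : ∀ z : ℂ, 0 ≤ s * z.im → ψ z = 1 := fun z hz => by
    refine step_of_ge ?_
    have : 0 ≤ 2 * (s * z.im) / η := by positivity
    linarith
  have hψ0 : ∀ z : ℂ, s * z.im ≤ -(η / 2) → ψ z = 0 := fun z hz => by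
    refine step_of_le ?_
    have : 2 * (s * z.im) / η ≤ -1 := by
      rw [div_le_iff₀ hη]; linarith
    linarith
  have him : ∀ z : ℂ, s * (z + (s * η : ℝ) * I).im = s * z.im + η := fun z => by
    simp only [Complex.add_im, Complex.im_ofReal_mul, Complex.I_im]
    linear_combination η * hs
  have hRc : ∀ z : ℂ, -η < s * z.im →
      ContDiffAt ℝ 1 (fun w => opResolvent H (w + (s * η : ℝ) * I)) z := fun z hz => by
    have h1 : (z + (s * η : ℝ) * I).im ≠ 0 := fun h => by
      have := him z
      rw [h, mul_zero] at this
      linarith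
    have h2 := contDiffAt_opResolvent (hH.notMem_opSpectrum h1)
    exact h2.comp z (f := fun w : ℂ => w + (s * η : ℝ) * I)
      (contDiffAt_id.add contDiffAt_const)
  have hRd : ∀ z : ℂ, 0 < s * z.im →
      DifferentiableAt ℂ (fun w => opResolvent H (w + (s * η : ℝ) * I)) z := fun z hz => by
    have h1 : (z + (s * η : ℝ) * I).im ≠ 0 := fun h => by
      have := him z
      rw [h, mul_zero] at this
      linarith
    have h2 := differentiableAt_opResolvent (hH.notMem_opSpectrum h1)
    exact DifferentiableAt.comp z (f := fun w : ℂ => w + (s * η : ℝ) * I) h2 (by fun_prop)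
  have hψc : ContDiff ℝ 1 (fun z => ((ψ z : ℝ) : ℂ)) := by
    refine Complex.ofRealCLM.contDiff.comp ((step_contDiff (n := 1)).comp ?_)
    have : ContDiff ℝ 1 (fun z : ℂ => z.im) := Complex.imCLM.contDiff
    fun_prop
  have hcontim : Continuous (fun z : ℂ => s * z.im) := continuous_const.mul Complex.continuous_im
  refine ⟨fun z => ((ψ z : ℝ) : ℂ) • D z • opResolvent H (z + (s * η : ℝ) * I), ?_, ?_, ?_, ?_⟩
  · rw [contDiff_iff_contDiffAt]
    intro z
    rcases lt_or_ge (-η) (s * z.im) with hz | hz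
    · exact hψc.contDiffAt.smul (hD.contDiffAt.smul (hRc z hz))
    · have hz' : s * z.im < -(η / 2) := by linarith
      refine contDiffAt_const (c := 0) |>.congr_of_eventuallyEq ?_
      filter_upwards [hcontim.continuousAt.eventually_lt_const hz'] with w hw
      rw [hψ0 w hw.le]; simp
  · refine hc.mono fun z hz => ?_
    contrapose! hz
    rw [Function.notMem_support] at hz ⊢
    rw [hz, zero_smul, smul_zero]
  · intro z hz
    have h1 : (fun z => ((ψ z : ℝ) : ℂ) • D z • opResolvent H (z + (s * η : ℝ) * I)) =ᶠ[𝓝 z]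
        fun z => D z • opResolvent H (z + (s * η : ℝ) * I) := by
      filter_upwards [hcontim.continuousAt.eventually_const_lt hz] with w hw
      rw [hψ1 w hw.le]; simp
    rw [dbarC_congr h1, dbarC_smul (hD.differentiable one_ne_zero z)
      ((hRd z hz).restrictScalars ℝ), dbarC_eq_zero (hRd z hz), smul_zero, add_zero]
  · intro x
    beta_reduce
    rw [hψ1 x (by simp), Complex.ofReal_one, one_smul]

/-- In a half-plane the shift by `isη` moves points away from the real axis, so the resolvent bound
for the unshifted integrand dominates the shifted integrands. -/
theorem tendsto_setIntegral_shift (hH : ResolventHypothesis H α) (hα : 0 ≤ α) {β : ℝ} {N : ℕ}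
    (hβ : β < 0) (hN : α < N) {D : ℂ → ℂ} (hD : AlmostAnalytic β N D) {s : ℝ} (hs : s ^ 2 = 1)
    {S : Set ℂ} (hS : MeasurableSet S) (hSs : ∀ z ∈ S, 0 ≤ s * z.im) {η : ℕ → ℝ}
    (hη0 : ∀ k, 0 < η k) (hη1 : ∀ k, η k ≤ 1) (hη : Tendsto η atTop (𝓝 0)) :
    Tendsto (fun k => ∫ z in S, dbarC D z • opResolvent H (z + (s * η k : ℝ) * I)) atTop
      (𝓝 (∫ z in S, dbarC D z • opResolvent H z)) := by
  obtain ⟨A, hA0, hA⟩ := hD.dbar_bound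
  obtain ⟨c, hc0, hc⟩ := hH.exists_norm_le hα
  have hsabs : |s| = 1 := by
    simpa using (sq_eq_sq_iff_abs_eq_abs s 1).1 (by rw [hs, one_pow])
  refine tendsto_integral_of_dominated_convergence
    (fun z => A * c * hsWeight β (N - 1 - α) z) (fun k => ?_)
    (((integrable_hsWeight hβ (by linarith)).const_mul _).integrableOn) (fun k => ?_) ?_
  · refine ((continuous_dbarC hD.contDiff).aestronglyMeasurable.smul ?_).restrict
    exact hH.aestronglyMeasurable.comp_measurePreserving (measurePreserving_add_right volume _)
  · filter_upwards [ae_restrict_mem hS, ae_restrict_of_ae ae_im_ne_zero] with z hz him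
    rw [norm_smul, ← weight_mul him]
    have h1 : ‖((s * η k : ℝ) : ℂ) * I‖ ≤ 1 := by
      rw [norm_mul, Complex.norm_I, mul_one, Complex.norm_real, norm_mul, Real.norm_eq_abs, hsabs,
        one_mul, Real.norm_of_nonneg (hη0 k).le]
      exact hη1 k
    have h2 : |z.im| ≤ |(z + (s * η k : ℝ) * I).im| := by
      have e1 : ∀ t : ℝ, |t| = |s * t| := fun t => by rw [abs_mul, hsabs, one_mul]
      have e2 : s * (z + (s * η k : ℝ) * I).im = s * z.im + η k := by
        simp only [Complex.add_im, Complex.im_ofReal_mul, Complex.I_im]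
        linear_combination η k * hs
      rw [e1, e1 (z + (s * η k : ℝ) * I).im, e2, abs_of_nonneg (hSs z hz),
        abs_of_nonneg (add_nonneg (hSs z hz) (hη0 k).le)]
      linarith [hη0 k]
    calc _ ≤ (A * (bracket z ^ (β - 1) * (|z.im| / bracket z) ^ N)) *
          (c * ((bracket z)⁻¹ * (|z.im| / bracket z) ^ (-1 - α))) := by
          gcongr
          · exact (norm_nonneg _).trans (hA z)
          · exact hA z
          · exact hc z _ him h2 (bracket_add_le h1)
      _ = _ := by ring
  · filter_upwards [ae_restrict_of_ae ae_im_ne_zero] with z him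
    refine Tendsto.const_smul ?_ _
    have h1 : Tendsto (fun k => z + ((s * η k : ℝ) : ℂ) * I) atTop (𝓝 z) := by
      have : Tendsto (fun k => z + ((s * η k : ℝ) : ℂ) * I) atTop
          (𝓝 (z + ((s * 0 : ℝ) : ℂ) * I)) :=
        (((Complex.continuous_ofReal.tendsto _).comp (hη.const_mul s)).mul_const I).const_add z
      simpa using this
    exact (hH.continuousAt him).tendsto.comp h1

/-- Away from the spectrum the resolvent is continuous up to the real axis. -/
theorem tendsto_integral_trace (hH : ResolventHypothesis H α) {D : ℂ → ℂ}
    (hD : ContDiff ℝ 1 D) (hc : HasCompactSupport D) {K : Set ℝ} (hK : IsCompact K)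
    (hKH : ∀ x ∈ K, (x : ℂ) ∉ opSpectrum H) (hDK : ∀ x : ℝ, D x ≠ 0 → x ∈ K)
    {s : ℝ} (hs : s ^ 2 = 1) {η : ℕ → ℝ}
    (hη0 : ∀ k, 0 < η k) (hη1 : ∀ k, η k ≤ 1) (hη : Tendsto η atTop (𝓝 0)) :
    Tendsto (fun k => ∫ x : ℝ, D x • opResolvent H (x + (s * η k : ℝ) * I)) atTop
      (𝓝 (∫ x : ℝ, D x • opResolvent H x)) := by
  have hsabs : |s| = 1 := by
    simpa using (sq_eq_sq_iff_abs_eq_abs s 1).1 (by rw [hs, one_pow])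
  have hs0 : s ≠ 0 := fun h => by simp [h] at hs
  have hDc : Continuous (fun x : ℝ => D x) := hD.continuous.comp Complex.continuous_ofReal
  have hDi : Integrable (fun x : ℝ => D x) := by
    refine hDc.integrable_of_hasCompactSupport ?_
    simpa using hasCompactSupport_slice_re hc 0
  obtain ⟨M, hM⟩ : ∃ M, ∀ p ∈ K ×ˢ Icc (-1 : ℝ) 1, ‖opResolvent H ((p.1 : ℂ) + p.2 * I)‖ ≤ M := by
    refine (hK.prod isCompact_Icc).exists_bound_of_continuousOn fun p hp => ?_
    have hp' : ((p.1 : ℂ) + p.2 * I) ∉ opSpectrum H := by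
      by_cases h : p.2 = 0
      · rw [h]; simpa using hKH _ hp.1
      · exact hH.notMem_opSpectrum (by simpa using h)
    have h1 := (contDiffAt_opResolvent hp').continuousAt
    have h2 : ContinuousAt (fun p : ℝ × ℝ => (p.1 : ℂ) + p.2 * I) p := by fun_prop
    exact (ContinuousAt.comp (f := fun p : ℝ × ℝ => (p.1 : ℂ) + p.2 * I) h1 h2).continuousWithinAt
  refine tendsto_integral_of_dominated_convergence (fun x => ‖D x‖ * M) (fun k => ?_)
    (hDi.norm.mul_const M) (fun k => Eventually.of_forall fun x => ?_)
    (Eventually.of_forall fun x => ?_)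
  · refine (hDc.smul ?_).aestronglyMeasurable
    rw [continuous_iff_continuousAt]
    intro x
    have h1 : ((x : ℂ) + (s * η k : ℝ) * I).im ≠ 0 := by
      simp only [Complex.add_im, Complex.im_ofReal_mul, Complex.I_im, Complex.ofReal_im, zero_add,
        mul_one]
      exact mul_ne_zero hs0 (hη0 k).ne'
    exact ContinuousAt.comp (f := fun x : ℝ => (x : ℂ) + (s * η k : ℝ) * I) (hH.continuousAt h1)
      (by fun_prop)
  · by_cases hx : D x = 0
    · simp [hx]
    · rw [norm_smul]
      gcongr
      refine hM (x, s * η k) ⟨hDK x hx, ?_⟩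
      rw [mem_Icc, ← abs_le, abs_mul, hsabs, one_mul, abs_of_pos (hη0 k)]
      exact hη1 k
  · by_cases hx : D x = 0
    · simp [hx]
    · refine Tendsto.const_smul ?_ _
      have h1 : Tendsto (fun k => (x : ℂ) + ((s * η k : ℝ) : ℂ) * I) atTop (𝓝 x) := by
        have : Tendsto (fun k => (x : ℂ) + ((s * η k : ℝ) : ℂ) * I) atTop
            (𝓝 ((x : ℂ) + ((s * 0 : ℝ) : ℂ) * I)) :=
          (((Complex.continuous_ofReal.tendsto _).comp (hη.const_mul s)).mul_const I).const_add _
        simpa using this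
      exact (contDiffAt_opResolvent (hKH x (hDK x hx))).continuousAt.tendsto.comp h1

/-- If the trace of `D` on the real axis lives away from the spectrum, the integral vanishes.
Moving the resolvent away from the real axis by `iη` in the upper and by `-iη` in the lower
half-plane, Stokes' theorem leaves the jump `∫ D(x) (R(x + iη) - R(x - iη)) dx`, which tends
to `0`. -/
theorem hsInt_eq_zero_of_compactSupport (hH : ResolventHypothesis H α) (hα : 0 ≤ α) {β : ℝ}
    {N : ℕ} (hβ : β < 0) (hN : α < N) {D : ℂ → ℂ} (hD : AlmostAnalytic β N D)
    (hc : HasCompactSupport D) {K : Set ℝ} (hK : IsCompact K)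
    (hKH : ∀ x ∈ K, (x : ℂ) ∉ opSpectrum H) (hDK : ∀ x : ℝ, D x ≠ 0 → x ∈ K) : hsInt H D = 0 := by
  set η : ℕ → ℝ := fun k => 1 / ((k : ℝ) + 1) with hη
  have hη0 : ∀ k, 0 < η k := fun k => by positivity
  have hη1 : ∀ k, η k ≤ 1 := fun k => by
    rw [hη, div_le_one (by positivity)]
    simp
  have hηlim : Tendsto η atTop (𝓝 0) := tendsto_one_div_add_atTop_nhds_zero_nat
  have hup : ∀ k, ∫ z in {z : ℂ | 0 < z.im}, dbarC D z • opResolvent H (z + (1 * η k : ℝ) * I) =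
      -(I / 2) • ∫ x : ℝ, D x • opResolvent H (x + (1 * η k : ℝ) * I) := by
    intro k
    obtain ⟨G, hG, hGc, h1, h2⟩ := exists_shifted_product hH hD.contDiff hc (s := 1) (by norm_num)
      (hη0 k)
    simp only [← h2]
    rw [← setIntegral_upper_dbarC hG hGc]
    refine setIntegral_congr_fun measurableSet_upper fun z hz => ?_
    exact (h1 z (by rw [one_mul]; exact hz)).symm
  have hlow : ∀ k, ∫ z in {z : ℂ | 0 < z.im}ᶜ,
      dbarC D z • opResolvent H (z + (-1 * η k : ℝ) * I) =
      (I / 2) • ∫ x : ℝ, D x • opResolvent H (x + (-1 * η k : ℝ) * I) := by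
    intro k
    obtain ⟨G, hG, hGc, h1, h2⟩ := exists_shifted_product hH hD.contDiff hc (s := -1) (by norm_num)
      (hη0 k)
    simp only [← h2]
    rw [← setIntegral_lower_dbarC hG hGc]
    refine setIntegral_congr_ae measurableSet_upper.compl ?_
    filter_upwards [ae_im_ne_zero] with z hz hz'
    have : z.im < 0 := lt_of_le_of_ne (not_lt.1 hz') hz
    exact (h1 z (by linarith)).symm
  have l1 := tendsto_setIntegral_shift hH hα hβ hN hD (s := 1) (by norm_num) measurableSet_upper
    (fun z hz => by rw [one_mul]; exact le_of_lt hz) hη0 hη1 hηlim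
  have l2 := tendsto_setIntegral_shift hH hα hβ hN hD (s := -1) (by norm_num)
    measurableSet_upper.compl (fun z hz => by
      have : z.im ≤ 0 := not_lt.1 hz
      linarith) hη0 hη1 hηlim
  have t1 := tendsto_integral_trace hH hD.contDiff hc hK hKH hDK (s := 1) (by norm_num)
    hη0 hη1 hηlim
  have t2 := tendsto_integral_trace hH hD.contDiff hc hK hKH hDK (s := -1) (by norm_num)
    hη0 hη1 hηlim
  simp only [hup] at l1
  simp only [hlow] at l2
  have e1 := tendsto_nhds_unique l1 (t1.const_smul _)
  have e2 := tendsto_nhds_unique l2 (t2.const_smul _)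
  rw [hsInt, ← integral_add_compl measurableSet_upper (hD.integrable hH hα hβ hN), e1, e2]
  module

/-- The compact support assumption on `D` is removed with an approximate unit. -/
theorem hsInt_eq_zero_of_trace (hH : ResolventHypothesis H α) (hα : 0 ≤ α) {β : ℝ} {N : ℕ}
    (hβ : β < 0) (hN : α < N) {D : ℂ → ℂ} (hD : AlmostAnalytic β N D)
    {S : Set ℝ} (hS : IsClosed S) (hSH : ∀ x ∈ S, (x : ℂ) ∉ opSpectrum H)
    (hDS : ∀ x : ℝ, D x ≠ 0 → x ∈ S) : hsInt H D = 0 := by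
  obtain ⟨Θ, C, hC, hΘ, hΘc, hb, hdb, hlim, hdlim⟩ := exists_approximate_unit N
  have h := tendsto_hsInt_mul hH hα hβ hN hD hC hΘ hb hdb hlim hdlim
  refine tendsto_nhds_unique h (tendsto_const_nhds.congr fun k => ?_)
  have hAA : AlmostAnalytic β N (fun z => Θ k z * D z) := by
    simpa using (hΘ k).mul hD
  have hcomp : HasCompactSupport (fun z => Θ k z * D z) := (hΘc k).mul_right
  obtain ⟨r, hr⟩ := (hΘc k).isBounded.subset_closedBall 0
  refine (hsInt_eq_zero_of_compactSupport hH hα hβ hN hAA hcomp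
    (K := S ∩ Metric.closedBall 0 r) ((isCompact_closedBall _ _).inter_left hS)
    (fun x hx => hSH x hx.1) fun x hx => ⟨hDS x (right_ne_zero_of_mul hx), ?_⟩).symm
  have := hr (subset_tsupport _ (left_ne_zero_of_mul hx))
  rw [mem_closedBall_zero_iff] at this ⊢
  rwa [Complex.norm_real] at this

/-- Translations by `|ε| ≤ 1` change the weights by bounded factors only, and preserve `Im z`. -/
theorem exists_almostAnalytic_translate {β : ℝ} {N : ℕ} {D : ℂ → ℂ} (hD : AlmostAnalytic β N D) :
    ∃ C, 0 ≤ C ∧ ∀ ε : ℝ, |ε| ≤ 1 → AlmostAnalytic β N (fun z => D (z + ε)) ∧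
      ∀ z, ‖dbarC D (z + ε)‖ ≤ C * (bracket z ^ (β - 1) * (|z.im| / bracket z) ^ N) := by
  obtain ⟨A, hA0, hA⟩ := hD.bound
  obtain ⟨C, hC0, hC⟩ := hD.dbar_bound
  have hcmp : ∀ (ε : ℝ) (z : ℂ), |ε| ≤ 1 → ∀ p : ℝ,
      bracket (z + ε) ^ p ≤ 2 ^ |p| * bracket z ^ p := fun ε z hε p => by
    have hε' : ‖(ε : ℂ)‖ ≤ 1 := by rwa [Complex.norm_real]
    exact rpow_le_of_comparable two_pos (bracket_pos _) (bracket_pos _) (bracket_add_le hε')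
      (bracket_le_add hε') p
  have hdb : ∀ (ε : ℝ), |ε| ≤ 1 → ∀ z : ℂ, ‖dbarC D (z + ε)‖ ≤
      (C * 2 ^ |β - 1| * 2 ^ N) * (bracket z ^ (β - 1) * (|z.im| / bracket z) ^ N) := by
    intro ε hε z
    have hb := bracket_pos z
    have hb' := bracket_pos (z + ε)
    have hε' : ‖(ε : ℂ)‖ ≤ 1 := by rwa [Complex.norm_real]
    have him : (z + ε).im = z.im := by simp
    calc _ ≤ C * (bracket (z + ε) ^ (β - 1) * (|(z + ε).im| / bracket (z + ε)) ^ N) := hC _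
      _ ≤ C * ((2 ^ |β - 1| * bracket z ^ (β - 1)) * (2 * (|z.im| / bracket z)) ^ N) := by
          rw [him]
          gcongr ?_ * (?_ * ?_ ^ N)
          · exact hcmp ε z hε _
          · rw [mul_div_assoc', div_le_div_iff₀ hb' hb]
            nlinarith [abs_nonneg z.im, bracket_le_add (z := z) hε']
      _ = _ := by rw [mul_pow]; ring
  refine ⟨C * 2 ^ |β - 1| * 2 ^ N, by positivity, fun ε hε => ⟨⟨?_, ?_, ?_⟩, hdb ε hε⟩⟩
  · exact hD.contDiff.comp (contDiff_id.add contDiff_const)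
  · refine ⟨A * 2 ^ |β|, by positivity, fun z => (hA _).trans ?_⟩
    rw [mul_assoc]
    gcongr
    exact hcmp ε z hε β
  · refine ⟨C * 2 ^ |β - 1| * 2 ^ N, by positivity, fun z => ?_⟩
    have := dbarC_comp_affine (G := D) 1 ε (z := z) (hD.differentiable _)
    simp only [Complex.ofReal_one, one_mul, one_smul] at this
    rw [this]
    exact hdb ε hε z

/-- The integral vanishes if the trace vanishes on `[0, ∞)`. The trace of the translate `D(z + ε)`
lives on `(-∞, -ε]`, at a positive distance from the spectrum. -/
theorem hsInt_eq_zero_of_eqOn (hH : ResolventHypothesis H α) (hα : 0 ≤ α)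
    (hspec : opSpectrum H ⊆ (fun x : ℝ => (x : ℂ)) '' Ici 0) {β : ℝ} {N : ℕ}
    (hβ : β < 0) (hN : α < N) {D : ℂ → ℂ} (hD : AlmostAnalytic β N D)
    (hD0 : ∀ x : ℝ, 0 ≤ x → D x = 0) : hsInt H D = 0 := by
  obtain ⟨C, hC0, hC⟩ := exists_almostAnalytic_translate hD
  set ε : ℕ → ℝ := fun k => 1 / ((k : ℝ) + 1) with hε
  have hε0 : ∀ k, 0 < ε k := fun k => by positivity
  have hε1 : ∀ k, |ε k| ≤ 1 := fun k => by
    rw [abs_of_pos (hε0 k), hε, div_le_one (by positivity)]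
    simp
  have hεlim : Tendsto ε atTop (𝓝 0) := tendsto_one_div_add_atTop_nhds_zero_nat
  have hdb : ∀ k z, dbarC (fun w => D (w + ε k)) z = dbarC D (z + ε k) := fun k z => by
    have := dbarC_comp_affine (G := D) 1 (ε k) (z := z) (hD.differentiable _)
    simpa only [Complex.ofReal_one, one_mul, one_smul] using this
  have hlim : Tendsto (fun k => hsInt H (fun z => D (z + ε k))) atTop (𝓝 (hsInt H D)) := by
    refine Tendsto.const_smul ?_ _
    refine tendsto_integral_of_dominated_convergence (fun z => C *
      (bracket z ^ (β - 1) * (|z.im| / bracket z) ^ N * ‖opResolvent H z‖)) (fun k => ?_)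
      ((hH.integrable_weight hα hβ hN).const_mul _) (fun k => Eventually.of_forall fun z => ?_)
      (Eventually.of_forall fun z => ?_)
    · exact (continuous_dbarC (hC _ (hε1 k)).1.contDiff).aestronglyMeasurable.smul
        hH.aestronglyMeasurable
    · rw [norm_smul, ← mul_assoc, hdb]
      gcongr
      exact (hC _ (hε1 k)).2 z
    · refine Tendsto.smul_const ?_ _
      simp only [hdb]
      have h1 : Tendsto (fun k => z + (ε k : ℂ)) atTop (𝓝 (z + (0 : ℝ))) :=
        ((Complex.continuous_ofReal.tendsto _).comp hεlim).const_add z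
      rw [Complex.ofReal_zero, add_zero] at h1
      exact ((continuous_dbarC hD.contDiff).tendsto z).comp h1
  refine tendsto_nhds_unique hlim (tendsto_const_nhds.congr fun k => ?_)
  refine (hsInt_eq_zero_of_trace hH hα hβ hN (hC _ (hε1 k)).1 (S := Iic (-ε k)) isClosed_Iic
    (fun x hx h => ?_) fun x hx => ?_).symm
  · obtain ⟨y, hy, hyx⟩ := hspec h
    have : y = x := Complex.ofReal_injective hyx
    have h1 : x ≤ -ε k := hx
    have h2 : 0 ≤ y := hy
    linarith [hε0 k]
  · by_contra h
    rw [mem_Iic, not_le] at h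
    refine hx ?_
    have := hD0 (x + ε k) (by linarith)
    rwa [Complex.ofReal_add] at this

/-- The integral depends only on the values on `[0, ∞)`, for any two extensions, of possibly
different orders. -/
theorem hsInt_congr (hH : ResolventHypothesis H α) (hα : 0 ≤ α)
    (hspec : opSpectrum H ⊆ (fun x : ℝ => (x : ℂ)) '' Ici 0) {β β' : ℝ} {N N' : ℕ}
    (hβ : β < 0) (hβ' : β' < 0) (hN : α < N) (hN' : α < N') {F G : ℂ → ℂ}
    (hF : AlmostAnalytic β N F) (hG : AlmostAnalytic β' N' G)
    (h : ∀ x : ℝ, 0 ≤ x → F x = G x) : hsInt H F = hsInt H G := by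
  have hF' := hF.mono (le_max_left β β') (min_le_left N N')
  have hG' := hG.mono (le_max_right β β') (min_le_right N N')
  have hβm : max β β' < 0 := max_lt hβ hβ'
  have hNm : α < (min N N' : ℕ) := by
    rw [Nat.cast_min]; exact lt_min hN hN'
  have h1 := hsInt_eq_zero_of_eqOn hH hα hspec hβm hNm (hF'.sub hG')
    fun x hx => by rw [h x hx, sub_self]
  have h2 := hsInt_add hH hα hβm hNm (hF'.sub hG') hG'
  simpa [h1] using h2

end Locality

/-! ### Multiplicativity -/

section Multiplicative

variable {B : Type*} [NormedAddCommGroup B] [NormedSpace ℂ B] [CompleteSpace B]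
  {H : B →ₗ.[ℂ] B} {α : ℝ}

/-- Integrability on the product space, as needed for Fubini's theorem with the Cauchy kernel. -/
theorem integrable_prod_kernel {E : Type*} [NormedAddCommGroup E] [NormedSpace ℂ E]
    {f : ℂ → E} {g : ℂ → ℂ} (hf : Integrable f) (hg : Integrable g) {M : ℝ}
    (hM : ∀ w, ‖g w‖ ≤ M) :
    Integrable (fun p : ℂ × ℂ => ((p.2 - p.1)⁻¹ * g p.2) • f p.1) (volume.prod volume) := by
  have hmeas : AEStronglyMeasurable (fun p : ℂ × ℂ => ((p.2 - p.1)⁻¹ * g p.2) • f p.1)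
      (volume.prod volume) := by
    refine AEStronglyMeasurable.smul (AEStronglyMeasurable.mul ?_ hg.1.comp_snd) hf.1.comp_fst
    exact (measurable_snd.sub measurable_fst).inv.aestronglyMeasurable
  rw [integrable_prod_iff hmeas]
  refine ⟨Eventually.of_forall fun z => ?_, ?_⟩
  · exact (integrable_kernel hg hM z).1.smul_const (f z)
  · refine (hf.norm.mul_const (M * (∫ u in Metric.ball (0 : ℂ) 1, ‖u‖⁻¹) + ∫ w, ‖g w‖)).mono'
      hmeas.norm.integral_prod_right' (Eventually.of_forall fun z => ?_)
    simp only [norm_smul (_ * _) (f _)]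
    rw [integral_mul_const, norm_mul, norm_norm, mul_comm,
      Real.norm_of_nonneg (integral_nonneg fun _ => norm_nonneg _)]
    gcongr
    exact (integrable_kernel hg hM z).2

/-- The product of two integrals is rewritten with the resolvent identity
`R(z) R(w) = (R(z) - R(w)) / (w - z)`; by Fubini's theorem the Cauchy–Pompeiu formula can be applied
in one of the variables in each of the two terms. -/
theorem hsInt_mul_of_compactSupport (hH : ResolventHypothesis H α) (hα : 0 ≤ α) {β β' : ℝ} {N : ℕ}
    (hβ : β < 0) (hβ' : β' < 0) (hN : α < N) {F G : ℂ → ℂ} (hF : AlmostAnalytic β N F)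
    (hG : AlmostAnalytic β' N G) (hFc : HasCompactSupport F) (hGc : HasCompactSupport G) :
    hsInt H F * hsInt H G = hsInt H (fun z => F z * G z) := by
  have hf := hF.integrable hH hα hβ hN
  have hg := hG.integrable hH hα hβ' hN
  set f : ℂ → (B →L[ℂ] B) := fun z => dbarC F z • opResolvent H z with hfdef
  set g : ℂ → (B →L[ℂ] B) := fun z => dbarC G z • opResolvent H z with hgdef
  have hdF := integrable_dbarC hF.contDiff hFc
  have hdG := integrable_dbarC hG.contDiff hGc
  obtain ⟨M, hM⟩ := (continuous_dbarC hF.contDiff).bounded_above_of_compact_support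
    (hasCompactSupport_dbarC hFc)
  obtain ⟨M', hM'⟩ := (continuous_dbarC hG.contDiff).bounded_above_of_compact_support
    (hasCompactSupport_dbarC hGc)
  have i1 := integrable_prod_kernel hf hdG hM'
  have i2 := (integrable_prod_kernel hg hdF hM).swap
  simp only [Function.comp_def, Prod.fst_swap, Prod.snd_swap] at i2
  have hprod : (∫ z, f z) * (∫ w, g w) = ∫ z, ∫ w, f z * g w := by
    rw [← integral_mul_const_of_integrable hf]
    congr 1; ext1 z
    rw [integral_const_mul_of_integrable hg]
  have hres : ∀ᵐ z : ℂ, ∫ w, f z * g w =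
      (∫ w, ((w - z)⁻¹ * dbarC G w) • f z) + ∫ w, ((z - w)⁻¹ * dbarC F z) • g w := by
    filter_upwards [ae_im_ne_zero, i1.prod_right_ae, i2.prod_right_ae] with z hz j1 j2
    rw [← integral_add j1 j2]
    refine integral_congr_ae ?_
    have hne : ∀ᵐ w : ℂ, w ≠ z := by simp [ae_iff, measure_singleton]
    filter_upwards [ae_im_ne_zero, hne] with w hw hwz
    have h1 := opResolvent_sub (hH.notMem_opSpectrum hz) (hH.notMem_opSpectrum hw)
    have h2 : w - z ≠ 0 := sub_ne_zero.2 hwz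
    have h3 : opResolvent H z * opResolvent H w =
        (w - z)⁻¹ • (opResolvent H z - opResolvent H w) := by
      rw [h1, smul_smul, inv_mul_cancel₀ h2, one_smul]
    have h4 : (z - w)⁻¹ = -(w - z)⁻¹ := by rw [← neg_sub, inv_neg]
    simp only [hfdef, hgdef]
    rw [smul_mul_smul_comm, h3, h4]
    module
  have i1' : Integrable (fun z => ∫ w, ((w - z)⁻¹ * dbarC G w) • f z) := i1.integral_prod_left
  have i2' : Integrable (fun z => ∫ w, ((z - w)⁻¹ * dbarC F z) • g w) := i2.integral_prod_left
  have hcp : ∀ (K : ℂ → ℂ) (_ : ContDiff ℝ 1 K) (_ : HasCompactSupport K) (z : ℂ),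
      ∫ w, (w - z)⁻¹ * dbarC K w = -(Real.pi : ℂ) * K z := fun K hK hKc z => by
    simpa only [smul_eq_mul] using cauchy_pompeiu hK hKc z
  have hA : ∫ z, ∫ w, ((w - z)⁻¹ * dbarC G w) • f z = -(Real.pi : ℂ) • ∫ z, G z • f z := by
    rw [← integral_smul]
    congr 1; ext1 z
    rw [integral_smul_const, hcp G hG.contDiff hGc, mul_smul]
  have hB : ∫ z, ∫ w, ((z - w)⁻¹ * dbarC F z) • g w = -(Real.pi : ℂ) • ∫ w, F w • g w := by
    rw [integral_integral_swap i2, ← integral_smul]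
    congr 1; ext1 w
    rw [integral_smul_const, hcp F hF.contDiff hFc, mul_smul]
  have jb : ∀ K : ℂ → ℂ, ContDiff ℝ 1 K → HasCompactSupport K →
      ∀ k : ℂ → (B →L[ℂ] B), Integrable k → Integrable (fun z => K z • k z) := by
    intro K hK hKc k hk
    obtain ⟨D, hD⟩ := hK.continuous.bounded_above_of_compact_support hKc
    exact hk.bdd_smul D hK.continuous.aestronglyMeasurable (Eventually.of_forall hD)
  have hsum : ∫ z, dbarC (fun z => F z * G z) z • opResolvent H z =
      (∫ z, G z • f z) + ∫ z, F z • g z := by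
    rw [← integral_add (jb G hG.contDiff hGc f hf) (jb F hF.contDiff hFc g hg)]
    congr 1; ext1 z
    have := dbarC_smul (hF.differentiable z) (hG.differentiable z)
    simp only [smul_eq_mul] at this
    rw [this]
    simp only [hfdef, hgdef]
    module
  have hpi : (Real.pi : ℂ) ≠ 0 := by exact_mod_cast Real.pi_ne_zero
  have htot : (∫ z, f z) * (∫ w, g w) =
      -(Real.pi : ℂ) • ∫ z, dbarC (fun z => F z * G z) z • opResolvent H z := by
    rw [hprod, integral_congr_ae hres, integral_add i1' i2', hA, hB, hsum, smul_add]
  rw [hsInt, hsInt, hsInt, smul_mul_smul_comm, htot, smul_smul]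
  congr 1
  push_cast
  field_simp

/-- The calculus is multiplicative. The compactly supported case is extended to general factors one
at a time, by multiplication with an approximate unit. -/
theorem hsInt_mul (hH : ResolventHypothesis H α) (hα : 0 ≤ α) {β β' : ℝ} {N : ℕ}
    (hβ : β < 0) (hβ' : β' < 0) (hN : α < N) {F G : ℂ → ℂ} (hF : AlmostAnalytic β N F)
    (hG : AlmostAnalytic β' N G) :
    hsInt H F * hsInt H G = hsInt H (fun z => F z * G z) := by
  obtain ⟨Θ, C, hC, hΘ, hΘc, hb, hdb, hlim, hdlim⟩ := exists_approximate_unit N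
  have key : ∀ {b : ℝ} {K : ℂ → ℂ}, b < 0 → AlmostAnalytic b N K →
      Tendsto (fun k => hsInt H (fun z => Θ k z * K z)) atTop (𝓝 (hsInt H K)) :=
    fun hb' hK => tendsto_hsInt_mul hH hα hb' hN hK hC hΘ hb hdb hlim hdlim
  have hΘK : ∀ {b : ℝ} {K : ℂ → ℂ} (k : ℕ), AlmostAnalytic b N K →
      AlmostAnalytic b N (fun z => Θ k z * K z) := fun k hK => by simpa using (hΘ k).mul hK
  have hββ' : β + β' < 0 := by linarith
  -- first with one compactly supported factor
  have h1 : ∀ k, hsInt H (fun z => Θ k z * F z) * hsInt H G =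
      hsInt H (fun z => Θ k z * (F z * G z)) := by
    intro k
    have l1 := (key hβ' hG).const_mul (hsInt H (fun z => Θ k z * F z))
    have l2 := key hββ' (hΘK k (hF.mul hG))
    refine tendsto_nhds_unique l1 (l2.congr fun j => ?_)
    rw [hsInt_mul_of_compactSupport hH hα hβ hβ' hN (hΘK k hF) (hΘK j hG) (hΘc k).mul_right
      (hΘc j).mul_right]
    congr 1; ext z; ring
  have l1 := (key hβ hF).mul_const (hsInt H G)
  have l2 := key hββ' (hF.mul hG)
  exact tendsto_nhds_unique l1 (l2.congr fun k => (h1 k).symm)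

end Multiplicative

/-! ### Resolvent functions -/

section ResolventFunctions

variable {B : Type*} [NormedAddCommGroup B] [NormedSpace ℂ B] [CompleteSpace B]
  {H : B →ₗ.[ℂ] B} {α : ℝ}

/-- A generalised almost analytic extension of `x ↦ 1 / (w - x)`: the holomorphic function
`1 / (w - z)`, with its pole removed by a bump function `κ`. The Cauchy–Pompeiu formula for `κ R`
evaluates its integral. -/
theorem exists_almostAnalytic_resolvent (hH : ResolventHypothesis H α) {w : ℂ} (hw : w.im ≠ 0)
    (N : ℕ) : ∃ F : ℂ → ℂ, AlmostAnalytic (-1) N F ∧ (∀ x : ℝ, F x = (w - x)⁻¹) ∧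
      hsInt H F = opResolvent H w := by
  have hw' : 0 < |w.im| := abs_pos.2 hw
  set r : ℝ := |w.im| / 4 with hr
  have hr0 : 0 < r := by positivity
  let b : ContDiffBump w := ⟨r, 2 * r, hr0, by linarith⟩
  set κ : ℂ → ℂ := fun z => ((b z : ℝ) : ℂ) with hκ
  have hκc : ContDiff ℝ 1 κ := Complex.ofRealCLM.contDiff.comp b.contDiff
  have hκd : Differentiable ℝ κ := hκc.differentiable one_ne_zero
  have hκs : HasCompactSupport κ := b.hasCompactSupport.comp_left Complex.ofReal_zero
  have hκ1 : ∀ᶠ z in 𝓝 w, κ z = 1 := by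
    filter_upwards [b.eventuallyEq_one] with z hz
    simp [hκ, hz]
  have hκw : κ w = 1 := hκ1.self_of_nhds
  have hκ0 : ∀ z : ℂ, z ∉ Metric.closedBall w (2 * r) → κ =ᶠ[𝓝 z] fun _ => 0 := fun z hz => by
    filter_upwards [Metric.isClosed_closedBall.isOpen_compl.mem_nhds hz] with u hu
    rw [mem_compl_iff, Metric.mem_closedBall, not_le] at hu
    have : b u = 0 := b.zero_of_le_dist hu.le
    simp [hκ, this]
  have him : ∀ z ∈ Metric.closedBall w (2 * r), 2 * r ≤ |z.im| := fun z hz => by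
    rw [mem_closedBall_iff_norm] at hz
    have h1 := (Complex.abs_im_le_norm (z - w)).trans hz
    rw [Complex.sub_im] at h1
    have h2 := abs_sub_abs_le_abs_sub w.im z.im
    rw [abs_sub_comm] at h2
    linarith
  set F : ℂ → ℂ := fun z => (1 - κ z) * (w - z)⁻¹ with hF
  have hFw : F =ᶠ[𝓝 w] fun _ => 0 := by
    filter_upwards [hκ1] with z hz
    simp [hF, hz]
  have hinv : ∀ z, z ≠ w → DifferentiableAt ℂ (fun u : ℂ => (w - u)⁻¹) z := fun z hz => by
    have : w - z ≠ 0 := sub_ne_zero.2 hz.symm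
    fun_prop (disch := assumption)
  have hFc : ContDiff ℝ 1 F := by
    rw [contDiff_iff_contDiffAt]
    intro z
    by_cases hz : z = w
    · subst hz; exact contDiffAt_const.congr_of_eventuallyEq hFw
    · refine (contDiff_const.sub hκc).contDiffAt.mul ?_
      exact (contDiffAt_const.sub contDiffAt_id).inv (sub_ne_zero.2 (Ne.symm hz))
  have hdF : ∀ z, dbarC F z = (z - w)⁻¹ * dbarC κ z := by
    intro z
    by_cases hz : z = w
    · subst hz; rw [dbarC_congr hFw]; simp [dbarC]
    · have h1 := dbarC_smul (F := fun u => 1 - κ u) (G := fun u => (w - u)⁻¹)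
        ((differentiableAt_const (1 : ℂ)).sub (hκd z)) ((hinv z hz).restrictScalars ℝ)
      have h2 : dbarC (fun u => 1 - κ u) z = -dbarC κ z := by
        have := dbarC_add (F := fun _ => (1 : ℂ)) (G := fun u => -κ u) (z := z)
          (differentiableAt_const _) (hκd z).neg
        rw [dbarC_neg] at this
        simp only [← sub_eq_add_neg] at this
        rw [this]
        simp [dbarC]
      simp only [smul_eq_mul] at h1
      rw [hF, h1, h2, dbarC_eq_zero (hinv z hz), ← neg_sub z w, inv_neg]
      ring
  have hdF0 : ∀ z, z ∉ Metric.closedBall w (2 * r) → dbarC F z = 0 := fun z hz => by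
    rw [hdF, dbarC_congr (hκ0 z hz)]; simp [dbarC]
  refine ⟨F, ⟨hFc, ?_, ?_⟩, fun x => ?_, ?_⟩
  · refine ⟨(1 + ‖w‖) / r + 1, by positivity, fun z => ?_⟩
    have hb := bracket_pos z
    rw [Real.rpow_neg_one, ← div_eq_mul_inv, le_div_iff₀ hb]
    by_cases hz : z ∈ Metric.closedBall w r
    · have : b z = 1 := b.one_of_mem_closedBall hz
      simp only [hF, hκ, this, Complex.ofReal_one, sub_self, zero_mul, norm_zero]
      positivity
    · rw [mem_closedBall_iff_norm, not_le] at hz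
      have h1 : ‖1 - κ z‖ ≤ 1 := by
        have : (1 : ℂ) - κ z = ((1 - b z : ℝ) : ℂ) := by simp [hκ]
        rw [this, Complex.norm_real, Real.norm_of_nonneg (by linarith [b.le_one (x := z)])]
        linarith [b.nonneg (x := z)]
      have h2 : ‖z‖ ≤ ‖w‖ + ‖z - w‖ := by
        calc ‖z‖ = ‖w + (z - w)‖ := by congr 1; ring
          _ ≤ _ := norm_add_le _ _
      have h3 : bracket z ≤ ((1 + ‖w‖) / r + 1) * ‖z - w‖ := by
        have h4 : 1 + ‖w‖ ≤ (1 + ‖w‖) / r * ‖z - w‖ := by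
          rw [div_mul_eq_mul_div, le_div_iff₀ hr0]
          gcongr
        linarith [bracket_le_one_add z]
      have h5 : 0 < ‖z - w‖ := hr0.trans hz
      rw [hF]
      simp only [norm_mul, norm_inv, norm_sub_rev w z]
      calc ‖1 - κ z‖ * ‖z - w‖⁻¹ * bracket z
          ≤ 1 * ‖z - w‖⁻¹ * (((1 + ‖w‖) / r + 1) * ‖z - w‖) := by gcongr
        _ = _ := by field_simp
  · have hcs : HasCompactSupport (dbarC F) :=
      HasCompactSupport.intro (isCompact_closedBall w (2 * r)) hdF0
    obtain ⟨M, hM⟩ := (continuous_dbarC hFc).bounded_above_of_compact_support hcs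
    have hM0 : 0 ≤ M := (norm_nonneg _).trans (hM 0)
    set L : ℝ := 1 + ‖w‖ + 2 * r with hL
    have hL0 : 0 < L := by positivity
    refine ⟨M * (L ^ 2 * (L / (2 * r)) ^ N), by positivity, fun z => ?_⟩
    have hb := bracket_pos z
    have ht := abs_im_div_bracket_nonneg z
    by_cases hz : z ∈ Metric.closedBall w (2 * r)
    · have h1 := him z hz
      have hzi : 0 < |z.im| := by linarith
      have h2 : bracket z ≤ L := by
        rw [mem_closedBall_iff_norm] at hz
        have : ‖z‖ ≤ ‖w‖ + ‖z - w‖ := by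
          calc ‖z‖ = ‖w + (z - w)‖ := by congr 1; ring
            _ ≤ _ := norm_add_le _ _
        linarith [bracket_le_one_add z]
      have e : bracket z ^ ((-1 : ℝ) - 1) = (bracket z ^ 2)⁻¹ := by
        have : ((-1 : ℝ) - 1) = -((2 : ℕ) : ℝ) := by norm_num
        rw [this, Real.rpow_neg hb.le, Real.rpow_natCast]
      have h3 : 1 ≤ (L ^ 2 * (L / (2 * r)) ^ N) *
          (bracket z ^ ((-1 : ℝ) - 1) * (|z.im| / bracket z) ^ N) := by
        rw [e, mul_mul_mul_comm, ← mul_pow, ← div_eq_mul_inv]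
        have a1 : 1 ≤ L ^ 2 / bracket z ^ 2 := by
          rw [one_le_div (by positivity)]; gcongr
        have a2 : 1 ≤ L / (2 * r) * (|z.im| / bracket z) := by
          rw [div_mul_div_comm, one_le_div (by positivity), mul_comm]
          gcongr
        exact one_le_mul_of_one_le_of_one_le a1 (one_le_pow₀ a2)
      calc ‖dbarC F z‖ ≤ M * 1 := by rw [mul_one]; exact hM z
        _ ≤ M * ((L ^ 2 * (L / (2 * r)) ^ N) *
          (bracket z ^ ((-1 : ℝ) - 1) * (|z.im| / bracket z) ^ N)) := by gcongr
        _ = _ := by ring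
    · rw [hdF0 z hz, norm_zero]
      positivity
  · have : (x : ℂ) ∉ Metric.closedBall w (2 * r) := fun h => by
      have := him _ h
      rw [Complex.ofReal_im, abs_zero] at this
      linarith
    have h1 := (hκ0 _ this).self_of_nhds
    simp [hF, h1]
  · have hGc : ContDiff ℝ 1 (fun z => κ z • opResolvent H z) := by
      rw [contDiff_iff_contDiffAt]
      intro z
      by_cases hz : z ∈ Metric.closedBall w (2 * r)
      · have : z.im ≠ 0 := abs_pos.1 (by linarith [him z hz])
        exact hκc.contDiffAt.smul (contDiffAt_opResolvent (hH.notMem_opSpectrum this))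
      · refine (contDiffAt_const (c := 0)).congr_of_eventuallyEq ?_
        filter_upwards [hκ0 z hz] with u hu
        rw [hu, zero_smul]
    have hGs : HasCompactSupport (fun z => κ z • opResolvent H z) := hκs.smul_right
    have hcp := cauchy_pompeiu hGc hGs w
    rw [hκw, one_smul] at hcp
    -- `∂(κ R)/∂z̄ = (∂κ/∂z̄) R`, since `R` is holomorphic near the support of `κ`
    have hpt : ∀ z, dbarC F z • opResolvent H z =
        (z - w)⁻¹ • dbarC (fun z => κ z • opResolvent H z) z := by
      intro z
      rw [hdF, mul_smul]
      congr 1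
      by_cases hz : z ∈ Metric.closedBall w (2 * r)
      · have hzi : z.im ≠ 0 := abs_pos.1 (by linarith [him z hz])
        have hd := differentiableAt_opResolvent (hH.notMem_opSpectrum hzi)
        rw [dbarC_smul (hκd z) (hd.restrictScalars ℝ), dbarC_eq_zero hd, smul_zero, add_zero]
      · have h1 : (fun z => κ z • opResolvent H z) =ᶠ[𝓝 z] fun _ => 0 := by
          filter_upwards [hκ0 z hz] with u hu
          rw [hu, zero_smul]
        rw [dbarC_congr h1, dbarC_congr (hκ0 z hz)]
        simp [dbarC]
    have hpi : (Real.pi : ℂ) ≠ 0 := by exact_mod_cast Real.pi_ne_zero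
    rw [hsInt, integral_congr_ae (Eventually.of_forall hpt), hcp, smul_smul]
    have : -((1 / Real.pi : ℝ) : ℂ) * -(Real.pi : ℂ) = 1 := by
      push_cast; field_simp
    rw [this, one_smul]

end ResolventFunctions

/-! ### Existence of Seeley data -/

section SeeleyData

/-- The Taylor coefficients of the entire function `∏_{j ≥ 0} (1 - t 2^(-j))`, which vanishes at
`t = 2^m` for all `m ≥ 0`. -/
def eulerCoeff : ℕ → ℝ
  | 0 => 1
  | k + 1 => -2 * eulerCoeff k / (2 ^ (k + 1) - 1)

theorem two_pow_succ_sub_one_pos (k : ℕ) : (0 : ℝ) < 2 ^ (k + 1) - 1 := by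
  have : (1 : ℝ) < 2 ^ (k + 1) := one_lt_pow₀ (by norm_num) k.succ_ne_zero
  linarith

theorem abs_eulerCoeff_succ (k : ℕ) :
    |eulerCoeff (k + 1)| = 2 / (2 ^ (k + 1) - 1) * |eulerCoeff k| := by
  rw [eulerCoeff, abs_div, abs_mul, abs_of_pos (two_pow_succ_sub_one_pos k)]
  norm_num
  ring

theorem summable_abs_eulerCoeff_mul_pow (t : ℝ) :
    Summable (fun k => |eulerCoeff k| * |t| ^ k) := by
  have hlim : Tendsto (fun k : ℕ => 2 / ((2 : ℝ) ^ (k + 1) - 1) * |t|) atTop (𝓝 (0 * |t|)) := by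
    refine Tendsto.mul_const _ (tendsto_const_nhds.div_atTop ?_)
    refine tendsto_atTop_add_const_right _ (-1) ?_
    exact (tendsto_pow_atTop_atTop_of_one_lt (by norm_num : (1 : ℝ) < 2)).comp
      (tendsto_add_atTop_nat 1)
  rw [zero_mul] at hlim
  refine summable_of_ratio_norm_eventually_le (r := 1 / 2) (by norm_num) ?_
  filter_upwards [hlim.eventually_le_const (by norm_num : (0 : ℝ) < 1 / 2)] with k hk
  rw [Real.norm_of_nonneg (by positivity), Real.norm_of_nonneg (by positivity),
    abs_eulerCoeff_succ, pow_succ]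
  calc _ = (2 / (2 ^ (k + 1) - 1) * |t|) * (|eulerCoeff k| * |t| ^ k) := by ring
    _ ≤ _ := by gcongr

theorem summable_eulerCoeff_mul_pow (t : ℝ) : Summable (fun k => eulerCoeff k * t ^ k) := by
  refine Summable.of_norm ?_
  simpa [abs_mul, abs_pow] using summable_abs_eulerCoeff_mul_pow t

/-- The functional equation `E(2t) = (1 - 2t) E(t)` of the product. -/
theorem tsum_eulerCoeff_two_mul (t : ℝ) :
    ∑' k, eulerCoeff k * (2 * t) ^ k = (1 - 2 * t) * ∑' k, eulerCoeff k * t ^ k := by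
  have h1 := summable_eulerCoeff_mul_pow (2 * t)
  have h2 := summable_eulerCoeff_mul_pow t
  have h3 : (∑' k, eulerCoeff k * (2 * t) ^ k) - ∑' k, eulerCoeff k * t ^ k =
      -(2 * t) * ∑' k, eulerCoeff k * t ^ k := by
    rw [← h1.tsum_sub h2, (h1.sub h2).tsum_eq_zero_add, ← tsum_mul_left]
    simp only [pow_zero, mul_one, sub_self, zero_add]
    congr 1; ext k
    have := (two_pow_succ_sub_one_pos k).ne'
    rw [eulerCoeff]
    field_simp
    ring
  linarith

theorem tsum_eulerCoeff_two_pow (m : ℕ) : ∑' k, eulerCoeff k * (2 ^ m) ^ k = 0 := by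
  induction m with
  | zero =>
    have := tsum_eulerCoeff_two_mul (1 / 2)
    norm_num at this
    simpa using this
  | succ m ih => rw [pow_succ', tsum_eulerCoeff_two_mul, ih, mul_zero]

theorem summable_abs_eulerCoeff_div_mul_pow (t : ℝ) :
    Summable (fun k => |eulerCoeff k / (2 ^ k + 1)| * |t| ^ k) := by
  refine (summable_abs_eulerCoeff_mul_pow t).of_nonneg_of_le (fun k => by positivity) fun k => ?_
  refine mul_le_mul_of_nonneg_right ?_ (by positivity)
  rw [abs_div]
  refine div_le_self (abs_nonneg _) ?_
  rw [abs_of_pos (by positivity)]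
  have : (0 : ℝ) < 2 ^ k := by positivity
  linarith

theorem summable_eulerCoeff_div_mul_pow (t : ℝ) :
    Summable (fun k => eulerCoeff k / (2 ^ k + 1) * t ^ k) := by
  refine Summable.of_norm ?_
  simpa only [norm_mul, norm_pow, Real.norm_eq_abs] using summable_abs_eulerCoeff_div_mul_pow t

/-- Dividing the coefficients by `2^k + 1` gives a solution of `A(2t) + A(t) = E(t)`, so `A`
changes its sign from `2^m` to `2^(m + 1)`. -/
theorem tsum_eulerCoeff_div_two_pow (m : ℕ) :
    ∑' k, eulerCoeff k / (2 ^ k + 1) * (2 ^ m) ^ k =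
      (-1) ^ m * ∑' k, eulerCoeff k / (2 ^ k + 1) := by
  induction m with
  | zero => simp
  | succ m ih =>
    have h1 := summable_eulerCoeff_div_mul_pow (2 ^ (m + 1))
    have h2 := summable_eulerCoeff_div_mul_pow (2 ^ m)
    have h3 : (∑' k, eulerCoeff k / (2 ^ k + 1) * (2 ^ (m + 1)) ^ k) +
        ∑' k, eulerCoeff k / (2 ^ k + 1) * (2 ^ m) ^ k = 0 := by
      rw [← h1.tsum_add h2, ← tsum_eulerCoeff_two_pow m]
      congr 1; ext k
      have : (2 : ℝ) ^ k + 1 ≠ 0 := by positivity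
      rw [pow_succ', mul_pow]
      field_simp
    rw [ih] at h3
    rw [pow_succ (-1 : ℝ)]
    linarith

theorem tsum_eulerCoeff_div_pos : 0 < ∑' k, eulerCoeff k / (2 ^ k + 1) := by
  have hs : Summable (fun k => eulerCoeff k / (2 ^ k + 1)) := by
    simpa using summable_eulerCoeff_div_mul_pow 1
  -- the first four terms add up to `109 / 1890`, and the remaining ones to at most `1 / 150`
  have hval : ∑ k ∈ Finset.range 4, eulerCoeff k / (2 ^ k + 1) = 109 / 1890 := by
    simp only [Finset.sum_range_succ, Finset.sum_range_zero, eulerCoeff]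
    norm_num
  have htail : ∀ k, ‖eulerCoeff (k + 4) / (2 ^ (k + 4) + 1)‖ ≤ 1 / 300 * (1 / 2) ^ k := by
    intro k
    induction k with
    | zero =>
      simp only [eulerCoeff]
      norm_num [abs_of_pos, abs_of_neg]
    | succ k ih =>
      have h0 : (16 : ℝ) ≤ 2 ^ (k + 4) := by
        rw [pow_add]
        have : (1 : ℝ) ≤ 2 ^ k := one_le_pow₀ (by norm_num)
        linarith
      have h1 : (0 : ℝ) < 2 ^ (k + 4) + 1 := by positivity
      rw [norm_div, Real.norm_eq_abs, Real.norm_of_nonneg h1.le] at ih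
      have e : k + 1 + 4 = (k + 4) + 1 := by ring
      rw [e, norm_div, Real.norm_eq_abs, abs_eulerCoeff_succ,
        Real.norm_of_nonneg (by positivity), pow_succ (1 / 2 : ℝ)]
      have h2 : (2 : ℝ) / (2 ^ (k + 4 + 1) - 1) ≤ 1 / 2 := by
        rw [div_le_div_iff₀ (two_pow_succ_sub_one_pos _) two_pos, pow_succ]
        linarith
      have h3 : (2 : ℝ) ^ (k + 4) + 1 ≤ 2 ^ (k + 4 + 1) + 1 := by
        rw [pow_succ _ (k + 4)]; linarith
      calc _ ≤ 1 / 2 * |eulerCoeff (k + 4)| / (2 ^ (k + 4) + 1) := by gcongr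
        _ = 1 / 2 * (|eulerCoeff (k + 4)| / (2 ^ (k + 4) + 1)) := by ring
        _ ≤ 1 / 2 * (1 / 300 * (1 / 2) ^ k) := by gcongr
        _ = _ := by ring
  have hgeo : HasSum (fun k : ℕ => (1 / 300 : ℝ) * (1 / 2) ^ k) (1 / 300 * 2) :=
    hasSum_geometric_two.mul_left _
  have h1 := tsum_of_norm_bounded hgeo htail
  rw [← hs.sum_add_tsum_nat_add 4, hval]
  have h2 := (abs_le.1 (Real.norm_eq_abs _ ▸ h1)).1
  linarith

/-- The data are `bₖ = -2^k` and `aₖ = eₖ / ((2^k + 1) A(1))`, with the coefficients `eₖ` of `E`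
and `A(t) = ∑ eₖ / (2^k + 1) t^k`. Then `∑ aₖ bₖⁿ = (-1)^n A(2^n) / A(1) = 1`. -/
theorem nonempty_seeleyData : Nonempty SeeleyData := by
  set S := ∑' k, eulerCoeff k / (2 ^ k + 1) with hS
  have hS0 : 0 < S := tsum_eulerCoeff_div_pos
  have hφ : ContDiff ℝ ∞ (fun x : ℝ =>
      ((Real.smoothTransition (2 - x) * Real.smoothTransition (x + 1) : ℝ) : ℂ)) := by
    refine Complex.ofRealCLM.contDiff.comp (ContDiff.mul ?_ ?_)
    · exact Real.smoothTransition.contDiff.comp (contDiff_const.sub contDiff_id)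
    · exact Real.smoothTransition.contDiff.comp (contDiff_id.add contDiff_const)
  have habs : ∀ k n : ℕ, |(-2 ^ k : ℝ)| ^ n = |(2 : ℝ) ^ n| ^ k := fun k n => by
    rw [abs_neg, abs_of_pos (by positivity), abs_of_pos (by positivity), ← pow_mul, ← pow_mul,
      mul_comm]
  refine ⟨{
    a := fun k => eulerCoeff k / (2 ^ k + 1) / S
    b := fun k => -2 ^ k
    φ := _
    b_neg := fun k => by
      have : (0 : ℝ) < 2 ^ k := by positivity
      linarith
    summable := fun n => ?_
    moments := fun n => ?_
    b_tendsto := ?_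
    φ_smooth := hφ
    φ_eq_one := fun x hx => ?_
    φ_eq_zero_right := fun x hx => ?_
    φ_eq_zero_left := fun x hx => ?_ }⟩
  · refine ((summable_abs_eulerCoeff_div_mul_pow (2 ^ n)).mul_left S⁻¹).congr fun k => ?_
    rw [habs, abs_div _ S, abs_of_pos hS0]
    ring
  · have h1 := (summable_eulerCoeff_div_mul_pow (2 ^ n)).hasSum
    rw [tsum_eulerCoeff_div_two_pow] at h1
    have h2 := h1.mul_left ((-1) ^ n / S)
    have e1 : (-1) ^ n / S * ((-1) ^ n * S) = 1 := by
      rw [div_mul_eq_mul_div, mul_left_comm, ← mul_assoc, ← mul_pow]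
      simp [hS0.ne']
    rw [e1] at h2
    refine h2.congr_fun fun k => ?_
    rw [neg_pow (2 ^ k : ℝ), ← pow_mul, ← pow_mul, mul_comm n k]
    ring
  · exact tendsto_neg_atTop_atBot.comp
      (tendsto_pow_atTop_atTop_of_one_lt (by norm_num : (1 : ℝ) < 2))
  · rw [Real.smoothTransition.one_of_one_le (by linarith [hx.2]),
      Real.smoothTransition.one_of_one_le (by linarith [hx.1])]
    simp
  · rw [Real.smoothTransition.zero_of_nonpos (by linarith)]
    simp
  · rw [Real.smoothTransition.zero_of_nonpos (x := x + 1) (by linarith)]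
    simp

end SeeleyData

/-! ### Seeley extensions are smooth -/

section SeeleyExtension

variable {d : SeeleyData} {F : ℝ → ℂ}

/-- The `r`-th one-sided derivative of `u ↦ φ(u) F(u)` on `[0, ∞)`. -/
def cutDeriv (d : SeeleyData) (F : ℝ → ℂ) (r : ℕ) (u : ℝ) : ℂ :=
  iteratedDerivWithin r (fun u => d.φ u * F u) (Ici 0) u

/-- The candidate for the `r`-th derivative of the Seeley extension of `F|_{[0, ∞)}`, obtained by
differentiating term by term. -/
def seeleyDeriv (d : SeeleyData) (F : ℝ → ℂ) (r : ℕ) (x : ℝ) : ℂ :=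
  if x < 0 then ∑' k, ((d.a k * d.b k ^ r : ℝ) : ℂ) * cutDeriv d F r (d.b k * x)
  else iteratedDerivWithin r F (Ici 0) x

theorem contDiffOn_cut (hF : ContDiffOn ℝ ∞ F (Ici 0)) :
    ContDiffOn ℝ ∞ (fun u => d.φ u * F u) (Ici 0) :=
  d.φ_smooth.contDiffOn.mul hF

theorem hasDerivWithinAt_iteratedDerivWithin (hF : ContDiffOn ℝ ∞ F (Ici 0)) (r : ℕ) {x : ℝ}
    (hx : 0 ≤ x) : HasDerivWithinAt (iteratedDerivWithin r F (Ici 0))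
      (iteratedDerivWithin (r + 1) F (Ici 0) x) (Ici 0) x := by
  rw [iteratedDerivWithin_succ]
  exact (hF.differentiableOn_iteratedDerivWithin (by exact_mod_cast WithTop.coe_lt_top _)
    (uniqueDiffOn_Ici 0) x hx).hasDerivWithinAt

theorem continuousOn_iteratedDerivWithin (hF : ContDiffOn ℝ ∞ F (Ici 0)) (r : ℕ) :
    ContinuousOn (iteratedDerivWithin r F (Ici 0)) (Ici 0) := fun _ hx =>
  (hasDerivWithinAt_iteratedDerivWithin hF r hx).continuousWithinAt

theorem hasDerivAt_iteratedDerivWithin (hF : ContDiffOn ℝ ∞ F (Ici 0)) (r : ℕ) {x : ℝ}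
    (hx : 0 < x) : HasDerivAt (iteratedDerivWithin r F (Ici 0))
      (iteratedDerivWithin (r + 1) F (Ici 0) x) x :=
  (hasDerivWithinAt_iteratedDerivWithin hF r hx.le).hasDerivAt (Ici_mem_nhds hx)

theorem cutDeriv_eq_zero (r : ℕ) {u : ℝ} (hu : 2 < u) : cutDeriv d F r u = 0 := by
  have h : (fun u => d.φ u * F u) =ᶠ[𝓝[Ici 0] u] fun _ => (0 : ℂ) := by
    filter_upwards [mem_nhdsWithin_of_mem_nhds (Ioi_mem_nhds hu)] with v hv
    rw [d.φ_eq_zero_right v (le_of_lt hv), zero_mul]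
  have h2 := h.iteratedDerivWithin_eq (n := r) (by simp [d.φ_eq_zero_right u hu.le])
  rw [cutDeriv, h2]
  simp [iteratedDerivWithin]

theorem cutDeriv_zero_right (r : ℕ) : cutDeriv d F r 0 = iteratedDerivWithin r F (Ici 0) 0 := by
  have h : (fun u => d.φ u * F u) =ᶠ[𝓝[Ici 0] 0] F := by
    filter_upwards [mem_nhdsWithin_of_mem_nhds (Iio_mem_nhds one_pos), self_mem_nhdsWithin]
      with v hv hv'
    rw [d.φ_eq_one v ⟨hv', le_of_lt hv⟩, one_mul]
  exact h.iteratedDerivWithin_eq (by simp [d.φ_eq_one 0 (by simp)])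

theorem exists_norm_cutDeriv_le (hF : ContDiffOn ℝ ∞ F (Ici 0)) (r : ℕ) :
    ∃ M, 0 ≤ M ∧ ∀ u, 0 ≤ u → ‖cutDeriv d F r u‖ ≤ M := by
  obtain ⟨M, hM⟩ := isCompact_Icc.exists_bound_of_continuousOn
    ((continuousOn_iteratedDerivWithin (contDiffOn_cut (d := d) hF) r).mono
      (Icc_subset_Ici_self : Icc (0 : ℝ) 2 ⊆ Ici 0))
  have hM0 : 0 ≤ M := (norm_nonneg _).trans (hM 0 (by simp))
  refine ⟨M, hM0, fun u hu => ?_⟩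
  rcases le_or_gt u 2 with h | h
  · exact hM u ⟨hu, h⟩
  · rwa [cutDeriv_eq_zero r h, norm_zero]

theorem SeeleyData.mul_pos_of_neg (d : SeeleyData) (k : ℕ) {x : ℝ} (hx : x < 0) :
    0 < d.b k * x := mul_pos_of_neg_of_neg (d.b_neg k) hx

theorem norm_seeleyTerm_le {r : ℕ} {M : ℝ} (hM : ∀ u, 0 ≤ u → ‖cutDeriv d F r u‖ ≤ M) (k : ℕ)
    {x : ℝ} (hx : x < 0) : ‖((d.a k * d.b k ^ r : ℝ) : ℂ) * cutDeriv d F r (d.b k * x)‖ ≤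
      |d.a k| * |d.b k| ^ r * M := by
  rw [norm_mul, Complex.norm_real, Real.norm_eq_abs, abs_mul, abs_pow]
  gcongr
  exact hM _ (d.mul_pos_of_neg k hx).le

theorem summable_seeleyTerm (hF : ContDiffOn ℝ ∞ F (Ici 0)) (r : ℕ) {x : ℝ} (hx : x < 0) :
    Summable fun k => ((d.a k * d.b k ^ r : ℝ) : ℂ) * cutDeriv d F r (d.b k * x) := by
  obtain ⟨M, -, hM⟩ := exists_norm_cutDeriv_le (d := d) hF r
  exact ((d.summable r).mul_right M).of_norm_bounded fun k => norm_seeleyTerm_le hM k hx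

theorem hasDerivAt_seeleyDeriv_of_neg (hF : ContDiffOn ℝ ∞ F (Ici 0)) (r : ℕ) {x : ℝ}
    (hx : x < 0) : HasDerivAt (seeleyDeriv d F r) (seeleyDeriv d F (r + 1) x) x := by
  obtain ⟨M, hM0, hM⟩ := exists_norm_cutDeriv_le (d := d) hF (r + 1)
  have key := hasDerivAt_tsum_of_isPreconnected (t := Iio (0 : ℝ)) (y := x) (y₀ := x)
    (g := fun k x => ((d.a k * d.b k ^ r : ℝ) : ℂ) * cutDeriv d F r (d.b k * x))
    (g' := fun k x => ((d.a k * d.b k ^ (r + 1) : ℝ) : ℂ) * cutDeriv d F (r + 1) (d.b k * x))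
    ((d.summable (r + 1)).mul_right M) isOpen_Iio isPreconnected_Iio
    (fun k y hy => ?_) (fun k y hy => norm_seeleyTerm_le hM k hy) hx
    (summable_seeleyTerm hF r hx) hx
  · rw [seeleyDeriv, if_pos hx]
    refine key.congr_of_eventuallyEq ?_
    filter_upwards [Iio_mem_nhds hx] with y hy
    rw [seeleyDeriv, if_pos (mem_Iio.1 hy)]
  · have h1 : HasDerivAt (cutDeriv d F r) (cutDeriv d F (r + 1) (d.b k * y)) (d.b k * y) :=
      hasDerivAt_iteratedDerivWithin (contDiffOn_cut hF) r (d.mul_pos_of_neg k hy)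
    have h2 : HasDerivAt (fun y => d.b k * y) (d.b k) y := by
      simpa using (hasDerivAt_id y).const_mul (d.b k)
    have h3 := (h1.scomp y h2).const_mul ((d.a k * d.b k ^ r : ℝ) : ℂ)
    refine h3.congr_deriv ?_
    rw [Complex.real_smul]
    push_cast
    ring

theorem hasDerivAt_seeleyDeriv_of_pos (hF : ContDiffOn ℝ ∞ F (Ici 0)) (r : ℕ) {x : ℝ}
    (hx : 0 < x) : HasDerivAt (seeleyDeriv d F r) (seeleyDeriv d F (r + 1) x) x := by
  rw [seeleyDeriv, if_neg hx.le.not_gt]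
  refine (hasDerivAt_iteratedDerivWithin hF r hx).congr_of_eventuallyEq ?_
  filter_upwards [Ioi_mem_nhds hx] with y hy
  rw [seeleyDeriv, if_neg (le_of_lt hy).not_gt]

/-- The one-sided limits at `0` agree because of the moment conditions `∑ aₖ bₖʳ = 1`. -/
theorem continuousAt_seeleyDeriv_zero (hF : ContDiffOn ℝ ∞ F (Ici 0)) (r : ℕ) :
    ContinuousAt (seeleyDeriv d F r) 0 := by
  rw [continuousAt_iff_continuous_left'_right']
  have h0 : seeleyDeriv d F r 0 = iteratedDerivWithin r F (Ici 0) 0 := by simp [seeleyDeriv]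
  constructor
  · obtain ⟨M, hM0, hM⟩ := exists_norm_cutDeriv_le (d := d) hF r
    have hlim : Tendsto
        (fun x => ∑' k, ((d.a k * d.b k ^ r : ℝ) : ℂ) * cutDeriv d F r (d.b k * x)) (𝓝[<] 0)
        (𝓝 (∑' k, ((d.a k * d.b k ^ r : ℝ) : ℂ) * cutDeriv d F r 0)) := by
      refine tendsto_tsum_of_dominated_convergence ((d.summable r).mul_right M) (fun k => ?_) ?_
      · refine Tendsto.const_mul _ ?_
        have hc := continuousOn_iteratedDerivWithin (contDiffOn_cut (d := d) hF) r 0 self_mem_Ici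
        refine hc.tendsto.comp (tendsto_nhdsWithin_iff.2 ⟨?_, ?_⟩)
        · have : Continuous fun x : ℝ => d.b k * x := by fun_prop
          have h := this.tendsto 0
          rw [mul_zero] at h
          exact h.mono_left nhdsWithin_le_nhds
        · filter_upwards [self_mem_nhdsWithin] with x hx
          exact (d.mul_pos_of_neg k hx).le
      · filter_upwards [self_mem_nhdsWithin] with x hx k
        exact norm_seeleyTerm_le hM k hx
    have hsum : ∑' k, ((d.a k * d.b k ^ r : ℝ) : ℂ) * cutDeriv d F r 0 =
        seeleyDeriv d F r 0 := by
      rw [tsum_mul_right, ← Complex.ofReal_tsum, (d.moments r).tsum_eq, cutDeriv_zero_right, h0]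
      simp
    rw [hsum] at hlim
    refine hlim.congr' ?_
    filter_upwards [self_mem_nhdsWithin] with x hx
    rw [seeleyDeriv, if_pos (mem_Iio.1 hx)]
  · refine (((continuousOn_iteratedDerivWithin hF r) 0 self_mem_Ici).mono
      Ioi_subset_Ici_self).congr (fun x hx => ?_) h0
    rw [seeleyDeriv, if_neg (le_of_lt hx).not_gt]

theorem hasDerivAt_seeleyDeriv (hF : ContDiffOn ℝ ∞ F (Ici 0)) (r : ℕ) (x : ℝ) :
    HasDerivAt (seeleyDeriv d F r) (seeleyDeriv d F (r + 1) x) x := by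
  have hne : ∀ y ≠ (0 : ℝ), HasDerivAt (seeleyDeriv d F r) (seeleyDeriv d F (r + 1) y) y :=
    fun y hy => (lt_or_gt_of_ne hy).elim (hasDerivAt_seeleyDeriv_of_neg hF r)
      (hasDerivAt_seeleyDeriv_of_pos hF r)
  rcases eq_or_ne x 0 with rfl | hx
  · exact hasDerivAt_of_hasDerivAt_of_ne hne (continuousAt_seeleyDeriv_zero hF r)
      (continuousAt_seeleyDeriv_zero hF (r + 1))
  · exact hne x hx

theorem iteratedDeriv_seeleyDeriv (hF : ContDiffOn ℝ ∞ F (Ici 0)) (r : ℕ) :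
    iteratedDeriv r (seeleyDeriv d F 0) = seeleyDeriv d F r := by
  induction r with
  | zero => exact iteratedDeriv_zero
  | succ r ih =>
    rw [iteratedDeriv_succ, ih]
    exact funext fun x => (hasDerivAt_seeleyDeriv hF r x).deriv

theorem contDiff_seeleyDeriv (hF : ContDiffOn ℝ ∞ F (Ici 0)) :
    ContDiff ℝ ∞ (seeleyDeriv d F 0) := by
  refine contDiff_of_differentiable_iteratedDeriv fun m _ => ?_
  rw [iteratedDeriv_seeleyDeriv hF]
  exact fun x => (hasDerivAt_seeleyDeriv hF m x).differentiableAt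

theorem seeleyExt_eq_seeleyDeriv (d : SeeleyData) (f : Ici (0 : ℝ) → ℂ) :
    seeleyExt d f = seeleyDeriv d (IciExtend f) 0 := by
  funext x
  simp [seeleyExt, seeleyDeriv, cutDeriv]

/-- As `bₖ` tends to `-∞` and does not vanish, the numbers `1 / bₖ` are bounded. -/
theorem SeeleyData.exists_abs_inv_le (d : SeeleyData) : ∃ Q, 0 < Q ∧ ∀ k, |d.b k|⁻¹ ≤ Q := by
  have h : Tendsto (fun k => |d.b k|⁻¹) atTop (𝓝 0) :=
    (tendsto_abs_atBot_atTop.comp d.b_tendsto).inv_tendsto_atTop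
  obtain ⟨Q, hQ⟩ := h.bddAbove_range
  have hQ' : ∀ k, |d.b k|⁻¹ ≤ Q := fun k => hQ (mem_range_self k)
  exact ⟨Q, (inv_pos.2 (abs_pos.2 (d.b_neg 0).ne)).trans_le (hQ' 0), hQ'⟩

/-- Far to the left all the points `bₖ x` lie beyond the support of `φ`. -/
theorem seeleyDeriv_eq_zero {Q : ℝ} (hQ : ∀ k, |d.b k|⁻¹ ≤ Q) (r : ℕ) {x : ℝ}
    (hx : x < -(2 * Q)) : seeleyDeriv d F r x = 0 := by
  have hQ0 : 0 ≤ Q := (inv_nonneg.2 (abs_nonneg _)).trans (hQ 0)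
  have hx0 : x < 0 := by linarith
  rw [seeleyDeriv, if_pos hx0]
  have : ∀ k, ((d.a k * d.b k ^ r : ℝ) : ℂ) * cutDeriv d F r (d.b k * x) = 0 := fun k => by
    have hb : 0 < |d.b k| := abs_pos.2 (d.b_neg k).ne
    have h1 : 1 ≤ |d.b k| * Q := by
      have := mul_le_mul_of_nonneg_left (hQ k) hb.le
      rwa [mul_inv_cancel₀ hb.ne'] at this
    rw [cutDeriv_eq_zero, mul_zero]
    rw [abs_of_neg (d.b_neg k)] at h1 hb
    nlinarith
  exact (tsum_congr this).trans tsum_zero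

/-- Only a compact piece is added on the negative half-line, so the decay is that of `F`. -/
theorem isSymbolOn_seeleyDeriv {β : ℝ} (hF : IsSymbolOn (Ici 0) β F) :
    IsSymbolOn univ β (seeleyDeriv d F 0) := by
  refine ⟨(contDiff_seeleyDeriv hF.1).contDiffOn, fun r => ?_⟩
  obtain ⟨Q, hQ0, hQ⟩ := d.exists_abs_inv_le
  obtain ⟨c, hc0, hc⟩ := hF.2 r
  obtain ⟨M, hM⟩ := (isCompact_Icc (a := -(2 * Q)) (b := 0)).exists_bound_of_continuousOn
    (f := seeleyDeriv d F r)
    (fun x _ => (hasDerivAt_seeleyDeriv hF.1 r x).continuousAt.continuousWithinAt)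
  have hM0 : 0 ≤ M := (norm_nonneg _).trans (hM 0 ⟨by linarith, le_rfl⟩)
  set K := bracket (2 * Q)
  have hK : 0 < K := bracket_pos _
  refine ⟨c + M * K ^ |(-(β - r))|, by positivity, fun x _ => ?_⟩
  rw [iteratedDerivWithin_univ, iteratedDeriv_seeleyDeriv hF.1, add_mul]
  have hb := bracket_pos x
  rcases le_or_gt 0 x with hx | hx
  · rw [seeleyDeriv, if_neg hx.not_gt]
    exact (hc x hx).trans (le_add_of_nonneg_right (by positivity))
  refine le_trans ?_ (le_add_of_nonneg_left (by positivity))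
  rcases lt_or_ge x (-(2 * Q)) with h | h
  · rw [seeleyDeriv_eq_zero hQ r h, norm_zero]
    positivity
  refine (hM x ⟨h, hx.le⟩).trans ?_
  rw [mul_assoc]
  refine le_mul_of_one_le_right hM0 ?_
  have h1 : bracket x ≤ K * 1 := by
    rw [mul_one]
    refine bracket_mono ?_
    rw [Real.norm_eq_abs, Real.norm_eq_abs, abs_of_neg hx, abs_of_pos (by linarith)]
    linarith
  have h2 : (1 : ℝ) ≤ K * bracket x := by
    nlinarith [one_le_bracket (2 * Q), one_le_bracket x]
  have h3 := rpow_le_of_comparable hK hb one_pos h1 h2 (-(β - r))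
  rw [Real.one_rpow, mul_one, Real.rpow_neg hb.le] at h3
  rwa [inv_le_iff_one_le_mul₀ (by positivity)] at h3

end SeeleyExtension

/-! ### Norm bounds for Seeley extensions -/

section SeeleyNorm

variable {F : ℝ → ℂ}

/-- Leibniz' rule, with a constant independent of `F`; all weights are comparable to `1` on the
support `[0, 2]` of `φ F`. -/
theorem exists_norm_cutDeriv_le_sum (d : SeeleyData) (r : ℕ) : ∃ C, 0 ≤ C ∧
    ∀ F : ℝ → ℂ, ContDiffOn ℝ ∞ F (Ici 0) → ∀ u, 0 ≤ u → ‖cutDeriv d F r u‖ ≤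
      C * ∑ j ∈ Finset.range (r + 1),
        ‖iteratedDerivWithin j F (Ici 0) u‖ * bracket u ^ ((j : ℝ) - 1) := by
  have hφ : ∀ i, ∃ D, ∀ u ∈ Icc (0 : ℝ) 2, ‖iteratedDerivWithin i d.φ (Ici 0) u‖ ≤ D := fun i =>
    isCompact_Icc.exists_bound_of_continuousOn
      ((continuousOn_iteratedDerivWithin d.φ_smooth.contDiffOn i).mono
        (Icc_subset_Ici_self : Icc (0 : ℝ) 2 ⊆ Ici 0))
  choose D hD using hφ
  have hD0 : ∀ i, 0 ≤ D i := fun i => (norm_nonneg _).trans (hD i 0 (by simp))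
  refine ⟨3 * ∑ j ∈ Finset.range (r + 1), (r.choose j : ℝ) * D (r - j), ?_, fun F hF u hu => ?_⟩
  · exact mul_nonneg (by norm_num)
      (Finset.sum_nonneg fun j _ => mul_nonneg (Nat.cast_nonneg _) (hD0 _))
  have hb := bracket_pos u
  have hS : 0 ≤ ∑ j ∈ Finset.range (r + 1),
      ‖iteratedDerivWithin j F (Ici 0) u‖ * bracket u ^ ((j : ℝ) - 1) :=
    Finset.sum_nonneg fun j _ => by positivity
  rcases le_or_gt u 2 with h | h
  · have key := norm_iteratedFDerivWithin_mul_le hF (d.φ_smooth.contDiffOn (s := Ici 0))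
      (uniqueDiffOn_Ici 0) hu (n := r) (by exact_mod_cast le_top)
    simp only [norm_iteratedFDerivWithin_eq_norm_iteratedDerivWithin] at key
    have e : cutDeriv d F r u = iteratedDerivWithin r (fun y => F y * d.φ y) (Ici 0) u := by
      rw [cutDeriv]
      congr 1
      exact funext fun y => mul_comm _ _
    rw [e]
    refine key.trans ?_
    rw [mul_assoc, Finset.sum_mul, Finset.mul_sum]
    refine Finset.sum_le_sum fun j hj => ?_
    have h3 : bracket u ≤ 3 := by
      rw [bracket, Real.sqrt_le_left (by norm_num), Real.norm_eq_abs, sq_abs]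
      nlinarith
    -- the weight `⟨u⟩^(j - 1)` is at least `1/3` on `[0, 2]`
    have h1 : 1 ≤ 3 * bracket u ^ ((j : ℝ) - 1) := by
      have h4 : bracket u ^ (-1 : ℝ) ≤ bracket u ^ ((j : ℝ) - 1) :=
        Real.rpow_le_rpow_of_exponent_le (one_le_bracket u)
          (by linarith [Nat.cast_nonneg (α := ℝ) j])
      rw [Real.rpow_neg_one] at h4
      have h5 : 1 ≤ 3 * (bracket u)⁻¹ := by
        rw [← div_eq_mul_inv, one_le_div hb]
        exact h3
      linarith
    have h2 : ‖iteratedDerivWithin j F (Ici 0) u‖ * bracket u ^ ((j : ℝ) - 1) ≤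
        ∑ j ∈ Finset.range (r + 1),
          ‖iteratedDerivWithin j F (Ici 0) u‖ * bracket u ^ ((j : ℝ) - 1) :=
      Finset.single_le_sum (f := fun j : ℕ => ‖iteratedDerivWithin j F (Ici 0) u‖ *
        bracket u ^ ((j : ℝ) - 1)) (fun _ _ => by positivity) hj
    calc (r.choose j : ℝ) * ‖iteratedDerivWithin j F (Ici 0) u‖ *
          ‖iteratedDerivWithin (r - j) d.φ (Ici 0) u‖
        ≤ (r.choose j : ℝ) * (‖iteratedDerivWithin j F (Ici 0) u‖ *
            (3 * bracket u ^ ((j : ℝ) - 1))) * D (r - j) := by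
          gcongr
          · exact le_mul_of_one_le_right (norm_nonneg _) h1
          · exact hD _ u ⟨hu, h⟩
      _ = 3 * ((r.choose j : ℝ) * D (r - j) *
            (‖iteratedDerivWithin j F (Ici 0) u‖ * bracket u ^ ((j : ℝ) - 1))) := by ring
      _ ≤ _ := by
          have := hD0 (r - j)
          gcongr
  · rw [cutDeriv_eq_zero r h, norm_zero]
    refine mul_nonneg (mul_nonneg (by norm_num) ?_) hS
    exact Finset.sum_nonneg fun j _ => mul_nonneg (Nat.cast_nonneg _) (hD0 _)

theorem integrableOn_cutDeriv (d : SeeleyData) (hF : ContDiffOn ℝ ∞ F (Ici 0)) (r : ℕ) :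
    IntegrableOn (cutDeriv d F r) (Ici 0) := by
  have h1 : IntegrableOn (cutDeriv d F r) (Icc 0 2) :=
    ((continuousOn_iteratedDerivWithin (contDiffOn_cut (d := d) hF) r).mono
      (Icc_subset_Ici_self : Icc (0 : ℝ) 2 ⊆ Ici 0)).integrableOn_Icc
  have h2 : IntegrableOn (cutDeriv d F r) (Ioi 2) :=
    integrableOn_zero.congr_fun (fun u hu => (cutDeriv_eq_zero r hu).symm) measurableSet_Ioi
  refine (h1.union h2).mono_set fun u hu => ?_
  rcases le_or_gt u 2 with h | h
  · exact Or.inl ⟨hu, h⟩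
  · exact Or.inr h

theorem continuous_seeleyDeriv (d : SeeleyData) (hF : ContDiffOn ℝ ∞ F (Ici 0)) (r : ℕ) :
    Continuous (seeleyDeriv d F r) :=
  continuous_iff_continuousAt.2 fun x => (hasDerivAt_seeleyDeriv hF r x).continuousAt

/-- The integral of the series over `(-∞, 0)` is computed term by term; the substitution
`u = bₖ x` turns each term into the integral of `cutDeriv` over `[0, ∞)`. -/
theorem exists_setIntegral_seeleyDeriv_le (d : SeeleyData) (r : ℕ) : ∃ C, 0 ≤ C ∧
    ∀ F : ℝ → ℂ, ContDiffOn ℝ ∞ F (Ici 0) →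
      ∫ x in Iio 0, ‖seeleyDeriv d F r x‖ * bracket x ^ ((r : ℝ) - 1) ≤
        C * ∫ u in Ici 0, ‖cutDeriv d F r u‖ := by
  obtain ⟨Q, hQ0, hQ⟩ := d.exists_abs_inv_le
  set W : ℝ := bracket (2 * Q) ^ (r : ℝ)
  have hW : 0 ≤ W := Real.rpow_nonneg (bracket_pos _).le _
  have hA : 0 ≤ ∑' k, |d.a k| * |d.b k| ^ r := tsum_nonneg fun k => by positivity
  refine ⟨(∑' k, |d.a k| * |d.b k| ^ r) * (W * Q), by positivity, fun F hF => ?_⟩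
  set J := ∫ u in Ici 0, ‖cutDeriv d F r u‖ with hJ
  have hJ0 : 0 ≤ J := integral_nonneg fun _ => norm_nonneg _
  -- `G(bₖ x)` is supported in `x ≤ 0`, so the terms can be integrated over all of `ℝ`
  set G : ℝ → ℝ := (Ici 0).indicator fun u => ‖cutDeriv d F r u‖ with hG
  have hG0 : ∀ u, 0 ≤ G u := indicator_nonneg fun _ _ => norm_nonneg _
  have hGi : Integrable G :=
    (integrable_indicator_iff measurableSet_Ici).2 (integrableOn_cutDeriv d hF r).norm
  have hGJ : ∫ u, G u = J := integral_indicator measurableSet_Ici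
  set T : ℕ → ℝ → ℝ := fun k x => |d.a k| * |d.b k| ^ r * W * G (d.b k * x) with hT
  have hT0 : ∀ k x, 0 ≤ T k x := fun k x => by
    have := hG0 (d.b k * x)
    positivity
  have hTi : ∀ k, Integrable (T k) := fun k => (hGi.comp_mul_left' (d.b_neg k).ne).const_mul _
  have hTJ : ∀ k, ∫ x, T k x ≤ |d.a k| * |d.b k| ^ r * (W * Q * J) := fun k => by
    rw [hT]
    simp only
    rw [integral_const_mul, Measure.integral_comp_mul_left, hGJ, abs_inv, smul_eq_mul]
    have := hQ k
    calc _ = |d.a k| * |d.b k| ^ r * (W * |d.b k|⁻¹ * J) := by ring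
      _ ≤ _ := by gcongr
  have hb0 : ∀ x, 0 ≤ ‖seeleyDeriv d F r x‖ * bracket x ^ ((r : ℝ) - 1) := fun x =>
    mul_nonneg (norm_nonneg _) (Real.rpow_nonneg (bracket_pos x).le _)
  have hpt : ∀ x ∈ Iio (0 : ℝ), ENNReal.ofReal (‖seeleyDeriv d F r x‖ *
      bracket x ^ ((r : ℝ) - 1)) ≤ ∑' k, ENNReal.ofReal (T k x) := by
    intro x hx
    have hb := bracket_pos x
    rcases lt_or_ge x (-(2 * Q)) with h | h
    · simp [seeleyDeriv_eq_zero hQ r h]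
    have hw : bracket x ^ ((r : ℝ) - 1) ≤ W := by
      refine (Real.rpow_le_rpow_of_exponent_le (one_le_bracket x)
        (by linarith : (r : ℝ) - 1 ≤ r)).trans ?_
      refine Real.rpow_le_rpow hb.le (bracket_mono ?_) r.cast_nonneg
      rw [Real.norm_eq_abs, Real.norm_eq_abs, abs_of_neg hx, abs_of_pos (by linarith)]
      linarith
    have hs := (summable_seeleyTerm (d := d) hF r hx).norm
    have hterm : ∀ k, ‖((d.a k * d.b k ^ r : ℝ) : ℂ) * cutDeriv d F r (d.b k * x)‖ * W =
        T k x := fun k => by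
      rw [hT, hG]
      simp only
      rw [indicator_of_mem (mem_Ici.2 (d.mul_pos_of_neg k hx).le), norm_mul, Complex.norm_real,
        Real.norm_eq_abs, abs_mul, abs_pow]
      ring
    rw [← ENNReal.ofReal_tsum_of_nonneg (fun k => hT0 k x)
      ((hs.mul_right W).congr hterm)]
    refine ENNReal.ofReal_le_ofReal ?_
    rw [← tsum_congr hterm, tsum_mul_right, seeleyDeriv, if_pos (mem_Iio.1 hx)]
    gcongr
    exact norm_tsum_le_tsum_norm hs
  have hsum : Summable fun k => |d.a k| * |d.b k| ^ r * (W * Q * J) :=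
    (d.summable r).mul_right _
  rw [integral_eq_lintegral_of_nonneg_ae (Eventually.of_forall hb0)]
  · refine ENNReal.toReal_le_of_le_ofReal (by positivity) ?_
    calc ∫⁻ x in Iio 0, ENNReal.ofReal (‖seeleyDeriv d F r x‖ * bracket x ^ ((r : ℝ) - 1))
        ≤ ∫⁻ x in Iio 0, ∑' k, ENNReal.ofReal (T k x) := setLIntegral_mono' measurableSet_Iio hpt
      _ ≤ ∫⁻ x, ∑' k, ENNReal.ofReal (T k x) := setLIntegral_le_lintegral _ _
      _ = ∑' k, ∫⁻ x, ENNReal.ofReal (T k x) :=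
          lintegral_tsum fun k => (hTi k).aestronglyMeasurable.aemeasurable.ennreal_ofReal
      _ = ∑' k, ENNReal.ofReal (∫ x, T k x) := tsum_congr fun k =>
          (ofReal_integral_eq_lintegral_ofReal (hTi k) (Eventually.of_forall (hT0 k))).symm
      _ ≤ ∑' k, ENNReal.ofReal (|d.a k| * |d.b k| ^ r * (W * Q * J)) :=
          ENNReal.tsum_le_tsum fun k => ENNReal.ofReal_le_ofReal (hTJ k)
      _ = ENNReal.ofReal ((∑' k, |d.a k| * |d.b k| ^ r) * (W * Q) * J) := by
          rw [← ENNReal.ofReal_tsum_of_nonneg (fun k => by positivity) hsum, tsum_mul_right]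
          congr 1
          ring
  · exact ((continuous_seeleyDeriv d hF r).norm.mul
      (continuous_bracket.rpow_const fun x => Or.inl (bracket_pos x).ne')).aestronglyMeasurable

theorem integrable_norm_iteratedDeriv_mul {f : ℝ → ℂ} {β : ℝ} (hβ : β < 0)
    (hf : IsSymbolOn univ β f) (r : ℕ) :
    Integrable fun x => ‖iteratedDeriv r f x‖ * bracket x ^ ((r : ℝ) - 1) := by
  refine (integrable_normDensity hβ hf r).mono' ((contDiff_iteratedDeriv hf.contDiff
    r).continuous.norm.mul (continuous_bracket.rpow_const
      fun x => Or.inl (bracket_pos x).ne')).aestronglyMeasurable (Eventually.of_forall fun x => ?_)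
  have h0 : ∀ j : ℕ, 0 ≤ ‖iteratedDeriv j f x‖ * bracket x ^ ((j : ℝ) - 1) := fun j =>
    mul_nonneg (norm_nonneg _) (Real.rpow_nonneg (bracket_pos x).le _)
  rw [Real.norm_of_nonneg (h0 r)]
  exact Finset.single_le_sum (f := fun j : ℕ => ‖iteratedDeriv j f x‖ *
    bracket x ^ ((j : ℝ) - 1)) (fun j _ => h0 j) (by simp)

/-- Seeley's extension is bounded for the norms `‖·‖ₙ`. -/
theorem exists_integral_normDensity_seeleyDeriv_le (d : SeeleyData) (n : ℕ) : ∃ C, 0 ≤ C ∧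
    ∀ (β : ℝ) (F : ℝ → ℂ), β < 0 → IsSymbolOn (Ici 0) β F →
      ∫ x, normDensity n (seeleyDeriv d F 0) x ≤ C * ∑ r ∈ Finset.range (n + 1),
        ∫ x in Ici 0, ‖iteratedDerivWithin r F (Ici 0) x‖ * bracket x ^ ((r : ℝ) - 1) := by
  choose C hC0 hC using exists_setIntegral_seeleyDeriv_le d
  choose D hD0 hD using exists_norm_cutDeriv_le_sum d
  refine ⟨∑ r ∈ Finset.range (n + 1), (C r * D r + 1), Finset.sum_nonneg fun r _ =>
    add_nonneg (mul_nonneg (hC0 r) (hD0 r)) zero_le_one, fun β F hβ hF => ?_⟩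
  have hsym := isSymbolOn_seeleyDeriv (d := d) hF
  have hint := integrable_norm_iteratedDeriv_mul hβ hsym
  simp only [iteratedDeriv_seeleyDeriv hF.1] at hint
  set N : ℕ → ℝ := fun r =>
    ∫ x in Ici 0, ‖iteratedDerivWithin r F (Ici 0) x‖ * bracket x ^ ((r : ℝ) - 1) with hN
  have hnn : ∀ (r : ℕ) (x : ℝ),
      0 ≤ ‖iteratedDerivWithin r F (Ici 0) x‖ * bracket x ^ ((r : ℝ) - 1) := fun r x =>
    mul_nonneg (norm_nonneg _) (Real.rpow_nonneg (bracket_pos x).le _)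
  have hN0 : ∀ r, 0 ≤ N r := fun r => integral_nonneg (hnn r)
  have heq : ∀ r : ℕ, EqOn (fun x => ‖seeleyDeriv d F r x‖ * bracket x ^ ((r : ℝ) - 1))
      (fun x => ‖iteratedDerivWithin r F (Ici 0) x‖ * bracket x ^ ((r : ℝ) - 1)) (Ici 0) :=
    fun r x hx => by
      simp only
      rw [seeleyDeriv, if_neg (mem_Ici.1 hx).not_gt]
  have hint' : ∀ r : ℕ, IntegrableOn
      (fun x => ‖iteratedDerivWithin r F (Ici 0) x‖ * bracket x ^ ((r : ℝ) - 1)) (Ici 0) :=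
    fun r => (hint r).integrableOn.congr_fun (heq r) measurableSet_Ici
  have hcut : ∀ r ∈ Finset.range (n + 1), ∫ u in Ici 0, ‖cutDeriv d F r u‖ ≤
      D r * ∑ j ∈ Finset.range (n + 1), N j := by
    intro r hr
    calc ∫ u in Ici 0, ‖cutDeriv d F r u‖ ≤ ∫ u in Ici 0, D r * ∑ j ∈ Finset.range (r + 1),
          ‖iteratedDerivWithin j F (Ici 0) u‖ * bracket u ^ ((j : ℝ) - 1) :=
          setIntegral_mono_on (integrableOn_cutDeriv d hF.1 r).norm
            ((integrable_finsetSum _ fun j _ => hint' j).const_mul _) measurableSet_Ici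
            fun u hu => hD r F hF.1 u hu
      _ = D r * ∑ j ∈ Finset.range (r + 1), N j := by
          rw [integral_const_mul, integral_finsetSum _ fun j _ => hint' j]
      _ ≤ _ := by
          refine mul_le_mul_of_nonneg_left (Finset.sum_le_sum_of_subset_of_nonneg
            (Finset.range_mono (by have := Finset.mem_range.1 hr; omega)) fun j _ _ => hN0 j)
            (hD0 r)
  unfold normDensity
  simp only [iteratedDeriv_seeleyDeriv hF.1]
  rw [integral_finsetSum _ fun r _ => hint r, Finset.sum_mul]
  refine Finset.sum_le_sum fun r hr => ?_
  rw [← integral_add_compl (measurableSet_Iio (a := (0 : ℝ))) (hint r), compl_Iio, add_mul,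
    one_mul]
  refine add_le_add ?_ ?_
  · refine (hC r F hF.1).trans ?_
    rw [mul_assoc]
    exact mul_le_mul_of_nonneg_left (hcut r hr) (hC0 r)
  · rw [setIntegral_congr_fun measurableSet_Ici (heq r)]
    exact Finset.single_le_sum (f := N) (fun j _ => hN0 j) hr

/-- Seeley's extension as a linear map `𝒜⁺ → 𝒜`. -/
def seeleyMap (d : SeeleyData) : halfLineAlgebra →ₗ[ℂ] lineAlgebra where
  toFun f := ⟨seeleyExt d f, by
    obtain ⟨β, hβ, hf⟩ := f.2
    refine ⟨β, hβ, ?_⟩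
    rw [seeleyExt_eq_seeleyDeriv]
    exact isSymbolOn_seeleyDeriv hf⟩
  map_add' f g := by
    refine Subtype.ext (funext fun x => ?_)
    obtain ⟨β, hβ, hf⟩ := f.2
    obtain ⟨β', hβ', hg⟩ := g.2
    change seeleyExt d ((f : Ici (0 : ℝ) → ℂ) + g) x = seeleyExt d f x + seeleyExt d g x
    unfold seeleyExt
    split_ifs with hx
    · have hsf := summable_seeleyTerm (d := d) hf.1 0 hx
      have hsg := summable_seeleyTerm (d := d) hg.1 0 hx
      simp only [pow_zero, mul_one, cutDeriv, iteratedDerivWithin_zero] at hsf hsg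
      rw [← hsf.tsum_add hsg]
      refine tsum_congr fun k => ?_
      simp only [IciExtend, Function.comp_apply, Pi.add_apply]
      ring
    · rfl
  map_smul' c f := by
    refine Subtype.ext (funext fun x => ?_)
    change seeleyExt d (c • (f : Ici (0 : ℝ) → ℂ)) x = c * seeleyExt d f x
    unfold seeleyExt
    split_ifs with hx
    · rw [← tsum_mul_left]
      refine tsum_congr fun k => ?_
      simp only [IciExtend, Function.comp_apply, Pi.smul_apply, smul_eq_mul]
      ring
    · rfl

theorem coe_seeleyMap (d : SeeleyData) (f : halfLineAlgebra) :
    (seeleyMap d f : ℝ → ℂ) = seeleyExt d f := rfl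

theorem seeleyMap_apply_of_nonneg (d : SeeleyData) (f : halfLineAlgebra) {x : ℝ} (hx : 0 ≤ x) :
    (seeleyMap d f : ℝ → ℂ) x = (f : Ici (0 : ℝ) → ℂ) ⟨x, hx⟩ := by
  rw [coe_seeleyMap, seeleyExt, if_neg hx.not_gt, IciExtend_of_mem _ hx]

theorem restrict_seeleyMap (d : SeeleyData) (f : halfLineAlgebra) :
    restrict (seeleyMap d f) = f :=
  Subtype.ext (funext fun x => seeleyMap_apply_of_nonneg d f x.2)

theorem exists_integral_normDensity_seeleyMap_le (d : SeeleyData) (n : ℕ) : ∃ C, 0 ≤ C ∧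
    ∀ f : halfLineAlgebra, ∫ x, normDensity n (seeleyMap d f : ℝ → ℂ) x ≤ C * halfLineNorm n f := by
  obtain ⟨C, hC0, hC⟩ := exists_integral_normDensity_seeleyDeriv_le d n
  refine ⟨C, hC0, fun f => ?_⟩
  obtain ⟨β, hβ, hf⟩ := f.2
  rw [coe_seeleyMap, seeleyExt_eq_seeleyDeriv]
  exact hC β _ hβ hf

end SeeleyNorm

/-! ### Resolvent functions are symbols -/

section ResolventFunctions

variable {w : ℂ}

theorem sub_ofReal_ne_zero (hw : w.im ≠ 0) (x : ℝ) : w - x ≠ 0 := fun h => hw <| by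
  simpa using congrArg Complex.im h

theorem hasDerivAt_inv_sub_ofReal (hw : w.im ≠ 0) (x : ℝ) :
    HasDerivAt (fun x : ℝ => (w - x)⁻¹) ((w - x)⁻¹ ^ 2) x := by
  have h := ((Complex.ofRealCLM.hasDerivAt (x := x)).const_sub w).fun_inv (sub_ofReal_ne_zero hw x)
  refine h.congr_deriv ?_
  simp

theorem iteratedDeriv_inv_sub_ofReal (hw : w.im ≠ 0) (n : ℕ) :
    iteratedDeriv n (fun x : ℝ => (w - x)⁻¹) =
      fun x : ℝ => (n.factorial : ℂ) * (w - x)⁻¹ ^ (n + 1) := by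
  induction n with
  | zero => simp
  | succ n ih =>
    rw [iteratedDeriv_succ, ih]
    funext x
    have h := ((hasDerivAt_inv_sub_ofReal hw x).fun_pow (n + 1)).const_mul (n.factorial : ℂ)
    rw [h.deriv, Nat.factorial_succ]
    push_cast
    ring

/-- The distance from `w` to `x` is comparable to `⟨x⟩`, since `w` is not real. -/
theorem isSymbolOn_inv_sub_ofReal (hw : w.im ≠ 0) :
    IsSymbolOn univ (-1) (fun x : ℝ => (w - x)⁻¹) := by
  have hw' : 0 < |w.im| := abs_pos.2 hw
  have hc : ContDiff ℝ ∞ (fun x : ℝ => (w - x)⁻¹) :=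
    (contDiff_const.sub Complex.ofRealCLM.contDiff).inv (sub_ofReal_ne_zero hw)
  refine ⟨hc.contDiffOn, fun n => ?_⟩
  set C : ℝ := (1 + ‖w‖) / |w.im| + 1
  have hC : 0 < C := by positivity
  refine ⟨n.factorial * C ^ (n + 1), by positivity, fun x _ => ?_⟩
  have hb := bracket_pos x
  have hd : 0 < ‖w - x‖ := norm_pos_iff.2 (sub_ofReal_ne_zero hw x)
  have h1 : |w.im| ≤ ‖w - x‖ := by
    have := Complex.abs_im_le_norm (w - x)
    simpa using this
  have h2 : bracket x ≤ C * ‖w - x‖ := by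
    have h3 : ‖x‖ ≤ ‖w‖ + ‖w - x‖ := by
      have := norm_sub_le w (w - x)
      rwa [sub_sub_cancel, Complex.norm_real] at this
    have h4 : 1 + ‖w‖ ≤ (1 + ‖w‖) / |w.im| * ‖w - x‖ := by
      rw [div_mul_eq_mul_div, le_div_iff₀ hw']
      gcongr
    calc bracket x ≤ 1 + ‖x‖ := bracket_le_one_add x
      _ ≤ (1 + ‖w‖) / |w.im| * ‖w - x‖ + ‖w - x‖ := by linarith
      _ = C * ‖w - x‖ := by ring
  have h5 : ‖w - x‖⁻¹ ≤ C * (bracket x)⁻¹ := by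
    rw [← div_eq_mul_inv, le_div_iff₀ hb, inv_mul_le_iff₀ hd, mul_comm]
    exact h2
  rw [iteratedDerivWithin_univ, iteratedDeriv_inv_sub_ofReal hw, norm_mul, norm_pow, norm_inv,
    Complex.norm_natCast, mul_assoc]
  have h6 : bracket x ^ ((-1 : ℝ) - n) = (bracket x)⁻¹ ^ (n + 1) := by
    rw [show (-1 : ℝ) - n = -((n + 1 : ℕ) : ℝ) by push_cast; ring, Real.rpow_neg hb.le,
      Real.rpow_natCast, inv_pow]
  rw [h6, ← mul_pow]
  gcongr

end ResolventFunctions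

/-! ### The functional calculus -/

section Calculus

variable {B : Type*} [NormedAddCommGroup B] [NormedSpace ℂ B] [CompleteSpace B]
  {H : B →ₗ.[ℂ] B} {α : ℝ} {n n' : ℕ} {τ τ' : ℝ → ℝ → ℂ}

theorem lineAlgebra_contDiff (F : lineAlgebra) : ContDiff ℝ ∞ (F : ℝ → ℂ) := by
  obtain ⟨β, -, hF⟩ := F.2
  exact hF.contDiff

theorem exists_almostAnalytic_aaExt (F : lineAlgebra) (hτ : IsCutoff τ) (n : ℕ) :
    ∃ β < 0, AlmostAnalytic β n (aaExt n τ F) := by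
  obtain ⟨β, hβ, hF⟩ := F.2
  exact ⟨β, hβ, almostAnalytic_aaExt hτ hF n⟩

theorem integrable_hsIntegrand (hH : ResolventHypothesis H α) (hα : 0 ≤ α) (hn : α < n)
    (hτ : IsCutoff τ) (F : lineAlgebra) : Integrable (hsIntegrand H n τ F) := by
  obtain ⟨β, hβ, hF⟩ := exists_almostAnalytic_aaExt F hτ n
  refine (hF.integrable hH hα hβ hn).congr (Eventually.of_forall fun z => ?_)
  simp only [hsIntegrand, dbar_almostAnalyticExt hτ (lineAlgebra_contDiff F)]

/-- The integral depends neither on `n`, nor on the cut-off, nor on the values on `(-∞, 0)`. -/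
theorem hsInt_aaExt_congr (hH : ResolventHypothesis H α) (hα : 0 ≤ α)
    (hspec : opSpectrum H ⊆ (fun x : ℝ => (x : ℂ)) '' Ici 0) (hn : α < n) (hn' : α < n')
    (hτ : IsCutoff τ) (hτ' : IsCutoff τ') {F G : lineAlgebra}
    (h : ∀ x : ℝ, 0 ≤ x → (F : ℝ → ℂ) x = (G : ℝ → ℂ) x) :
    hsInt H (aaExt n τ F) = hsInt H (aaExt n' τ' G) := by
  obtain ⟨β, hβ, hF⟩ := exists_almostAnalytic_aaExt F hτ n
  obtain ⟨β', hβ', hG⟩ := exists_almostAnalytic_aaExt G hτ' n'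
  refine hsInt_congr hH hα hspec hβ hβ' hn hn' hF hG fun x hx => ?_
  rw [aaExt_ofReal hτ, aaExt_ofReal hτ', h x hx]

theorem hsInt_aaExt_add (hH : ResolventHypothesis H α) (hα : 0 ≤ α)
    (hspec : opSpectrum H ⊆ (fun x : ℝ => (x : ℂ)) '' Ici 0) (hn : α < n) (hτ : IsCutoff τ)
    (F G : lineAlgebra) : hsInt H (aaExt n τ (F + G : lineAlgebra)) =
      hsInt H (aaExt n τ F) + hsInt H (aaExt n τ G) := by
  obtain ⟨β, hβ, hF⟩ := exists_almostAnalytic_aaExt F hτ n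
  obtain ⟨β', hβ', hG⟩ := exists_almostAnalytic_aaExt G hτ n
  obtain ⟨β'', hβ'', hFG⟩ := exists_almostAnalytic_aaExt (F + G) hτ n
  have hm : max β β' < 0 := max_lt hβ hβ'
  have hF' := hF.mono (le_max_left β β') le_rfl
  have hG' := hG.mono (le_max_right β β') le_rfl
  rw [← hsInt_add hH hα hm hn hF' hG']
  refine hsInt_congr hH hα hspec hβ'' hm hn hn hFG (hF'.add hG') fun x _ => ?_
  simp only [aaExt_ofReal hτ]
  rfl

theorem hsInt_aaExt_smul (hH : ResolventHypothesis H α) (hα : 0 ≤ α)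
    (hspec : opSpectrum H ⊆ (fun x : ℝ => (x : ℂ)) '' Ici 0) (hn : α < n) (hτ : IsCutoff τ)
    (c : ℂ) (F : lineAlgebra) : hsInt H (aaExt n τ (c • F : lineAlgebra)) =
      c • hsInt H (aaExt n τ F) := by
  obtain ⟨β, hβ, hF⟩ := exists_almostAnalytic_aaExt F hτ n
  obtain ⟨β', hβ', hcF⟩ := exists_almostAnalytic_aaExt (c • F) hτ n
  rw [← hsInt_const_smul c hF.differentiable]
  refine hsInt_congr hH hα hspec hβ' hβ hn hn hcF (hF.const_smul c) fun x _ => ?_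
  simp only [aaExt_ofReal hτ]
  rfl

theorem hsInt_aaExt_mul (hH : ResolventHypothesis H α) (hα : 0 ≤ α)
    (hspec : opSpectrum H ⊆ (fun x : ℝ => (x : ℂ)) '' Ici 0) (hn : α < n) (hτ : IsCutoff τ)
    {F G P : lineAlgebra}
    (h : ∀ x : ℝ, 0 ≤ x → (P : ℝ → ℂ) x = (F : ℝ → ℂ) x * (G : ℝ → ℂ) x) :
    hsInt H (aaExt n τ P) = hsInt H (aaExt n τ F) * hsInt H (aaExt n τ G) := by
  obtain ⟨β, hβ, hF⟩ := exists_almostAnalytic_aaExt F hτ n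
  obtain ⟨β', hβ', hG⟩ := exists_almostAnalytic_aaExt G hτ n
  obtain ⟨β'', hβ'', hP⟩ := exists_almostAnalytic_aaExt P hτ n
  rw [hsInt_mul hH hα hβ hβ' hn hF hG]
  refine hsInt_congr hH hα hspec hβ'' (add_neg hβ hβ') hn hn hP (hF.mul hG) fun x hx => ?_
  simp only [aaExt_ofReal hτ, h x hx]

/-- The functional calculus `γ_H : 𝒜⁺ → ℒ(ℬ)`, built from a choice of Seeley data `d`, an
order `n > α` and a cut-off `τ`. -/
def halfLineCalculus (hH : ResolventHypothesis H α) (hα : 0 ≤ α)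
    (hspec : opSpectrum H ⊆ (fun x : ℝ => (x : ℂ)) '' Ici 0) (hn : α < n) (hτ : IsCutoff τ)
    (d : SeeleyData) : halfLineAlgebra →ₙₐ[ℂ] (B →L[ℂ] B) where
  toFun f := hsInt H (aaExt n τ (seeleyMap d f))
  map_smul' c f := by
    rw [map_smul]
    exact hsInt_aaExt_smul hH hα hspec hn hτ c _
  map_zero' := by
    have h := hsInt_aaExt_smul hH hα hspec hn hτ 0 (seeleyMap d 0)
    rw [zero_smul, zero_smul] at h
    rw [map_zero]
    exact h
  map_add' f g := by
    rw [map_add]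
    exact hsInt_aaExt_add hH hα hspec hn hτ _ _
  map_mul' f g := hsInt_aaExt_mul hH hα hspec hn hτ fun x hx => by
    simp only [seeleyMap_apply_of_nonneg d _ hx]
    rfl

/-- A smooth cut-off, equal to `1` on the support of `f` and supported away from the spectrum,
replaces the extension of `f` by one whose support does not meet the spectrum. -/
theorem hsInt_aaExt_eq_zero (hH : ResolventHypothesis H α) (hα : 0 ≤ α)
    (hspec : opSpectrum H ⊆ (fun x : ℝ => (x : ℂ)) '' Ici 0) (hn : α < n) (hτ : IsCutoff τ)
    {f : halfLineAlgebra} (hfc : HasCompactSupport (f : Ici (0 : ℝ) → ℂ))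
    (hf : ∀ x ∈ tsupport (f : Ici (0 : ℝ) → ℂ), ((x : ℝ) : ℂ) ∉ opSpectrum H)
    {F : lineAlgebra} (hF : ∀ x : Ici (0 : ℝ), (F : ℝ → ℂ) x = (f : Ici (0 : ℝ) → ℂ) x) :
    hsInt H (aaExt n τ F) = 0 := by
  set K : Set ℝ := (fun x : Ici (0 : ℝ) => (x : ℝ)) '' tsupport (f : Ici (0 : ℝ) → ℂ)
  have hK : IsCompact K := hfc.isCompact.image continuous_subtype_val
  have hU : IsOpen {x : ℝ | (x : ℂ) ∉ opSpectrum H} :=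
    isClosed_opSpectrum.isOpen_compl.preimage Complex.continuous_ofReal
  have hKU : K ⊆ {x : ℝ | (x : ℂ) ∉ opSpectrum H} := by
    rintro _ ⟨x, hx, rfl⟩
    exact hf x hx
  obtain ⟨L, hL, hKL, hLU⟩ := exists_compact_between hK hU hKU
  obtain ⟨χ, hχ0, hχ1, -⟩ := exists_contMDiffMap_zero_one_of_isClosed
    (modelWithCornersSelf ℝ ℝ) (n := ⊤)
    isOpen_interior.isClosed_compl hK.isClosed (disjoint_compl_left_iff_subset.2 hKL)
  have hχL : ∀ x, x ∉ L → χ x = 0 := fun x hx => hχ0 fun h => hx (interior_subset h)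
  set g : ℝ → ℂ := fun x => (F : ℝ → ℂ) x * ((χ x : ℝ) : ℂ) with hg
  have hgL : ∀ x, g x ≠ 0 → x ∈ L := fun x hx => by
    by_contra h
    exact hx (by simp [hg, hχL x h])
  have hgc : ContDiff ℝ ∞ g := (lineAlgebra_contDiff F).mul
    (Complex.ofRealCLM.contDiff.comp χ.contMDiff.contDiff)
  have hgs : IsSymbolOn univ (-1) g := isSymbolOn_of_hasCompactSupport hgc
    (HasCompactSupport.of_support_subset_isCompact hL hgL) _
  have hn1 : (-1 : ℝ) < 0 := by norm_num
  rw [hsInt_aaExt_congr hH hα hspec hn hn hτ hτ (F := F) (G := ⟨g, -1, hn1, hgs⟩)]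
  · refine hsInt_eq_zero_of_trace hH hα hn1 hn (almostAnalytic_aaExt hτ hgs n) hL.isClosed
      (fun x hx => hLU hx) fun x hx => hgL x ?_
    rwa [aaExt_ofReal hτ] at hx
  · intro x hx
    change (F : ℝ → ℂ) x = (F : ℝ → ℂ) x * ((χ x : ℝ) : ℂ)
    by_cases h : (⟨x, hx⟩ : Ici (0 : ℝ)) ∈ tsupport (f : Ici (0 : ℝ) → ℂ)
    · have h1 : χ x = 1 := hχ1 ⟨_, h, rfl⟩
      simp [h1]
    · have h1 : (F : ℝ → ℂ) x = 0 := (hF ⟨x, hx⟩).trans (image_eq_zero_of_notMem_tsupport h)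
      simp [h1]

end Calculus

end HalfLineCalculus

end

open HalfLineCalculus

theorem mainTheorem6 {B : Type*} [NormedAddCommGroup B] [NormedSpace ℂ B] [CompleteSpace B]
    (H : B →ₗ.[ℂ] B) (α : ℝ) (hα : 0 ≤ α)
    (hH : HalfLineCalculus.ResolventHypothesis H α)
    (hspec : HalfLineCalculus.opSpectrum H ⊆ (fun x : ℝ => (x : ℂ)) '' Set.Ici 0) :
    ∃ γ : HalfLineCalculus.halfLineAlgebra →ₙₐ[ℂ] (B →L[ℂ] B),
      -- `γ f` is the Helffer–Sjöstrand integral of the Seeley extension of `f`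
      (Nonempty HalfLineCalculus.SeeleyData ∧
        ∀ d : HalfLineCalculus.SeeleyData,
          ∃ E : HalfLineCalculus.halfLineAlgebra →ₗ[ℂ] HalfLineCalculus.lineAlgebra,
            ∀ f : HalfLineCalculus.halfLineAlgebra,
              (E f : ℝ → ℂ) = HalfLineCalculus.seeleyExt d f ∧
              HalfLineCalculus.restrict (E f) = f ∧
              ∀ (n : ℕ) (τ : ℝ → ℝ → ℂ), α < n → HalfLineCalculus.IsCutoff τ →
                MeasureTheory.Integrable (HalfLineCalculus.hsIntegrand H n τ (E f)) ∧
                γ f = HalfLineCalculus.hsIntegral H n τ (E f)) ∧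
      -- on functions that come from `𝒜`, `γ` is the Helffer–Sjöstrand integral
      (∃ τ, HalfLineCalculus.IsCutoff τ) ∧
      (∀ (F : HalfLineCalculus.lineAlgebra) (n : ℕ) (τ : ℝ → ℝ → ℂ),
        α < n → HalfLineCalculus.IsCutoff τ →
          MeasureTheory.Integrable (HalfLineCalculus.hsIntegrand H n τ F) ∧
          γ (HalfLineCalculus.restrict F) = HalfLineCalculus.hsIntegral H n τ F) ∧
      -- norm bounds
      (∀ n : ℕ, α < n → ∃ c : ℝ, ∀ f : HalfLineCalculus.halfLineAlgebra,
        ‖γ f‖ ≤ c * HalfLineCalculus.halfLineNorm (n + 1) f) ∧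
      -- functions of compact support disjoint from the spectrum are sent to `0`
      (∀ f : HalfLineCalculus.halfLineAlgebra,
        HasCompactSupport (f : Set.Ici (0 : ℝ) → ℂ) →
        (∀ x ∈ tsupport (f : Set.Ici (0 : ℝ) → ℂ),
          ((x : ℝ) : ℂ) ∉ HalfLineCalculus.opSpectrum H) → γ f = 0) ∧
      -- resolvent functions are sent to resolvents
      (∀ z : ℂ, z.im ≠ 0 → ∃ g : HalfLineCalculus.halfLineAlgebra,
        (∀ x : Set.Ici (0 : ℝ), (g : Set.Ici (0 : ℝ) → ℂ) x = (z - ((x : ℝ) : ℂ))⁻¹) ∧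
        γ g = HalfLineCalculus.opResolvent H z) := by
  obtain ⟨n₀, hn₀⟩ := exists_nat_gt α
  obtain ⟨τ₀, hτ₀⟩ := exists_isCutoff
  obtain ⟨d₀⟩ := nonempty_seeleyData
  -- any extension of `f` to `𝒜`, any order `n > α` and any cut-off compute `γ f`
  have hγ : ∀ (f : halfLineAlgebra) (F : lineAlgebra) (n : ℕ) (τ : ℝ → ℝ → ℂ), α < n →
      IsCutoff τ → (∀ x : Set.Ici (0 : ℝ), (F : ℝ → ℂ) x = (f : Set.Ici (0 : ℝ) → ℂ) x) →
      halfLineCalculus hH hα hspec hn₀ hτ₀ d₀ f = hsInt H (aaExt n τ F) :=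
    fun f F n τ hn hτ h => hsInt_aaExt_congr hH hα hspec hn₀ hn hτ₀ hτ fun x hx =>
      (seeleyMap_apply_of_nonneg d₀ f hx).trans (h ⟨x, hx⟩).symm
  refine ⟨halfLineCalculus hH hα hspec hn₀ hτ₀ d₀, ⟨⟨d₀⟩, fun d => ⟨seeleyMap d, fun f =>
    ⟨rfl, restrict_seeleyMap d f, fun n τ hn hτ =>
      ⟨integrable_hsIntegrand hH hα hn hτ _, ?_⟩⟩⟩⟩, ⟨τ₀, hτ₀⟩, fun F n τ hn hτ =>
    ⟨integrable_hsIntegrand hH hα hn hτ F, ?_⟩, fun n hn => ?_, fun f hfc hf =>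
    hsInt_aaExt_eq_zero hH hα hspec hn₀ hτ₀ hfc hf fun x => seeleyMap_apply_of_nonneg d₀ f x.2,
    fun z hz => ?_⟩
  · rw [hsIntegral_eq_hsInt H hτ (lineAlgebra_contDiff _)]
    exact hγ f _ n τ hn hτ fun x => seeleyMap_apply_of_nonneg d f x.2
  · rw [hsIntegral_eq_hsInt H hτ (lineAlgebra_contDiff _)]
    exact hγ _ F n τ hn hτ fun x => rfl
  · obtain ⟨K, hK0, hK⟩ := exists_norm_hsInt_aaExt_le hH hα hτ₀ hn
    obtain ⟨C, -, hC⟩ := exists_integral_normDensity_seeleyMap_le d₀ (n + 1)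
    refine ⟨K * C, fun f => ?_⟩
    rw [hγ f (seeleyMap d₀ f) n τ₀ hn hτ₀ fun x => seeleyMap_apply_of_nonneg d₀ f x.2, mul_assoc]
    obtain ⟨β, hβ, hf⟩ := (seeleyMap d₀ f).2
    exact (hK β _ hβ hf).trans (mul_le_mul_of_nonneg_left (hC f) hK0)
  · have hz1 : (-1 : ℝ) < 0 := by norm_num
    let G : lineAlgebra := ⟨fun x : ℝ => (z - x)⁻¹, -1, hz1, isSymbolOn_inv_sub_ofReal hz⟩
    refine ⟨restrict G, fun x => rfl, ?_⟩
    -- `F` has the same trace as the almost analytic extension of `G`, and its integral is known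
    obtain ⟨F, hF, hFx, hFR⟩ := exists_almostAnalytic_resolvent hH hz n₀
    rw [hγ (restrict G) G n₀ τ₀ hn₀ hτ₀ fun x => rfl, ← hFR]
    refine hsInt_congr hH hα hspec hz1 hz1 hn₀ hn₀
      (almostAnalytic_aaExt hτ₀ (isSymbolOn_inv_sub_ofReal hz) n₀) hF fun x _ => ?_
    rw [aaExt_ofReal hτ₀, hFx]
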